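/- Let $M$ be a smooth manifold of dimension $m$. Let $\Omega^k(M)$ and $\Omega^k(M;TM)$ be the spaces of smooth $k$-forms on $M$ with values in $\mathbb R$ and in $TM$; both are $0$ for $k<0$ and for $k>m$. Let $[\ ,\ ]$ be the Frölicher–Nijenhuis bracket on $\Omega(M;TM)=\bigoplus_k\Omega^k(M;TM)$, let $\mathbf I=\mathrm{Id}_{TM}\in\Omega^1(M;TM)$, and let $c:\Omega^k(M;TM)\to\Omega^{k-1}(M)$ be the contraction, $c(\varphi\otimes X)=i_X\varphi$. Put $\mathcal C^k(M)=\ker\big(c|_{\Omega^k(M;TM)}\big)$ (the traceless vector valued $k$-forms) and $\mathcal C(M)=\bigoplus_k\mathcal C^k(M)$. For $K\in\Omega^k(M;TM)$ and $L\in\Omega^\ell(M;TM)$ put $$\delta(K)=(-1)^{k-1}\,d\,c(K)\wedge\mathbf I\in\Omega^{k+1}(M;TM),\qquad [K,L]^c=[K,L]-\tfrac{(-1)^\ell}{m-k-\ell+1}\,dS(K,L)\wedge\mathbf I ,$$ where $S(\varphi\otimes X,\psi\otimes Y)=i_Y\varphi\wedge i_X\psi$ (if $k+\ell>m$, then $[K,L]^c=0$).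 Then: 1. $\delta\circ\delta=0$, and the Frölicher–Nijenhuis bracket induces a bracket $H^k(\Omega(M;TM),\delta)\times H^\ell(\Omega(M;TM),\delta)\to H^{k+\ell}(\Omega(M;TM),\delta)$ which makes $H(\Omega(M;TM),\delta)=\bigoplus_kH^k(\Omega(M;TM),\delta)$ a graded Lie algebra. The bracket $[\ ,\ ]^c$ maps $\mathcal C^k(M)\times\mathcal C^\ell(M)$ to $\mathcal C^{k+\ell}(M)$ and makes $\mathcal C(M)$ a graded Lie algebra. 2. For $0\le k<m$ the map $([\varphi],K')\mapsto[\varphi\wedge\mathbf I+K']$ is a well-defined linear isomorphism $$H^{k-1}_{dR}(M)\oplus\mathcal C^k(M)\;\cong\;H^k(\Omega(M;TM),\delta),\qquad H^{-1}_{dR}(M)=0 .$$ In the top degree $m\ge1$ there is a linear isomorphism $H^m(\Omega(M;TM),\delta)\cong\big(\Omega^{m-1}(M)/d\Omega^{m-2}(M)\big)\oplus\mathcal C^m(M)$. 3. In the degrees $k,\ell<m$ the induced bracket corresponds to the direct product of the abelian algebra $H^{*-1}_{dR}(M)$ and of the graded Lie algebra $(\mathcal C(M),[\ ,\ ]^c)$: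 if $k+\ell<m$, then, under the isomorphisms of 2, $$[(\alpha,K'),(\beta,L')]=(0,[K',L']^c),$$ and if $k+\ell\ge m$, then $\mathcal C^{k+\ell}(M)=0$ and the induced bracket $H^k\times H^\ell\to H^{k+\ell}$ is zero. -/

import Mathlib

noncomputable section

namespace FN

/-! ### Alternating forms on a finite-dimensional vector space -/

section Algebra

variable {E F G H : Type*} [NormedAddCommGroup E] [NormedSpace ℝ E]
  [NormedAddCommGroup F] [NormedSpace ℝ F] [NormedAddCommGroup G] [NormedSpace ℝ G]
  [NormedAddCommGroup H] [NormedSpace ℝ H]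

/-- The multilinear map `v ↦ B (a (v₁, …, v_k)) (b (v_{k+1}, …, v_{k+l}))`. -/
def tensorForm {k l : ℕ} (B : F →L[ℝ] G →L[ℝ] H) (a : E [⋀^Fin k]→L[ℝ] F)
    (b : E [⋀^Fin l]→L[ℝ] G) : ContinuousMultilinearMap ℝ (fun _ : Fin (k + l) => E) H where
  toFun v := B (a fun i => v (Fin.castAdd l i)) (b fun i => v (Fin.natAdd k i))
  map_update_add' := by
    intro inst v i x y
    obtain rfl : inst = instDecidableEqFin _ := Subsingleton.elim _ _
    have hL (j : Fin k) (z : E) : (fun i => Function.update v (Fin.castAdd l j) z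
        (Fin.castAdd l i)) = Function.update (fun i => v (Fin.castAdd l i)) j z := by
      ext1 i; simp [Function.update_apply]
    have hL' (j : Fin k) (z : E) : (fun i => Function.update v (Fin.castAdd l j) z
        (Fin.natAdd k i)) = (fun i => v (Fin.natAdd k i)) := by
      ext1 i; simp [Function.update_apply, Fin.ext_iff]; omega
    have hR (j : Fin l) (z : E) : (fun i => Function.update v (Fin.natAdd k j) z
        (Fin.natAdd k i)) = Function.update (fun i => v (Fin.natAdd k i)) j z := by
      ext1 i; simp [Function.update_apply]
    have hR' (j : Fin l) (z : E) : (fun i => Function.update v (Fin.natAdd k j) z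
        (Fin.castAdd l i)) = (fun i => v (Fin.castAdd l i)) := by
      ext1 i; simp [Function.update_apply, Fin.ext_iff]; omega
    refine Fin.addCases (fun j => ?_) (fun j => ?_) i
    · rw [hL, hL', hL, hL', hL, hL']; simp
    · rw [hR, hR', hR, hR', hR, hR']; simp
  map_update_smul' := by
    intro inst v i c x
    obtain rfl : inst = instDecidableEqFin _ := Subsingleton.elim _ _
    have hL (j : Fin k) (z : E) : (fun i => Function.update v (Fin.castAdd l j) z
        (Fin.castAdd l i)) = Function.update (fun i => v (Fin.castAdd l i)) j z := by
      ext1 i; simp [Function.update_apply]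
    have hL' (j : Fin k) (z : E) : (fun i => Function.update v (Fin.castAdd l j) z
        (Fin.natAdd k i)) = (fun i => v (Fin.natAdd k i)) := by
      ext1 i; simp [Function.update_apply, Fin.ext_iff]; omega
    have hR (j : Fin l) (z : E) : (fun i => Function.update v (Fin.natAdd k j) z
        (Fin.natAdd k i)) = Function.update (fun i => v (Fin.natAdd k i)) j z := by
      ext1 i; simp [Function.update_apply]
    have hR' (j : Fin l) (z : E) : (fun i => Function.update v (Fin.natAdd k j) z
        (Fin.castAdd l i)) = (fun i => v (Fin.castAdd l i)) := by
      ext1 i; simp [Function.update_apply, Fin.ext_iff]; omega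
    refine Fin.addCases (fun j => ?_) (fun j => ?_) i
    · rw [hL, hL', hL, hL']; simp
    · rw [hR, hR', hR, hR']; simp
  cont := by
    have h1 : Continuous fun v : Fin (k + l) → E => a fun i => v (Fin.castAdd l i) :=
      a.cont.comp (by fun_prop)
    have h2 : Continuous fun v : Fin (k + l) → E => b fun i => v (Fin.natAdd k i) :=
      b.cont.comp (by fun_prop)
    exact (B.continuous.comp h1).clm_apply h2

/-- The wedge product of vector-valued alternating forms with respect to a bilinear pairing `B`:
`(a ∧ b)(v) = 1/(k! l!) ∑_σ sign σ • B (a (v_{σ 1}, …)) (b (v_{σ (k+1)}, …))`. -/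
def wedge {k l : ℕ} (B : F →L[ℝ] G →L[ℝ] H) (a : E [⋀^Fin k]→L[ℝ] F)
    (b : E [⋀^Fin l]→L[ℝ] G) : E [⋀^Fin (k + l)]→L[ℝ] H :=
  ((k.factorial * l.factorial : ℝ)⁻¹) •
    ContinuousMultilinearMap.alternatization (tensorForm B a b)

theorem wedge_apply {k l : ℕ} (B : F →L[ℝ] G →L[ℝ] H) (a : E [⋀^Fin k]→L[ℝ] F)
    (b : E [⋀^Fin l]→L[ℝ] G) (v : Fin (k + l) → E) :
    wedge B a b v = ((k.factorial * l.factorial : ℝ)⁻¹) • ∑ σ : Equiv.Perm (Fin (k + l)),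
      Equiv.Perm.sign σ • B (a fun i => v (σ (Fin.castAdd l i)))
        (b fun i => v (σ (Fin.natAdd k i))) := by
  rw [wedge, ContinuousAlternatingMap.smul_apply,
    ContinuousMultilinearMap.alternatization_apply_apply]
  rfl

/-- The form `v ↦ α(·, v₁, …, v_k)` with values in linear maps. -/
def firstSlot {k : ℕ} (α : E [⋀^Fin (k + 1)]→L[ℝ] F) : E [⋀^Fin k]→L[ℝ] (E →L[ℝ] F) :=
  α.curryLeft.flipAlternating

/-- Insertion of a vector-valued form, `i_K α`; for `K = φ ⊗ X` this is `φ ∧ i_X α`. -/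
def insertForm {k p : ℕ} (K : E [⋀^Fin k]→L[ℝ] E) (α : E [⋀^Fin (p + 1)]→L[ℝ] F) :
    E [⋀^Fin (k + p)]→L[ℝ] F :=
  wedge (ContinuousLinearMap.id ℝ (E →L[ℝ] F)).flip K (firstSlot α)

variable (E) in
/-- The identity of `E` as an `E`-valued `1`-form. -/
def idForm : E [⋀^Fin 1]→L[ℝ] E :=
  ContinuousAlternatingMap.ofSubsingleton ℝ E E (0 : Fin 1) (ContinuousLinearMap.id ℝ E)

/-- `φ ∧ I`, where `I` is the identity as a vector-valued `1`-form. -/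
def wedgeId {k : ℕ} (φ : E [⋀^Fin k]→L[ℝ] ℝ) : E [⋀^Fin (k + 1)]→L[ℝ] E :=
  wedge (ContinuousLinearMap.lsmul ℝ ℝ) φ (idForm E)

theorem wedgeId_add {k : ℕ} (φ ψ : E [⋀^Fin k]→L[ℝ] ℝ) :
    wedgeId (φ + ψ) = wedgeId φ + wedgeId ψ := by
  ext1 v
  simp only [wedgeId, wedge_apply, ContinuousAlternatingMap.add_apply, map_add,
    _root_.add_apply, smul_add, Finset.sum_add_distrib]

theorem wedgeId_smul {k : ℕ} (r : ℝ) (φ : E [⋀^Fin k]→L[ℝ] ℝ) :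
    wedgeId (r • φ) = r • wedgeId φ := by
  ext1 v
  simp only [wedgeId, wedge_apply, ContinuousAlternatingMap.smul_apply, map_smul,
    _root_.smul_apply, Finset.smul_sum, smul_comm _ r]

theorem wedgeId_transport {k : ℕ} (φ : E [⋀^Fin k]→L[ℝ] ℝ) (A A' : E →L[ℝ] E)
    (h : A'.comp A = ContinuousLinearMap.id ℝ E) :
    A'.compContinuousAlternatingMap ((wedgeId φ).compContinuousLinearMap A) =
      wedgeId (φ.compContinuousLinearMap A) := by
  have hz (z : E) : A' (A z) = z := by simpa using DFunLike.congr_fun h z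
  ext1 v
  simp only [ContinuousLinearMap.compContinuousAlternatingMap_coe, Function.comp_apply,
    ContinuousAlternatingMap.compContinuousLinearMap_apply, wedgeId, wedge_apply, map_smul,
    map_sum, idForm, Function.comp_def]
  congr 1
  refine Finset.sum_congr rfl fun σ _ => ?_
  simp [hz, Units.smul_def]

/-- Change of the degree along an equality of natural numbers. -/
def castForm {k l : ℕ} (h : k = l) (α : E [⋀^Fin k]→L[ℝ] F) : E [⋀^Fin l]→L[ℝ] F :=
  h ▸ α

variable [FiniteDimensional ℝ E]

theorem finiteDimensional_form {k : ℕ} [FiniteDimensional ℝ F] :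
    FiniteDimensional ℝ (E [⋀^Fin k]→L[ℝ] F) := by
  let f : (E [⋀^Fin k]→L[ℝ] F) →ₗ[ℝ] MultilinearMap ℝ (fun _ : Fin k => E) F :=
    { toFun := fun α => α.toContinuousMultilinearMap.toMultilinearMap
      map_add' := fun _ _ => rfl
      map_smul' := fun _ _ => rfl }
  refine FiniteDimensional.of_injective f fun a b h => ?_
  ext v
  exact DFunLike.congr_fun h v

variable (E) in
/-- The trace of endomorphisms. -/
def traceCLM : (E →L[ℝ] E) →L[ℝ] ℝ :=
  LinearMap.toContinuousLinearMap
    ((LinearMap.trace ℝ E).comp (ContinuousLinearMap.coeLM ℝ))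

/-- The contraction `c`; for `K = φ ⊗ X` this is `i_X φ`. -/
def contract {k : ℕ} (K : E [⋀^Fin (k + 1)]→L[ℝ] E) : E [⋀^Fin k]→L[ℝ] ℝ :=
  (traceCLM E).compContinuousAlternatingMap (firstSlot K)

variable (E) in
/-- The pairing `(A, B) ↦ tr (A ∘ B)`. -/
def traceComp : (E →L[ℝ] E) →L[ℝ] (E →L[ℝ] E) →L[ℝ] ℝ :=
  ((ContinuousLinearMap.compL ℝ (E →L[ℝ] E) (E →L[ℝ] E) ℝ) (traceCLM E)).comp
    (ContinuousLinearMap.compL ℝ E E E)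

/-- The concomitant `S`; for `K = φ ⊗ X` and `L = ψ ⊗ Y` this is `i_Y φ ∧ i_X ψ`. -/
def concomitant {k l : ℕ} (K : E [⋀^Fin (k + 1)]→L[ℝ] E) (L : E [⋀^Fin (l + 1)]→L[ℝ] E) :
    E [⋀^Fin (k + l)]→L[ℝ] ℝ :=
  wedge (traceComp E) (firstSlot K) (firstSlot L)

theorem contDiff_wedgeId {k : ℕ} :
    ContDiff ℝ (⊤ : ℕ∞) (wedgeId : (E [⋀^Fin k]→L[ℝ] ℝ) → E [⋀^Fin (k + 1)]→L[ℝ] E) := by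
  have := finiteDimensional_form (E := E) (F := ℝ) (k := k)
  let f : (E [⋀^Fin k]→L[ℝ] ℝ) →ₗ[ℝ] (E [⋀^Fin (k + 1)]→L[ℝ] E) :=
    { toFun := wedgeId, map_add' := wedgeId_add, map_smul' := wedgeId_smul }
  exact (LinearMap.toContinuousLinearMap f).contDiff

theorem contract_apply {k : ℕ} (K : E [⋀^Fin (k + 1)]→L[ℝ] E) (v : Fin k → E) :
    contract K v = LinearMap.trace ℝ E (firstSlot K v : E →ₗ[ℝ] E) := rfl

theorem contract_add {k : ℕ} (K L : E [⋀^Fin (k + 1)]→L[ℝ] E) :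
    contract (K + L) = contract K + contract L := by
  ext v
  rw [ContinuousAlternatingMap.add_apply, contract_apply, contract_apply, contract_apply,
    ← map_add]
  rfl

theorem contract_smul {k : ℕ} (r : ℝ) (K : E [⋀^Fin (k + 1)]→L[ℝ] E) :
    contract (r • K) = r • contract K := by
  ext v
  rw [ContinuousAlternatingMap.smul_apply, contract_apply, contract_apply, ← map_smul]
  rfl

theorem contDiff_contract {k : ℕ} :
    ContDiff ℝ (⊤ : ℕ∞) (contract : (E [⋀^Fin (k + 1)]→L[ℝ] E) → E [⋀^Fin k]→L[ℝ] ℝ) := by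
  have := finiteDimensional_form (E := E) (F := E) (k := k + 1)
  let f : (E [⋀^Fin (k + 1)]→L[ℝ] E) →ₗ[ℝ] (E [⋀^Fin k]→L[ℝ] ℝ) :=
    { toFun := contract, map_add' := contract_add, map_smul' := contract_smul }
  exact (LinearMap.toContinuousLinearMap f).contDiff

theorem contract_transport {k : ℕ} (K : E [⋀^Fin (k + 1)]→L[ℝ] E) (A A' : E →L[ℝ] E)
    (h : A.comp A' = ContinuousLinearMap.id ℝ E) :
    contract (A'.compContinuousAlternatingMap (K.compContinuousLinearMap A)) =
      (contract K).compContinuousLinearMap A := by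
  ext v
  rw [ContinuousAlternatingMap.compContinuousLinearMap_apply, contract_apply, contract_apply]
  have h1 : (firstSlot (A'.compContinuousAlternatingMap (K.compContinuousLinearMap A)) v :
      E →ₗ[ℝ] E) = (A' : E →ₗ[ℝ] E) * ((firstSlot K (A ∘ v) : E →ₗ[ℝ] E) * (A : E →ₗ[ℝ] E)) := by
    ext z
    simp only [firstSlot, ContinuousLinearMap.coe_coe, Module.End.mul_apply,
      ContinuousLinearMap.flipAlternating_apply_apply,
      ContinuousAlternatingMap.curryLeft_apply_apply,
      ContinuousLinearMap.compContinuousAlternatingMap_coe, Function.comp_apply,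
      ContinuousAlternatingMap.compContinuousLinearMap_apply]
    congr 2
    ext i
    refine Fin.cases ?_ (fun i => ?_) i <;> simp
  have h2 : (A : E →ₗ[ℝ] E) * (A' : E →ₗ[ℝ] E) = 1 := by
    ext z
    simpa using DFunLike.congr_fun h z
  rw [h1, LinearMap.trace_mul_comm, mul_assoc, h2, mul_one]

end Algebra

/-! ### Differential forms on a manifold

`M` is a smooth manifold modelled on `ℝᵐ`. In Mathlib the tangent space `T_x M` is the model space
`ℝᵐ`, where a vector is represented in the preferred chart at `x`, and `tangentCoordChange x y p`
is the derivative at `p` of the coordinate change from the preferred chart at `x` to the one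
at `y`. -/

section Manifold

open scoped Manifold

universe u

/-- The model space `ℝᵐ`. -/
abbrev Mod (m : ℕ) : Type := EuclideanSpace ℝ (Fin m)

/-- Not necessarily smooth `k`-forms: families of alternating forms on the spaces `T_x M`. -/
abbrev RawForm (m : ℕ) (M : Type*) (k : ℕ) : Type _ := M → Mod m [⋀^Fin k]→L[ℝ] ℝ

/-- Not necessarily smooth `k`-forms with values in the tangent bundle. -/
abbrev RawVForm (m : ℕ) (M : Type*) (k : ℕ) : Type _ := M → Mod m [⋀^Fin k]→L[ℝ] Mod m

variable {m : ℕ} {M : Type u} [TopologicalSpace M] [ChartedSpace (Mod m) M]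
  [IsManifold (𝓡 m) (⊤ : ℕ∞) M]

/-- The coordinate expression of a form in the preferred chart at `x`, at the point `y` of the
image of the chart (the pullback of the form along the inverse of the chart). -/
def RawForm.rep {k : ℕ} (α : RawForm m M k) (x : M) (y : Mod m) : Mod m [⋀^Fin k]→L[ℝ] ℝ :=
  (α ((extChartAt (𝓡 m) x).symm y)).compContinuousLinearMap
    (tangentCoordChange (𝓡 m) x ((extChartAt (𝓡 m) x).symm y) ((extChartAt (𝓡 m) x).symm y))

/-- The coordinate expression of a tangent bundle valued form in the preferred chart at `x`. -/
def RawVForm.rep {k : ℕ} (K : RawVForm m M k) (x : M) (y : Mod m) :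
    Mod m [⋀^Fin k]→L[ℝ] Mod m :=
  (tangentCoordChange (𝓡 m) ((extChartAt (𝓡 m) x).symm y) x
    ((extChartAt (𝓡 m) x).symm y)).compContinuousAlternatingMap
    ((K ((extChartAt (𝓡 m) x).symm y)).compContinuousLinearMap
      (tangentCoordChange (𝓡 m) x ((extChartAt (𝓡 m) x).symm y) ((extChartAt (𝓡 m) x).symm y)))

variable (m M) in
/-- `Ω^k(M)` as a space of families: the forms whose coordinate expressions are smooth. -/
def formSubmodule (k : ℕ) : Submodule ℝ (RawForm m M k) where
  carrier := {α | ∀ x, ContDiffOn ℝ (⊤ : ℕ∞) (RawForm.rep α x) (extChartAt (𝓡 m) x).target}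
  add_mem' ha hb x := (ha x).add (hb x)
  zero_mem' x := by
    have : RawForm.rep (0 : RawForm m M k) x = 0 := rfl
    rw [this]
    exact contDiffOn_const
  smul_mem' c a ha x := by
    have : RawForm.rep (c • a) x = c • RawForm.rep a x := rfl
    rw [this]
    exact contDiffOn_const.smul (ha x)

theorem mem_form {k : ℕ} {α : RawForm m M k} : α ∈ formSubmodule m M k ↔
    ∀ x, ContDiffOn ℝ (⊤ : ℕ∞) (RawForm.rep α x) (extChartAt (𝓡 m) x).target := Iff.rfl

variable (m M) in
/-- `Ω^k(M; TM)` as a space of families: the tangent bundle valued forms whose coordinate expressions are smooth. -/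
def vformSubmodule (k : ℕ) : Submodule ℝ (RawVForm m M k) where
  carrier := {K | ∀ x, ContDiffOn ℝ (⊤ : ℕ∞) (RawVForm.rep K x) (extChartAt (𝓡 m) x).target}
  add_mem' {a b} ha hb x := by
    have : RawVForm.rep (a + b) x = RawVForm.rep a x + RawVForm.rep b x := by
      ext; simp [RawVForm.rep]
    rw [this]
    exact (ha x).add (hb x)
  zero_mem' x := by
    have : RawVForm.rep (0 : RawVForm m M k) x = 0 := by
      ext; simp [RawVForm.rep]
    rw [this]
    exact contDiffOn_const
  smul_mem' c a ha x := by
    have : RawVForm.rep (c • a) x = c • RawVForm.rep a x := by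
      ext; simp [RawVForm.rep]
    rw [this]
    exact contDiffOn_const.smul (ha x)

theorem mem_vform {k : ℕ} {K : RawVForm m M k} : K ∈ vformSubmodule m M k ↔
    ∀ x, ContDiffOn ℝ (⊤ : ℕ∞) (RawVForm.rep K x) (extChartAt (𝓡 m) x).target := Iff.rfl

theorem Form.differentiableAt {k : ℕ} {α : RawForm m M k} (hα : α ∈ formSubmodule m M k) (x : M) :
    DifferentiableAt ℝ (RawForm.rep α x) (extChartAt (𝓡 m) x x) :=
  ((mem_form.1 hα x).contDiffAt ((isOpen_extChartAt_target x).mem_nhds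
    (mem_extChartAt_target x))).differentiableAt (by simp)

variable (m M) in
/-- `Ω^k(M)`: the smooth `k`-forms. -/
def Form (k : ℕ) : Type _ := formSubmodule m M k

instance (k : ℕ) : AddCommGroup (Form m M k) :=
  inferInstanceAs (AddCommGroup (formSubmodule m M k))

instance (k : ℕ) : Module ℝ (Form m M k) :=
  inferInstanceAs (Module ℝ (formSubmodule m M k))

variable (m M) in
/-- `Ω^k(M; TM)`: the smooth `k`-forms with values in the tangent bundle. -/
def VForm (k : ℕ) : Type _ := vformSubmodule m M k

instance (k : ℕ) : AddCommGroup (VForm m M k) :=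
  inferInstanceAs (AddCommGroup (vformSubmodule m M k))

instance (k : ℕ) : Module ℝ (VForm m M k) :=
  inferInstanceAs (Module ℝ (vformSubmodule m M k))

/-- The exterior derivative, computed at `x` in the preferred chart at `x`. -/
def RawForm.d {k : ℕ} (α : RawForm m M k) : RawForm m M (k + 1) := fun x =>
  extDeriv (RawForm.rep α x) (extChartAt (𝓡 m) x x)

theorem tangentCoordChange_inv {x p : M} (hp : p ∈ (extChartAt (𝓡 m) x).source) :
    (tangentCoordChange (𝓡 m) p x p).comp (tangentCoordChange (𝓡 m) x p p) =
      ContinuousLinearMap.id ℝ (Mod m) := by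
  ext1 v
  rw [ContinuousLinearMap.comp_apply,
    tangentCoordChange_comp ⟨⟨hp, mem_extChartAt_source p⟩, hp⟩, tangentCoordChange_self hp]
  rfl

theorem tangentCoordChange_inv' {x p : M} (hp : p ∈ (extChartAt (𝓡 m) x).source) :
    (tangentCoordChange (𝓡 m) x p p).comp (tangentCoordChange (𝓡 m) p x p) =
      ContinuousLinearMap.id ℝ (Mod m) := by
  have h := mem_extChartAt_source (I := 𝓡 m) p
  ext1 v
  rw [ContinuousLinearMap.comp_apply,
    tangentCoordChange_comp ⟨⟨h, hp⟩, h⟩, tangentCoordChange_self h]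
  rfl

/-- The exterior derivative is computed by the same formula in every chart. -/
theorem RawForm.rep_d {k : ℕ} {α : RawForm m M k} (hα : α ∈ formSubmodule m M k) (x : M) {y : Mod m}
    (hy : y ∈ (extChartAt (𝓡 m) x).target) :
    RawForm.rep (RawForm.d α) x y = extDeriv (RawForm.rep α x) y := by
  set e := extChartAt (𝓡 m) x with he
  set p := e.symm y with hp
  set e' := extChartAt (𝓡 m) p with he'
  have hps : p ∈ e.source := e.map_target hy
  have hps' : p ∈ e'.source := mem_extChartAt_source p
  have hey : e p = y := e.right_inv hy
  let τ : Mod m → Mod m := e' ∘ e.symm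
  have hτy : τ y = e' p := rfl
  have hsrc : ∀ᶠ z in nhds y, z ∈ e.target ∧ e.symm z ∈ e'.source := by
    have h1 : e.target ∈ nhds y := (isOpen_extChartAt_target x).mem_nhds hy
    have h2 : ContinuousAt e.symm y := (continuousOn_extChartAt_symm x).continuousAt h1
    exact (Filter.eventually_of_mem h1 fun _ h => h).and
      (h2.eventually ((isOpen_extChartAt_source p).mem_nhds hps'))
  have hfd : ∀ z, z ∈ e.target → e.symm z ∈ e'.source →
      fderiv ℝ τ z = tangentCoordChange (𝓡 m) x p (e.symm z) := by
    intro z hz hz'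
    have := hasFDerivWithinAt_tangentCoordChange (I := 𝓡 m) (x := x) (y := p) (z := e.symm z)
      ⟨e.map_target hz, hz'⟩
    rw [ModelWithCorners.range_eq_univ, hasFDerivWithinAt_univ] at this
    have h3 := this.fderiv
    rw [← he, e.right_inv hz] at h3
    exact h3
  have hev : RawForm.rep α x =ᶠ[nhds y]
      fun z => (RawForm.rep α p (τ z)).compContinuousLinearMap (fderiv ℝ τ z) := by
    filter_upwards [hsrc] with z hz
    have h4 : e'.symm (τ z) = e.symm z := e'.left_inv hz.2
    ext v
    rw [hfd z hz.1 hz.2]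
    simp only [RawForm.rep, ContinuousAlternatingMap.compContinuousLinearMap_apply, ← he, ← he', h4]
    congr 1
    ext1 i
    simp only [Function.comp_apply]
    rw [tangentCoordChange_comp ⟨⟨e.map_target hz.1, hz.2⟩, mem_extChartAt_source _⟩]
  have hd : DifferentiableAt ℝ (RawForm.rep α p) (τ y) := Form.differentiableAt hα p
  have hτ : ContDiffAt ℝ 2 τ y := by
    have := contDiffWithinAt_ext_coord_change (I := 𝓡 m) (n := 2) p x (y := y) (by
      rw [PartialEquiv.trans_source'', PartialEquiv.symm_symm, PartialEquiv.symm_target]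
      exact ⟨p, ⟨hps, hps'⟩, hey⟩)
    rwa [ModelWithCorners.range_eq_univ, contDiffWithinAt_univ] at this
  rw [hev.extDeriv_eq, extDeriv_pullback hd hτ (by simp), hfd y hy hps']
  rfl

theorem Form.d_mem {k : ℕ} {α : RawForm m M k} (hα : α ∈ formSubmodule m M k) :
    RawForm.d α ∈ formSubmodule m M (k + 1) := by
  refine mem_form.2 fun x => ?_
  have h : ContDiffOn ℝ (⊤ : ℕ∞) (extDeriv (RawForm.rep α x)) (extChartAt (𝓡 m) x).target := by
    have h1 := (mem_form.1 hα x).fderiv_of_isOpen (m := (⊤ : ℕ∞)) (isOpen_extChartAt_target x) (by simp)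
    exact (ContinuousAlternatingMap.alternatizeUncurryFinCLM ℝ (Mod m) ℝ).contDiff.comp_contDiffOn
      h1
  exact h.congr fun y hy => RawForm.rep_d hα x hy

/-- The exterior derivative `d : Ω^k(M) → Ω^{k+1}(M)`. -/
def Form.d (k : ℕ) : Form m M k →ₗ[ℝ] Form m M (k + 1) where
  toFun α := ⟨RawForm.d α.1, Form.d_mem α.2⟩
  map_add' α β := by
    refine Subtype.ext (funext fun x => ?_)
    exact extDeriv_add (Form.differentiableAt α.2 x) (Form.differentiableAt β.2 x)
  map_smul' c α := by
    refine Subtype.ext (funext fun x => ?_)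
    exact extDeriv_smul c (RawForm.rep α.1 x)

/-- The contraction (trace) `c : Ω^{k+1}(M; TM) → Ω^k(M)`. In degree `0` the contraction is `0`. -/
def VForm.c (k : ℕ) : VForm m M (k + 1) →ₗ[ℝ] Form m M k where
  toFun K := ⟨fun x => contract (K.1 x), mem_form.2 fun x =>
    ((contDiff_contract (E := Mod m)).comp_contDiffOn (mem_vform.1 K.2 x)).congr fun _ hy =>
      (contract_transport _ _ _
        (tangentCoordChange_inv' ((extChartAt (𝓡 m) x).map_target hy))).symm⟩
  map_add' K L := by
    refine Subtype.ext (funext fun x => ?_)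
    exact contract_add _ _
  map_smul' r K := by
    refine Subtype.ext (funext fun x => ?_)
    exact contract_smul _ _

/-- The map `j : Ω^k(M) → Ω^{k+1}(M; TM)`, `φ ↦ φ ∧ I`, where `I` is the identity of `TM`. -/
def Form.wedgeI (k : ℕ) : Form m M k →ₗ[ℝ] VForm m M (k + 1) where
  toFun φ := ⟨fun x => wedgeId (φ.1 x), mem_vform.2 fun x =>
    ((contDiff_wedgeId (E := Mod m)).comp_contDiffOn (mem_form.1 φ.2 x)).congr fun _ hy =>
      wedgeId_transport _ _ _
        (tangentCoordChange_inv ((extChartAt (𝓡 m) x).map_target hy))⟩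
  map_add' φ ψ := by
    refine Subtype.ext (funext fun x => ?_)
    exact wedgeId_add _ _
  map_smul' r φ := by
    refine Subtype.ext (funext fun x => ?_)
    exact wedgeId_smul _ _

/-- The operator `δ K = (-1)^{k-1} d(c K) ∧ I` on `Ω^k(M; TM)`. -/
def VForm.δ : (k : ℕ) → VForm m M k →ₗ[ℝ] VForm m M (k + 1)
  | 0 => 0
  | k + 1 => (-1 : ℝ) ^ k • (Form.wedgeI (k + 1) ∘ₗ Form.d k ∘ₗ VForm.c k)

variable (m M) in
/-- `C^k(M)`: the traceless tangent bundle valued `k`-forms, i.e. the kernel of `c`. -/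
def Traceless : (k : ℕ) → Submodule ℝ (VForm m M k)
  | 0 => ⊤
  | k + 1 => LinearMap.ker (VForm.c k)

/-! ### Brackets -/

/-- `d (i_K α)` in a vector space, for a `k`-form `K` with values in `E` and an `l`-form `α`;
this is `0` for `l = 0`. -/
def flatDInsert {E : Type*} [NormedAddCommGroup E] [NormedSpace ℝ E] {k : ℕ}
    (K : E → E [⋀^Fin k]→L[ℝ] E) : {l : ℕ} → (E → E [⋀^Fin l]→L[ℝ] E) →
      E → E [⋀^Fin (k + l)]→L[ℝ] E
  | 0, _ => 0
  | _ + 1, α => extDeriv fun y => insertForm (K y) (α y)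

/-- The Lie derivative `Θ(K) α = i_K d α - (-1)^{k-1} d i_K α` along a vector-valued `k`-form in a
vector space, applied to each component of the vector-valued form `α`. -/
def flatLie {E : Type*} [NormedAddCommGroup E] [NormedSpace ℝ E] {k l : ℕ}
    (K : E → E [⋀^Fin k]→L[ℝ] E) (α : E → E [⋀^Fin l]→L[ℝ] E) (y : E) :
    E [⋀^Fin (k + l)]→L[ℝ] E :=
  insertForm (K y) (extDeriv α y) + (-1 : ℝ) ^ k • flatDInsert K α y

/-- The Frölicher–Nijenhuis bracket `[K, L]` of tangent bundle valued forms. It is characterized by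
`Θ([K, L]) = Θ(K) Θ(L) - (-1)^{k l} Θ(L) Θ(K)`; applied to the coordinate functions `u^i` of a
chart, for which `Θ(K) u^i = K^i`, this says that its components are
`[K, L]^i = Θ(K) L^i - (-1)^{k l} Θ(L) K^i`. At `x`, the preferred chart at `x` is used. -/
def fnBracket {k l : ℕ} (K : RawVForm m M k) (L : RawVForm m M l) : RawVForm m M (k + l) :=
  fun x =>
    flatLie (RawVForm.rep K x) (RawVForm.rep L x) (extChartAt (𝓡 m) x x) -
      (-1 : ℝ) ^ (k * l) • castForm (Nat.add_comm l k)
        (flatLie (RawVForm.rep L x) (RawVForm.rep K x) (extChartAt (𝓡 m) x x))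

/-- `dS(K, L) ∧ I`, where `S(φ ⊗ X, ψ ⊗ Y) = i_Y φ ∧ i_X ψ`. If `K` or `L` has degree `0`,
then `S(K, L) = 0`. -/
def dSWedgeI : {k l : ℕ} → RawVForm m M k → RawVForm m M l → RawVForm m M (k + l)
  | k + 1, l + 1, K, L => fun x => castForm (by omega)
      (wedgeId (RawForm.d (fun y => concomitant (K y) (L y) : RawForm m M (k + l)) x))
  | 0, _, _, _ => 0
  | _ + 1, 0, _, _ => 0

/-- `[K, L]^c = [K, L] - (-1)^l / (m - k - l + 1) • dS(K, L) ∧ I`. (For `k + l = m + 1` the forms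
of degree `k + l` vanish, so that the value of the coefficient does not matter.) -/
def tracelessBracket {k l : ℕ} (K : RawVForm m M k) (L : RawVForm m M l) :
    RawVForm m M (k + l) :=
  fnBracket K L - ((-1 : ℝ) ^ l / ((m : ℝ) - k - l + 1)) • dSWedgeI K L

/-! ### Cohomology -/

variable (m M) in
/-- The exact `k`-forms. -/
def Form.boundaries : (k : ℕ) → Submodule ℝ (Form m M k)
  | 0 => ⊥
  | k + 1 => LinearMap.range (Form.d k)

variable (m M) in
/-- The de Rham cohomology `H^k_dR(M)`. -/
abbrev DeRham (k : ℕ) : Type _ :=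
  LinearMap.ker (Form.d (m := m) (M := M) k) ⧸
    (Form.boundaries m M k).submoduleOf (LinearMap.ker (Form.d k))

variable (m M) in
/-- `H^{k-1}_dR(M)`, which is `0` for `k = 0`. -/
def DeRhamPred : ℕ → Type u
  | 0 => PUnit
  | k + 1 => DeRham m M k

instance : (k : ℕ) → AddCommGroup (DeRhamPred m M k)
  | 0 => (inferInstance : AddCommGroup PUnit.{u + 1})
  | k + 1 => (inferInstance : AddCommGroup (DeRham m M k))

instance : (k : ℕ) → Module ℝ (DeRhamPred m M k)
  | 0 => (inferInstance : Module ℝ PUnit.{u + 1})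
  | k + 1 => (inferInstance : Module ℝ (DeRham m M k))

variable (m M) in
/-- The `δ`-closed tangent bundle valued forms. -/
abbrev VForm.cocycles (k : ℕ) : Submodule ℝ (VForm m M k) := LinearMap.ker (VForm.δ k)

variable (m M) in
/-- The `δ`-exact tangent bundle valued forms. -/
def VForm.boundaries : (k : ℕ) → Submodule ℝ (VForm m M k)
  | 0 => ⊥
  | k + 1 => LinearMap.range (VForm.δ k)

variable (m M) in
/-- The cohomology `H^k(Ω(M; TM), δ)`. -/
abbrev DeltaCohomology (k : ℕ) : Type _ :=
  VForm.cocycles m M k ⧸ (VForm.boundaries m M k).submoduleOf (VForm.cocycles m M k)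

/-- The class of a cocycle. -/
abbrev DeltaCohomology.mk {k : ℕ} (K : VForm.cocycles m M k) : DeltaCohomology m M k :=
  Submodule.Quotient.mk K

/-- The class in `H^{(k+1)-1}_dR(M)` of a closed `k`-form. -/
def DeRhamPred.mk {k : ℕ} (φ : LinearMap.ker (Form.d (m := m) (M := M) k)) :
    DeRhamPred m M (k + 1) :=
  (Submodule.Quotient.mk φ : DeRham m M k)

end Manifold

/-- A family of bilinear brackets of degree `0` on a graded real vector space is a graded Lie
bracket if it is graded anticommutative and satisfies the graded Jacobi identity
(the identities are written in the direct sum of the homogeneous components). -/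
structure IsGradedLie {V : ℕ → Type*} [∀ k, AddCommGroup (V k)] [∀ k, Module ℝ (V k)]
    (b : ∀ k l, V k →ₗ[ℝ] V l →ₗ[ℝ] V (k + l)) : Prop where
  anticomm : ∀ (k l : ℕ) (x : V k) (y : V l),
    DirectSum.lof ℝ ℕ V (k + l) (b k l x y) =
      -((-1 : ℝ) ^ (k * l) • DirectSum.lof ℝ ℕ V (l + k) (b l k y x))
  jacobi : ∀ (k l n : ℕ) (x : V k) (y : V l) (z : V n),
    DirectSum.lof ℝ ℕ V (k + (l + n)) (b k (l + n) x (b l n y z)) =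
      DirectSum.lof ℝ ℕ V (k + l + n) (b (k + l) n (b k l x y) z) +
        (-1 : ℝ) ^ (k * l) • DirectSum.lof ℝ ℕ V (l + (k + n)) (b l (k + n) y (b k n x z))

end FN

end

noncomputable section
namespace FN

/-! ### An algebraic model of the calculus of differential forms -/

/-! The whole theorem rests on three trace identities. For a `k`-form `φ`, `c(φ ∧ I) = (-1)^k (m -
k) φ` (`contract_wedgeId`). For closed `φ` and any `L`, `[φ ∧ I, L] = ± d(i_L φ) ∧ I`
(`FormCalculus.bracket_mul_e`). For traceless `K` of degree `k` and `L`, `c[K, L] = (-1)^{k-1} dS(K,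
L)` (`FormCalculus.sum_ins_bracket`).

The first identity gives `δ² = 0` and shows that the boundaries in positive degree are exactly the
forms `dψ ∧ I`. Below degree `m` it splits every cocycle uniquely as `φ ∧ I + K'` with `φ` closed
and `K'` traceless. This is the isomorphism of `H^k` with `H^{k-1}_dR ⊕ C^k`. In degree `m ≥ 1`
every form is a cocycle and `c` is injective, so every form is some `φ ∧ I`.

By the second identity, forms `φ ∧ I` with `φ` closed, in particular boundaries, have only
boundaries as brackets. By the first and the third, `[K', L']^c` is traceless, and it differs from
`[K', L']` by a boundary. Hence brackets of cocycles are cocycles, the bracket descends to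
cohomology, de Rham classes bracket to zero with everything, and traceless forms bracket by `[ ,
]^c`. Since `C^k → H^k` is injective, bilinearity, anticommutativity and the Jacobi identity for `[
, ]^c` are inherited from cohomology and need no computation.

Behind this lies `Θ([K, L]) = [Θ(K), Θ(L)]` (`FormCalculus.lie_bracket`): both sides are graded
derivations, so it suffices to compare them on functions and on the `dx^i`. Applied to components it
gives the Jacobi identity. Applied to a coordinate change `τ`, regarded as a tuple of functions with
`Θ(K) τ = dτ ∘ K`, it gives naturality (`flatBracket_pullback`), hence independence of the chart.

These identities are proved in an abstract calculus of forms, realized by `C^∞(U) ⊗ Λ(ℝᵐ)`. The map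
`toAlg` sends a smooth form on `U` to its coefficients in this algebra, turns wedge, insertion and
`d` into the algebraic operations, and determines the form on `U`. -/

/-- The structure of the algebra of differential forms on an open subset of `ℝᵐ`: the grading
involution `γ`, the coordinate differentials `e i`, the partial derivatives `D i` and the
insertion operators `ins i` of the coordinate vector fields. -/
structure FormCalculus (ι : Type*) [DecidableEq ι] (Ω : Type*) [Ring Ω] [Algebra ℝ Ω] where
  γ : Ω →ₐ[ℝ] Ω
  e : ι → Ω
  D : ι → Ω →ₗ[ℝ] Ω
  ins : ι → Ω →ₗ[ℝ] Ω
  γ_γ : ∀ x, γ (γ x) = x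
  γ_e : ∀ i, γ (e i) = -e i
  γ_D : ∀ i x, γ (D i x) = D i (γ x)
  γ_ins : ∀ i x, γ (ins i x) = -ins i (γ x)
  D_mul : ∀ i x y, D i (x * y) = D i x * y + x * D i y
  D_e : ∀ i j, D i (e j) = 0
  D_comm : ∀ i j x, D i (D j x) = D j (D i x)
  ins_mul : ∀ i x y, ins i (x * y) = ins i x * y + γ x * ins i y
  ins_e : ∀ i j, ins i (e j) = if i = j then 1 else 0
  ins_ins : ∀ i j x, ins i (ins j x) = -ins j (ins i x)
  ins_D : ∀ i j x, ins i (D j x) = D j (ins i x)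
  -- Graded commutativity stated without a grading: `x + γ x` and `x - γ x` are twice the even and
  -- the odd part of `x`.
  supercomm : ∀ x y, (2 : ℝ) • (x * y) = y * (x + γ x) + γ y * (x - γ x)
  -- An induction principle. The functions enter as even elements killed by all insertions, and
  -- products with the `e i` reach everything else.
  generate : ∀ P : Submodule ℝ Ω, (∀ f, γ f = f → (∀ i, ins i f = 0) → f ∈ P) →
    (∀ i x, x ∈ P → e i * x ∈ P) → P = ⊤

namespace FormCalculus

variable {ι : Type*} [DecidableEq ι] {Ω : Type*} [Ring Ω] [Algebra ℝ Ω]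
  (C : FormCalculus ι Ω)

/-- Elements of the parity of `k`. -/
def Par (k : ℕ) (x : Ω) : Prop := C.γ x = (-1 : ℝ) ^ k • x

variable {C}

theorem Par.mul {k l : ℕ} {x y : Ω} (hx : C.Par k x) (hy : C.Par l y) : C.Par (k + l) (x * y) := by
  simp only [Par] at *
  rw [map_mul, hx, hy, smul_mul_smul_comm, pow_add]

theorem Par.add {k : ℕ} {x y : Ω} (hx : C.Par k x) (hy : C.Par k y) : C.Par k (x + y) := by
  simp only [Par] at *
  rw [map_add, hx, hy, smul_add]

theorem Par.smul {k : ℕ} {x : Ω} (hx : C.Par k x) (r : ℝ) : C.Par k (r • x) := by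
  simp only [Par] at *
  rw [map_smul, hx, smul_comm]

theorem Par.neg {k : ℕ} {x : Ω} (hx : C.Par k x) : C.Par k (-x) := by
  simp only [Par] at *
  rw [map_neg, hx, smul_neg]

theorem Par.sub {k : ℕ} {x y : Ω} (hx : C.Par k x) (hy : C.Par k y) : C.Par k (x - y) := by
  rw [sub_eq_add_neg]; exact hx.add hy.neg

theorem Par.sum {κ : Type*} {s : Finset κ} {k : ℕ} {x : κ → Ω} (hx : ∀ j, C.Par k (x j)) :
    C.Par k (∑ j ∈ s, x j) := by
  simp only [Par] at *
  rw [map_sum, Finset.smul_sum, Finset.sum_congr rfl fun j _ => hx j]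

theorem Par.D {k : ℕ} {x : Ω} (hx : C.Par k x) (i : ι) : C.Par k (C.D i x) := by
  simp only [Par] at *
  rw [C.γ_D, hx, map_smul]

theorem Par.ins {k : ℕ} {x : Ω} (hx : C.Par k x) (i : ι) : C.Par (k + 1) (C.ins i x) := by
  simp only [Par] at *
  rw [C.γ_ins, hx, map_smul, pow_succ]
  module

variable (C) in
theorem par_e (i : ι) : C.Par 1 (C.e i) := by simp [Par, C.γ_e]

theorem Par.of_add_two {k : ℕ} {x : Ω} (hx : C.Par (k + 2) x) : C.Par k x := by
  simpa [Par, pow_add] using hx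

theorem Par.congr {k l : ℕ} {x : Ω} (hx : C.Par k x) (h : k = l) : C.Par l x := h ▸ hx

theorem Par.mul_comm {k l : ℕ} {x y : Ω} (hx : C.Par k x) (hy : C.Par l y) :
    x * y = (-1 : ℝ) ^ (k * l) • (y * x) := by
  have h := C.supercomm x y
  simp only [Par] at hx hy
  rw [hx, hy] at h
  have h2 : (2 : ℝ) • (x * y) = (2 : ℝ) • ((-1 : ℝ) ^ (k * l) • (y * x)) := by
    rw [h, pow_mul]
    rcases neg_one_pow_eq_or ℝ k with hk | hk <;> rcases neg_one_pow_eq_or ℝ l with hl | hl <;>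
      simp only [hk, hl, one_pow] <;>
      simp only [mul_add, mul_sub, mul_smul_comm, smul_mul_assoc] <;> module
  exact smul_right_injective Ω (two_ne_zero (α := ℝ)) h2

-- The even part of `e i` vanishes, so only the second term of `supercomm` survives.
variable (C) in
theorem e_mul (i : ι) (x : Ω) : C.e i * x = C.γ x * C.e i := by
  have h := C.supercomm (C.e i) x
  rw [C.γ_e, add_neg_cancel, mul_zero, zero_add, sub_neg_eq_add, ← two_smul ℝ (C.e i),
    mul_smul_comm] at h
  exact smul_right_injective Ω (two_ne_zero (α := ℝ)) h

variable (C) in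
theorem e_mul_e (i j : ι) : C.e i * C.e j = -(C.e j * C.e i) := by
  rw [e_mul, C.γ_e, neg_mul]

variable [Fintype ι]

/-! ### Exterior derivative, Lie derivatives and the bracket in the algebraic model. -/

variable (C) in
/-- The exterior derivative. -/
def d : Ω →ₗ[ℝ] Ω := ∑ i, LinearMap.mulLeft ℝ (C.e i) ∘ₗ C.D i

variable (C) in
/-- Insertion of a vector-valued form. -/
def insV (K : ι → Ω) : Ω →ₗ[ℝ] Ω := ∑ i, LinearMap.mulLeft ℝ (K i) ∘ₗ C.ins i

variable (C) in
/-- The Lie derivative along a vector-valued form of degree `k`. -/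
def lie (k : ℕ) (K : ι → Ω) : Ω →ₗ[ℝ] Ω :=
  C.insV K ∘ₗ C.d + (-1 : ℝ) ^ k • (C.d ∘ₗ C.insV K)

variable (C) in
/-- The Frölicher–Nijenhuis bracket. -/
def bracket (k l : ℕ) (K L : ι → Ω) (i : ι) : Ω :=
  C.lie k K (L i) - (-1 : ℝ) ^ (k * l) • C.lie l L (K i)

theorem d_apply (x : Ω) : C.d x = ∑ i, C.e i * C.D i x := by simp [d]

theorem insV_apply (K : ι → Ω) (x : Ω) : C.insV K x = ∑ i, K i * C.ins i x := by simp [insV]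

theorem lie_apply (k : ℕ) (K : ι → Ω) (x : Ω) :
    C.lie k K x = C.insV K (C.d x) + (-1 : ℝ) ^ k • C.d (C.insV K x) := rfl

theorem d_mul (x y : Ω) : C.d (x * y) = C.d x * y + C.γ x * C.d y := by
  simp only [d_apply, C.D_mul, mul_add, Finset.sum_add_distrib, Finset.sum_mul, Finset.mul_sum,
    mul_assoc]
  congr 1
  exact Finset.sum_congr rfl fun i _ => by rw [← mul_assoc, e_mul, mul_assoc]

theorem Par.d {k : ℕ} {x : Ω} (hx : C.Par k x) : C.Par (k + 1) (C.d x) := by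
  rw [d_apply]
  exact Par.sum fun i => ((C.par_e i).mul (hx.D i)).congr (add_comm _ _)

/-- The products `e i * e j` are antisymmetric and the second derivatives symmetric, so `d (d x)`
equals its own negative. -/
theorem d_d (x : Ω) : C.d (C.d x) = 0 := by
  have h : C.d (C.d x) = ∑ i, ∑ j, C.e i * C.e j * C.D i (C.D j x) := by
    rw [d_apply x, map_sum, Finset.sum_comm]
    simp only [d_apply, C.D_mul, C.D_e, zero_mul, zero_add, mul_assoc]
  have h2 : C.d (C.d x) = -C.d (C.d x) := by
    conv_lhs => rw [h, Finset.sum_comm]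
    rw [h]
    simp only [← Finset.sum_neg_distrib]
    exact Finset.sum_congr rfl fun i _ => Finset.sum_congr rfl fun j _ => by
      rw [e_mul_e, C.D_comm, neg_mul]
  have h3 : (2 : ℝ) • C.d (C.d x) = 0 := by
    rw [two_smul]; nth_rewrite 1 [h2]; exact neg_add_cancel _
  simpa using h3

/-- Cartan's formula for a coordinate vector field, whose Lie derivative is `D i`. -/
theorem ins_d (i : ι) (x : Ω) : C.ins i (C.d x) = C.D i x - C.d (C.ins i x) := by
  simp only [d_apply, map_sum, C.ins_mul, C.ins_e, C.γ_e, C.ins_D, Finset.sum_add_distrib,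
    neg_mul, Finset.sum_neg_distrib, sub_eq_add_neg]
  simp

theorem d_e (i : ι) : C.d (C.e i) = 0 := by simp [d_apply, C.D_e]

/-- By Cartan's formula the terms `K j * d (ins j x)` cancel. What remains is a sum of elementary
graded derivations, which is the form used in all later computations. -/
theorem lie_eq {k : ℕ} {K : ι → Ω} (hK : ∀ i, C.Par k (K i)) (x : Ω) :
    C.lie k K x = ∑ j, (K j * C.D j x + (-1 : ℝ) ^ k • (C.d (K j) * C.ins j x)) := by
  rw [lie_apply, insV_apply, insV_apply, map_sum, Finset.smul_sum, ← Finset.sum_add_distrib]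
  refine Finset.sum_congr rfl fun j _ => ?_
  rw [ins_d, d_mul, show C.γ (K j) = _ from hK j]
  rcases neg_one_pow_eq_or ℝ k with hk | hk <;> simp only [hk] <;> simp [mul_sub]

theorem Par.lie {k p : ℕ} {K : ι → Ω} (hK : ∀ i, C.Par k (K i)) {x : Ω} (hx : C.Par p x) :
    C.Par (k + p) (C.lie k K x) := by
  rw [lie_eq hK]
  refine Par.sum fun j => ((hK j).mul (hx.D j)).add ((Par.of_add_two ?_).smul _)
  exact ((hK j).d.mul (hx.ins j)).congr (by ring)

theorem Par.bracket {k l : ℕ} {K L : ι → Ω} (hK : ∀ i, C.Par k (K i)) (hL : ∀ i, C.Par l (L i))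
    (i : ι) : C.Par (k + l) (C.bracket k l K L i) :=
  (Par.lie hK (hL i)).sub (((Par.lie hL (hK i)).congr (add_comm _ _)).smul _)

/-- Each summand of `lie_eq` is a graded derivation of degree `k`; the sign comes from moving `K j`
or `d (K j)` past `x`. -/
theorem lie_mul {k p : ℕ} {K : ι → Ω} (hK : ∀ i, C.Par k (K i)) {x : Ω} (hx : C.Par p x) (y : Ω) :
    C.lie k K (x * y) = C.lie k K x * y + (-1 : ℝ) ^ (k * p) • (x * C.lie k K y) := by
  simp only [lie_eq hK, Finset.sum_mul, Finset.mul_sum, Finset.smul_sum]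
  rw [← Finset.sum_add_distrib]
  refine Finset.sum_congr rfl fun j _ => ?_
  rw [C.D_mul, C.ins_mul, show C.γ x = _ from hx]
  have h1 := (hK j).mul_comm hx
  have h2 := (hK j).d.mul_comm hx
  simp only [mul_add, add_mul, smul_mul_assoc, mul_smul_comm, ← mul_assoc, h1, h2]
  simp only [one_mul, pow_add, pow_mul]
  rcases neg_one_pow_eq_or ℝ k with hk | hk <;> rcases neg_one_pow_eq_or ℝ p with hp | hp <;>
    simp only [hk, hp, one_pow] <;> module

theorem lie_d (k : ℕ) (K : ι → Ω) (x : Ω) :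
    C.lie k K (C.d x) = (-1 : ℝ) ^ k • C.d (C.lie k K x) := by
  rw [lie_apply, lie_apply, d_d, map_zero, zero_add, map_add, map_smul, d_d, smul_zero, add_zero]

theorem insV_e (K : ι → Ω) (i : ι) : C.insV K (C.e i) = K i := by
  simp [insV_apply, C.ins_e]

theorem lie_e (k : ℕ) (K : ι → Ω) (i : ι) : C.lie k K (C.e i) = (-1 : ℝ) ^ k • C.d (K i) := by
  rw [lie_apply, d_e, map_zero, zero_add, insV_e]

theorem lie_of_ins_eq_zero {k : ℕ} {K : ι → Ω} (hK : ∀ i, C.Par k (K i)) {f : Ω}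
    (hf : ∀ i, C.ins i f = 0) : C.lie k K f = ∑ j, K j * C.D j f := by
  rw [lie_eq hK]
  simp [hf]

/-- On functions this separates the first-order part of a composition of Lie derivatives from the
second-order part, which drops out of the graded commutator. -/
theorem lie_lie_of_ins_eq_zero {k l : ℕ} {K L : ι → Ω} (hK : ∀ i, C.Par k (K i))
    (hL : ∀ i, C.Par l (L i)) {f : Ω} (hf : ∀ i, C.ins i f = 0) :
    C.lie k K (C.lie l L f) = ∑ j, C.lie k K (L j) * C.D j f +
      (-1 : ℝ) ^ (k * l) • ∑ j, ∑ i, L j * K i * C.D i (C.D j f) := by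
  have hD (j i) : C.ins i (C.D j f) = 0 := by rw [C.ins_D, hf, map_zero]
  rw [lie_of_ins_eq_zero hL hf, map_sum]
  simp only [lie_mul hK (hL _), Finset.sum_add_distrib, lie_of_ins_eq_zero hK (hD _),
    Finset.mul_sum, Finset.smul_sum, mul_assoc]

/-- The Lie derivative along a bracket is the graded commutator of the Lie derivatives. -/
theorem lie_bracket {k l : ℕ} {K L : ι → Ω} (hK : ∀ i, C.Par k (K i)) (hL : ∀ i, C.Par l (L i))
    (x : Ω) : C.lie (k + l) (C.bracket k l K L) x =
      C.lie k K (C.lie l L x) - (-1 : ℝ) ^ (k * l) • C.lie l L (C.lie k K x) := by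
  let R : Ω →ₗ[ℝ] Ω := C.lie k K ∘ₗ C.lie l L - (-1 : ℝ) ^ (k * l) • (C.lie l L ∘ₗ C.lie k K)
  have hB := Par.bracket hK hL
  have h : LinearMap.eqLocus (C.lie (k + l) (C.bracket k l K L)) R = ⊤ := by
    refine C.generate _ (fun f _ hf => ?_) (fun i y hy => ?_)
    · change C.lie (k + l) (C.bracket k l K L) f =
        C.lie k K (C.lie l L f) - (-1 : ℝ) ^ (k * l) • C.lie l L (C.lie k K f)
      -- The second-order parts of the two compositions agree up to the commutator sign, because
      -- second derivatives are symmetric.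
      have h1 : ∑ j, ∑ i, K j * L i * C.D i (C.D j f) =
          (-1 : ℝ) ^ (k * l) • ∑ j, ∑ i, L j * K i * C.D i (C.D j f) := by
        rw [Finset.sum_comm, Finset.smul_sum]
        refine Finset.sum_congr rfl fun j _ => ?_
        rw [Finset.smul_sum]
        refine Finset.sum_congr rfl fun i _ => ?_
        rw [(hK i).mul_comm (hL j), smul_mul_assoc, C.D_comm]
      rw [lie_of_ins_eq_zero hB hf, lie_lie_of_ins_eq_zero hK hL hf,
        lie_lie_of_ins_eq_zero hL hK hf, h1]
      simp only [bracket, sub_mul, Finset.sum_sub_distrib, smul_mul_assoc, ← Finset.smul_sum]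
      rw [mul_comm l k]
      rcases neg_one_pow_eq_or ℝ (k * l) with h | h <;> simp only [h] <;> module
    -- The set of agreement is stable under multiplication by `e i`: both sides are graded
    -- derivations, and on `e i` they agree because Lie derivatives commute with `d` up to sign.
    · replace hy : C.lie (k + l) (C.bracket k l K L) y =
        C.lie k K (C.lie l L y) - (-1 : ℝ) ^ (k * l) • C.lie l L (C.lie k K y) := hy
      change C.lie (k + l) (C.bracket k l K L) (C.e i * y) =
        C.lie k K (C.lie l L (C.e i * y)) - (-1 : ℝ) ^ (k * l) • C.lie l L (C.lie k K (C.e i * y))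
      rw [lie_mul hB (C.par_e i), lie_mul hL (C.par_e i), lie_mul hK (C.par_e i), map_add, map_add,
        lie_mul hK (Par.lie hL (C.par_e i)), lie_mul hL (Par.lie hK (C.par_e i)), map_smul, map_smul,
        lie_mul hK (C.par_e i), lie_mul hL (C.par_e i), hy]
      simp only [lie_e, bracket, map_sub, map_smul, lie_d, sub_mul, mul_sub, smul_mul_assoc,
        mul_smul_comm, mul_add, mul_one, pow_add, pow_mul]
      rcases neg_one_pow_eq_or ℝ k with hk | hk <;> rcases neg_one_pow_eq_or ℝ l with hl | hl <;>
        simp only [hk, hl, one_pow] <;> module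
  have hx : x ∈ LinearMap.eqLocus (C.lie (k + l) (C.bracket k l K L)) R := h ▸ Submodule.mem_top
  exact hx

/-- After the Lie derivatives along inner brackets are expanded into commutators by `lie_bracket`,
only iterated Lie derivatives of components are left, and they cancel in pairs. -/
theorem bracket_jacobi {k l n : ℕ} {K L N : ι → Ω} (hK : ∀ i, C.Par k (K i))
    (hL : ∀ i, C.Par l (L i)) (hN : ∀ i, C.Par n (N i)) (i : ι) :
    C.bracket k (l + n) K (C.bracket l n L N) i =
      C.bracket (k + l) n (C.bracket k l K L) N i +
        (-1 : ℝ) ^ (k * l) • C.bracket l (k + n) L (C.bracket k n K N) i := by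
  simp only [bracket.eq_1 C k (l + n), bracket.eq_1 C (k + l) n, bracket.eq_1 C l (k + n),
    lie_bracket hK hL, lie_bracket hL hN, lie_bracket hK hN]
  simp only [bracket, map_sub, map_smul, smul_sub]
  simp only [mul_add, add_mul, pow_add, pow_mul]
  rcases neg_one_pow_eq_or ℝ k with hk | hk <;> rcases neg_one_pow_eq_or ℝ l with hl | hl <;>
    rcases neg_one_pow_eq_or ℝ n with hn | hn <;> simp only [hk, hl, hn, one_pow] <;> module

/-! ### Traces of brackets and brackets with `φ ∧ I`. -/

theorem sum_ins_lie {k : ℕ} {K L : ι → Ω} (hK : ∀ i, C.Par k (K i))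
    (hcL : ∑ i, C.ins i (L i) = 0) :
    ∑ i, C.ins i (C.lie k K (L i)) = ∑ i, ∑ j, (C.ins i (K j) * C.D j (L i) +
      (-1 : ℝ) ^ k • (C.D i (K j) * C.ins j (L i) - C.d (C.ins i (K j)) * C.ins j (L i))) := by
  -- Terms in which another operator acts on `ins i (L i)` sum to that operator applied to the trace
  -- of `L`, which is zero; the same holds in `h2`.
  have h1 : ∑ i, ∑ j, (-1 : ℝ) ^ k • (K j * C.D j (C.ins i (L i))) = 0 := by
    rw [Finset.sum_comm]
    refine Finset.sum_eq_zero fun j _ => ?_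
    rw [← Finset.smul_sum, ← Finset.mul_sum, ← map_sum, hcL, map_zero, mul_zero, smul_zero]
  have h2 : ∑ i, ∑ j, C.d (K j) * C.ins j (C.ins i (L i)) = 0 := by
    rw [Finset.sum_comm]
    refine Finset.sum_eq_zero fun j _ => ?_
    rw [← Finset.mul_sum, ← map_sum, hcL, map_zero, mul_zero]
  rw [← sub_eq_zero, ← Finset.sum_sub_distrib, ← (congrArg₂ (· + ·) h1 h2).trans (add_zero 0),
    ← Finset.sum_add_distrib]
  refine Finset.sum_congr rfl fun i _ => ?_
  rw [lie_eq hK, map_sum, ← Finset.sum_sub_distrib, ← Finset.sum_add_distrib]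
  refine Finset.sum_congr rfl fun j _ => ?_
  rw [map_add, map_smul, C.ins_mul, C.ins_mul, ins_d, show C.γ (K j) = _ from hK j,
    show C.γ (C.d (K j)) = _ from (hK j).d, C.ins_D, C.ins_ins i j]
  simp only [pow_succ, sub_mul, smul_mul_assoc, mul_neg]
  rcases neg_one_pow_eq_or ℝ k with hk | hk <;> simp only [hk] <;> module

/-- The trace of the bracket of traceless forms. -/
theorem sum_ins_bracket {k l : ℕ} {K L : ι → Ω} (hK : ∀ i, C.Par k (K i))
    (hL : ∀ i, C.Par l (L i)) (hcK : ∑ i, C.ins i (K i) = 0) (hcL : ∑ i, C.ins i (L i) = 0) :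
    ∑ i, C.ins i (C.bracket k l K L i) =
      -((-1 : ℝ) ^ k • C.d (∑ i, ∑ j, C.ins i (K j) * C.ins j (L i))) := by
  simp only [bracket, map_sub, map_smul, Finset.sum_sub_distrib, ← Finset.smul_sum]
  rw [sum_ins_lie hK hcL, sum_ins_lie hL hcK]
  -- Exchanging the indices in the second trace pairs `K j` with `L i` in both double sums.
  conv_lhs => enter [2, 2]; rw [Finset.sum_comm]
  simp only [map_sum, Finset.smul_sum, ← Finset.sum_sub_distrib, ← Finset.sum_neg_distrib]
  -- By graded commutativity the terms containing a `D` cancel; the rest is the Leibniz rule for `d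
  -- (ins i (K j) * ins j (L i))`.
  have key (i j) : C.ins i (K j) * C.D j (L i) + (-1 : ℝ) ^ k • (C.D i (K j) * C.ins j (L i) -
        C.d (C.ins i (K j)) * C.ins j (L i)) -
      (-1 : ℝ) ^ (k * l) • (C.ins j (L i) * C.D i (K j) + (-1 : ℝ) ^ l • (C.D j (L i) * C.ins i (K j) -
        C.d (C.ins j (L i)) * C.ins i (K j))) =
      -((-1 : ℝ) ^ k • C.d (C.ins i (K j) * C.ins j (L i))) := by
    rw [((hL i).ins j).mul_comm ((hK j).D i), ((hL i).D j).mul_comm ((hK j).ins i),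
      ((hL i).ins j).d.mul_comm ((hK j).ins i), d_mul,
      show C.γ (C.ins i (K j)) = _ from (hK j).ins i]
    simp only [mul_add, add_mul, one_mul, mul_one, pow_add, smul_mul_assoc, mul_comm l k, pow_mul]
    rcases neg_one_pow_eq_or ℝ k with hk | hk <;> rcases neg_one_pow_eq_or ℝ l with hl | hl <;>
      simp only [hk, hl, one_pow, pow_one] <;> module
  exact Finset.sum_congr rfl fun i _ => Finset.sum_congr rfl fun j _ => key i j

/-- Insertion of the identity counts the degree of a form, and `d` raises the degree by one. -/
theorem insV_e_d (x : Ω) : C.insV C.e (C.d x) = C.d x + C.d (C.insV C.e x) := by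
  simp only [insV_apply, map_sum, ins_d, d_mul, d_e, zero_mul, zero_add, C.γ_e, mul_sub,
    Finset.sum_sub_distrib, neg_mul, Finset.sum_neg_distrib]
  rw [← d_apply, sub_eq_add_neg]

/-- The bracket of `φ ∧ I` with `L` for a closed form `φ`. -/
theorem bracket_mul_e {q l : ℕ} {φ : Ω} {L : ι → Ω} (hφ : C.Par q φ) (hL : ∀ i, C.Par l (L i))
    (hd : C.d φ = 0) (i : ι) :
    C.bracket (q + 1) l (fun j => φ * C.e j) L i =
      (-1 : ℝ) ^ (q * l + 1) • (C.d (C.insV L φ) * C.e i) := by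
  have h1 (x : Ω) : C.insV (fun j => φ * C.e j) x = φ * C.insV C.e x := by
    simp only [insV_apply, Finset.mul_sum, mul_assoc]
  -- The two degree-counting terms cancel because `φ` is closed. The remaining `φ * d (L i)` later
  -- cancels against the part of `lie l L (φ * e i)` in which `e i` is differentiated.
  have h2 : C.lie (q + 1) (fun j => φ * C.e j) (L i) = φ * C.d (L i) := by
    rw [lie_apply, h1, h1, d_mul, hd, zero_mul, zero_add, insV_e_d, show C.γ φ = _ from hφ,
      smul_mul_assoc, smul_smul, ← pow_add, Odd.neg_one_pow (by exact ⟨q, by ring⟩)]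
    rw [mul_add]
    module
  have h3 : C.lie l L φ = (-1 : ℝ) ^ l • C.d (C.insV L φ) := by
    rw [lie_apply, hd, map_zero, zero_add]
  rw [bracket, h2, lie_mul hL hφ, lie_e, h3]
  simp only [add_mul, one_mul, mul_comm l q, pow_add, pow_mul, smul_mul_assoc, mul_smul_comm]
  rcases neg_one_pow_eq_or ℝ q with hk | hk <;> rcases neg_one_pow_eq_or ℝ l with hl | hl <;>
      simp only [hk, hl, one_pow, pow_one] <;> module

/-- Source of the factor `m - k`: inserting into `e i` contributes `φ` once for each index, and
inserting into `φ` subtracts the degree-counting operator. -/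
theorem sum_ins_mul_e {k : ℕ} {φ : Ω} (hφ : C.Par k φ) :
    ∑ i, C.ins i (φ * C.e i) = (-1 : ℝ) ^ k • ((Fintype.card ι : ℝ) • φ - C.insV C.e φ) := by
  have h (i) : C.ins i (φ * C.e i) = (-1 : ℝ) ^ k • (φ - C.e i * C.ins i φ) := by
    rw [C.ins_mul, C.ins_e, if_pos rfl, mul_one, C.e_mul, C.γ_ins, show C.γ φ = _ from hφ]
    simp only [map_smul, neg_mul, smul_mul_assoc]
    rcases neg_one_pow_eq_or ℝ k with hk | hk <;> simp only [hk] <;> module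
  simp only [h, ← Finset.smul_sum, Finset.sum_sub_distrib, ← insV_apply]
  simp [← Nat.cast_smul_eq_nsmul ℝ]

/-- Applying `ins j` to `e i * K j = 0` and summing over `j` gives `K i = e i * c(K)`. The
hypothesis `hK` holds for forms of top degree. -/
theorem eq_zero_of_sum_ins_eq_zero {K : ι → Ω} (hK : ∀ i j, C.e i * K j = 0)
    (hc : ∑ i, C.ins i (K i) = 0) (i : ι) : K i = 0 := by
  have h (j) : (if j = i then K j else 0) = C.e i * C.ins j (K j) := by
    have := congrArg (C.ins j) (hK i j)
    rw [C.ins_mul, C.ins_e, C.γ_e, map_zero, neg_mul, ← sub_eq_add_neg, sub_eq_zero] at this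
    rw [← this]
    split_ifs <;> simp
  have h2 := Finset.sum_congr (rfl : (Finset.univ : Finset ι) = _) fun j _ => h j
  rw [← Finset.mul_sum, hc, mul_zero] at h2
  simpa using h2

end FormCalculus
end FN
end

noncomputable section
namespace FN

open TensorProduct

/-! ### The algebra of differential forms on an open subset of `ℝᵐ` -/

/-! ### Insertion, parity and graded commutativity in the exterior algebra. -/

section Exterior

variable {N : Type*} [AddCommGroup N] [Module ℝ N]

open CliffordAlgebra in
theorem involute_contractLeft (d : Module.Dual ℝ N) (x : ExteriorAlgebra ℝ N) :
    involute (contractLeft (Q := (0 : QuadraticForm ℝ N)) d x) =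
      -contractLeft (Q := (0 : QuadraticForm ℝ N)) d (involute x) := by
  induction x using CliffordAlgebra.left_induction with
  | algebraMap r => simp
  | add x y hx hy => simp only [map_add, hx, hy, neg_add]
  | ι_mul x v hx =>
    simp only [contractLeft_ι_mul, map_sub, map_smul, map_mul, involute_ι, hx, neg_mul, map_neg]
    simp

open CliffordAlgebra in
theorem contractLeft_mul (d : Module.Dual ℝ N) (x y : ExteriorAlgebra ℝ N) :
    contractLeft (Q := (0 : QuadraticForm ℝ N)) d (x * y) =
      contractLeft (Q := (0 : QuadraticForm ℝ N)) d x * y +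
        involute x * contractLeft (Q := (0 : QuadraticForm ℝ N)) d y := by
  induction x using CliffordAlgebra.left_induction with
  | algebraMap r => simp [contractLeft_algebraMap_mul]
  | add x z hx hz => simp only [map_add, add_mul, hx, hz]; abel
  | ι_mul x v hx =>
    simp only [contractLeft_ι_mul, map_mul, involute_ι, hx, mul_assoc, sub_mul, smul_mul_assoc,
      mul_add, neg_mul]
    abel

open CliffordAlgebra in
theorem ι_mul_eq_involute_mul (v : N) (x : ExteriorAlgebra ℝ N) :
    ExteriorAlgebra.ι ℝ v * x =
      involute (Q := (0 : QuadraticForm ℝ N)) x * ExteriorAlgebra.ι ℝ v := by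
  induction x using CliffordAlgebra.left_induction with
  | algebraMap r => simpa using (Algebra.commutes r _).symm
  | add x z hx hz => simp only [map_add, mul_add, add_mul, hx, hz]
  | ι_mul x w hx =>
    rw [map_mul, involute_ι, mul_assoc, ← hx, neg_mul, ← mul_assoc, ← mul_assoc,
      eq_neg_iff_add_eq_zero, ← add_mul]
    have := ExteriorAlgebra.ι_add_mul_swap (R := ℝ) v w
    exact (congrArg (· * x) this).trans (zero_mul x)

open CliffordAlgebra in
theorem two_smul_mul_eq (x y : ExteriorAlgebra ℝ N) :
    (2 : ℝ) • (x * y) = y * (x + involute (Q := (0 : QuadraticForm ℝ N)) x) +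
      involute (Q := (0 : QuadraticForm ℝ N)) y *
        (x - involute (Q := (0 : QuadraticForm ℝ N)) x) := by
  induction x using CliffordAlgebra.left_induction generalizing y with
  | algebraMap r =>
    rw [AlgHom.commutes, sub_self, mul_zero, add_zero, two_smul, mul_add, Algebra.commutes]
  | add x z hx hz => simp only [map_add, add_mul, smul_add, hx, hz]; noncomm_ring
  | ι_mul x v hx =>
    have h := congrArg (fun z => ExteriorAlgebra.ι ℝ v * z) (hx y)
    simp only [mul_smul_comm, mul_add, ← mul_assoc, ι_mul_eq_involute_mul v y] at h
    rw [ι_mul_eq_involute_mul v (involute y), involute_involute] at h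
    rw [mul_assoc, show CliffordAlgebra.ι (0 : QuadraticForm ℝ N) v = ExteriorAlgebra.ι ℝ v from rfl,
      ← mul_assoc, h, map_mul,
      show involute (Q := (0 : QuadraticForm ℝ N)) (ExteriorAlgebra.ι ℝ v) = -ExteriorAlgebra.ι ℝ v
        from involute_ι v]
    noncomm_ring

end Exterior

open TopologicalSpace (Opens)

variable {m : ℕ}

/-! ### Smooth functions on an open set and their derivatives. -/

/-- Extension by zero of a function on an open set. -/
def extZero (U : Opens (Mod m)) (f : U → ℝ) : Mod m → ℝ := Function.extend Subtype.val f 0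

theorem extZero_apply {U : Opens (Mod m)} (f : U → ℝ) (y : U) : extZero U f y = f y :=
  Subtype.val_injective.extend_apply _ _ _

theorem extZero_eventuallyEq {U : Opens (Mod m)} {f : U → ℝ} {g : Mod m → ℝ}
    (h : ∀ y : U, f y = g y) (y : U) : extZero U f =ᶠ[nhds (y : Mod m)] g := by
  filter_upwards [U.isOpen.mem_nhds y.2] with z hz
  exact (extZero_apply f ⟨z, hz⟩).trans (h ⟨z, hz⟩)

/-- The algebra of smooth functions on an open subset of `ℝᵐ`. -/
def Smooth (U : Opens (Mod m)) : Subalgebra ℝ (U → ℝ) where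
  carrier := {f | ContDiffOn ℝ (⊤ : ℕ∞) (extZero U f) U}
  mul_mem' {f g} hf hg := (hf.mul hg).congr fun y hy => by
    simp [extZero_apply _ (⟨y, hy⟩ : U)]
  add_mem' {f g} hf hg := (hf.add hg).congr fun y hy => by
    simp [extZero_apply _ (⟨y, hy⟩ : U)]
  algebraMap_mem' r := (contDiffOn_const (c := r)).congr fun y hy => by
    simp [extZero_apply _ (⟨y, hy⟩ : U)]

/-- The restriction of a function to an open set on which it is smooth. -/
def Smooth.res {U : Opens (Mod m)} (g : Mod m → ℝ) (hg : ContDiffOn ℝ (⊤ : ℕ∞) g U) : Smooth U :=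
  ⟨fun y => g y, hg.congr fun y hy => extZero_apply _ (⟨y, hy⟩ : U)⟩

theorem Smooth.differentiableAt {U : Opens (Mod m)} (f : Smooth U) (y : U) :
    DifferentiableAt ℝ (extZero U f.1) y :=
  (ContDiffOn.contDiffAt f.2 (U.isOpen.mem_nhds y.2)).differentiableAt (by simp)

theorem contDiffOn_fderiv_apply {U : Opens (Mod m)} {g : Mod m → ℝ}
    (hg : ContDiffOn ℝ (⊤ : ℕ∞) g U) (v : Mod m) :
    ContDiffOn ℝ (⊤ : ℕ∞) (fun y => fderiv ℝ g y v) U :=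
  (hg.fderiv_of_isOpen (m := (⊤ : ℕ∞)) U.isOpen (by simp)).clm_apply contDiffOn_const

/-- The derivative of smooth functions in the direction `v`. -/
def Smooth.D {U : Opens (Mod m)} (v : Mod m) : Smooth U →ₗ[ℝ] Smooth U where
  toFun f := Smooth.res (fun y => fderiv ℝ (extZero U f.1) y v) (contDiffOn_fderiv_apply f.2 v)
  map_add' f g := Subtype.ext (funext fun y => by
    change fderiv ℝ (extZero U (f.1 + g.1)) y v =
      fderiv ℝ (extZero U f.1) y v + fderiv ℝ (extZero U g.1) y v
    rw [(extZero_eventuallyEq (g := extZero U f.1 + extZero U g.1)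
      (fun z => by simp [extZero_apply]) y).fderiv_eq,
      fderiv_add (Smooth.differentiableAt f y) (Smooth.differentiableAt g y)]
    rfl)
  map_smul' r f := Subtype.ext (funext fun y => by
    change fderiv ℝ (extZero U (r • f.1)) y v = r • fderiv ℝ (extZero U f.1) y v
    rw [(extZero_eventuallyEq (g := r • extZero U f.1)
      (fun z => by simp [extZero_apply]) y).fderiv_eq,
      fderiv_const_smul (Smooth.differentiableAt f y)]
    rfl)

theorem Smooth.D_apply {U : Opens (Mod m)} (v : Mod m) (f : Smooth U) (y : U) :
    (Smooth.D v f).1 y = fderiv ℝ (extZero U f.1) y v := rfl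

theorem Smooth.D_res {U : Opens (Mod m)} (v : Mod m) (g : Mod m → ℝ)
    (hg : ContDiffOn ℝ (⊤ : ℕ∞) g U) :
    Smooth.D v (Smooth.res g hg) =
      Smooth.res (fun y => fderiv ℝ g y v) (contDiffOn_fderiv_apply hg v) :=
  Subtype.ext (funext fun y => by
    rw [Smooth.D_apply, (extZero_eventuallyEq (f := (Smooth.res g hg).1) (g := g) (fun _ => rfl) y).fderiv_eq]
    rfl)

theorem Smooth.D_mul {U : Opens (Mod m)} (v : Mod m) (f g : Smooth U) :
    Smooth.D v (f * g) = Smooth.D v f * g + f * Smooth.D v g :=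
  Subtype.ext (funext fun y => by
    change (Smooth.D v (f * g)).1 y = (Smooth.D v f).1 y * g.1 y + f.1 y * (Smooth.D v g).1 y
    rw [Smooth.D_apply, Smooth.D_apply, Smooth.D_apply,
      (extZero_eventuallyEq (f := (f * g).1) (g := extZero U f.1 * extZero U g.1)
      (fun z => by simp [extZero_apply]) y).fderiv_eq,
      fderiv_mul (Smooth.differentiableAt f y) (Smooth.differentiableAt g y)]
    simp [extZero_apply]
    ring)

theorem Smooth.D_one {U : Opens (Mod m)} (v : Mod m) : Smooth.D v (1 : Smooth U) = 0 := by
  have := Smooth.D_mul v (1 : Smooth U) 1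
  simpa using this

/-- Both orders are values of the second Fréchet derivative, which is symmetric for smooth
functions. -/
theorem Smooth.D_comm {U : Opens (Mod m)} (v w : Mod m) (f : Smooth U) :
    Smooth.D v (Smooth.D w f) = Smooth.D w (Smooth.D v f) := by
  refine Subtype.ext (funext fun y => ?_)
  have hf : ContDiffAt ℝ (⊤ : ℕ∞) (extZero U f.1) y :=
    ContDiffOn.contDiffAt f.2 (U.isOpen.mem_nhds y.2)
  have hd : DifferentiableAt ℝ (fderiv ℝ (extZero U f.1)) y :=
    (hf.fderiv_right (m := 1) (by norm_cast)).differentiableAt (by simp)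
  have h (v w : Mod m) : (Smooth.D v (Smooth.D w f)).1 y =
      fderiv ℝ (fderiv ℝ (extZero U f.1)) y v w := by
    rw [Smooth.D_apply, (extZero_eventuallyEq (f := (Smooth.D w f).1)
      (g := fun z => fderiv ℝ (extZero U f.1) z w)
      (fun _ => rfl) y).fderiv_eq, fderiv_clm_apply hd (by fun_prop)]
    simp
  rw [h, h]
  exact (hf.isSymmSndFDerivAt (by simp only [minSmoothness_of_isRCLikeNormedField]; norm_cast)) v w

/-! ### The concrete model of the calculus. -/

/-- The algebra of differential forms on an open subset of `ℝᵐ`, generated by the smooth functions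
and the coordinate differentials. -/
abbrev FormAlg (U : Opens (Mod m)) : Type := Smooth U ⊗[ℝ] ExteriorAlgebra ℝ (Fin m → ℝ)

instance (U : Opens (Mod m)) : Ring (FormAlg U) := inferInstance

instance (U : Opens (Mod m)) : AddCommGroup (FormAlg U) := Ring.toAddCommGroup

open CliffordAlgebra in
/-- The calculus of differential forms on an open subset of `ℝᵐ`. -/
def formCalculus (U : Opens (Mod m)) : FormCalculus (Fin m) (FormAlg U) where
  γ := Algebra.TensorProduct.map (AlgHom.id ℝ (Smooth U))
    (involute (Q := (0 : QuadraticForm ℝ (Fin m → ℝ))))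
  e i := 1 ⊗ₜ ExteriorAlgebra.ι ℝ (Pi.single i 1)
  D i := LinearMap.rTensor _ (Smooth.D (EuclideanSpace.single i 1))
  ins i := LinearMap.lTensor _
    (contractLeft (Q := (0 : QuadraticForm ℝ (Fin m → ℝ))) (LinearMap.proj i))
  γ_γ x := by
    induction x using TensorProduct.induction_on with
    | zero => simp
    | add x y hx hy => simp only [map_add, hx, hy]
    | tmul f x => simp
  γ_e i := by
    simp only [Algebra.TensorProduct.map_tmul, map_one]
    rw [show involute (Q := (0 : QuadraticForm ℝ (Fin m → ℝ))) (ExteriorAlgebra.ι ℝ _) = - _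
      from involute_ι _, tmul_neg]
  γ_D i x := by
    induction x using TensorProduct.induction_on with
    | zero => simp
    | add x y hx hy => simp only [map_add, hx, hy]
    | tmul f x => simp
  γ_ins i x := by
    induction x using TensorProduct.induction_on with
    | zero => simp
    | add x y hx hy => simp only [map_add, hx, hy]; exact (neg_add _ _).symm
    | tmul f x =>
      simp only [LinearMap.lTensor_tmul, Algebra.TensorProduct.map_tmul, ← tmul_neg]
      exact congrArg _ (involute_contractLeft _ _)
  D_mul i x y := by
    induction x using TensorProduct.induction_on with
    | zero => simp
    | add x z hx hz => simp only [map_add, add_mul, hx, hz]; abel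
    | tmul f x =>
      induction y using TensorProduct.induction_on with
      | zero => simp
      | add y z hy hz => simp only [map_add, mul_add, hy, hz]; abel
      | tmul g y =>
        simp only [Algebra.TensorProduct.tmul_mul_tmul, LinearMap.rTensor_tmul, Smooth.D_mul,
          add_tmul]
  D_e i j := by simp [Smooth.D_one]
  D_comm i j x := by
    induction x using TensorProduct.induction_on with
    | zero => simp
    | add x y hx hy => simp only [map_add, hx, hy]
    | tmul f x => simp only [LinearMap.rTensor_tmul, Smooth.D_comm (EuclideanSpace.single i 1)]
  ins_mul i x y := by
    induction x using TensorProduct.induction_on with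
    | zero => simp
    | add x z hx hz => simp only [map_add, add_mul, hx, hz]; abel
    | tmul f x =>
      induction y using TensorProduct.induction_on with
      | zero => simp
      | add y z hy hz => simp only [map_add, mul_add, hy, hz]; abel
      | tmul g y =>
        simp only [Algebra.TensorProduct.tmul_mul_tmul, LinearMap.lTensor_tmul,
          Algebra.TensorProduct.map_tmul, AlgHom.id_apply, ← tmul_add]
        exact congrArg _ (contractLeft_mul _ _ _)
  ins_e i j := by
    rw [LinearMap.lTensor_tmul, show contractLeft (Q := (0 : QuadraticForm ℝ (Fin m → ℝ)))
      (LinearMap.proj i) (ExteriorAlgebra.ι ℝ (Pi.single j 1)) = _ from contractLeft_ι _ _ _]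
    by_cases h : i = j
    · subst h
      simp [Algebra.TensorProduct.one_def]
    · simp [h]
  ins_ins i j x := by
    induction x using TensorProduct.induction_on with
    | zero => simp
    | add x y hx hy => simp only [map_add, hx, hy]; exact (neg_add _ _).symm
    | tmul f x =>
      simp only [LinearMap.lTensor_tmul, ← tmul_neg]
      exact congrArg _ (contractLeft_comm _ _ _)
  ins_D i j x := by
    induction x using TensorProduct.induction_on with
    | zero => simp
    | add x y hx hy => simp only [map_add, hx, hy]
    | tmul f x => simp
  supercomm x y := by
    induction x using TensorProduct.induction_on with
    | zero => simp
    | add x z hx hz => simp only [map_add, add_mul, mul_add, mul_sub, smul_add, hx, hz]; abel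
    | tmul f x =>
      induction y using TensorProduct.induction_on with
      | zero => simp
      | add y z hy hz => simp only [map_add, mul_add, add_mul, mul_sub, smul_add, hy, hz]; abel
      | tmul g y =>
        simp only [Algebra.TensorProduct.tmul_mul_tmul, Algebra.TensorProduct.map_tmul,
          AlgHom.id_apply, ← tmul_add, ← tmul_sub, mul_comm g f, ← tmul_smul]
        exact congrArg _ (two_smul_mul_eq x y)
  generate P hf he := by
    refine Submodule.eq_top_iff'.2 fun x => ?_
    induction x using TensorProduct.induction_on with
    | zero => exact P.zero_mem
    | add x y hx hy => exact P.add_mem hx hy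
    | tmul f x =>
      induction x using CliffordAlgebra.left_induction with
      | algebraMap r => exact hf _ (by simp) (fun i => by simp)
      | add x y hx hy => rw [tmul_add]; exact P.add_mem hx hy
      | ι_mul x v hx =>
        -- Multiplication by an arbitrary vector reduces to multiplication by the `e i`, for which
        -- stability of `P` is assumed.
        have hv : ι (0 : QuadraticForm ℝ (Fin m → ℝ)) v =
            ∑ i, v i • ExteriorAlgebra.ι ℝ (Pi.single i (1 : ℝ)) := by
          conv_lhs => rw [pi_eq_sum_univ' v]
          rw [map_sum]
          refine Finset.sum_congr rfl fun i _ => ?_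
          rw [← map_smul]
        rw [hv, Finset.sum_mul, tmul_sum]
        refine P.sum_mem fun i _ => ?_
        have := P.smul_mem (v i) (he i _ hx)
        rwa [Algebra.TensorProduct.tmul_mul_tmul, one_mul, ← tmul_smul, ← smul_mul_assoc] at this

end FN
end

noncomputable section
namespace FN
open TensorProduct
open TopologicalSpace (Opens)
variable {m : ℕ}

/-! ### Differential forms as elements of the algebra -/

/-- The product `dx^{f 1} ∧ … ∧ dx^{f k}`. -/
def mono {k : ℕ} (f : Fin k → Fin m) : ExteriorAlgebra ℝ (Fin m → ℝ) :=
  ExteriorAlgebra.ιMulti ℝ k fun i => Pi.single (f i) (1 : ℝ)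

theorem mono_comp_perm {k : ℕ} (f : Fin k → Fin m) (σ : Equiv.Perm (Fin k)) :
    mono (f ∘ σ) = Equiv.Perm.sign σ • mono f :=
  AlternatingMap.map_perm (ExteriorAlgebra.ιMulti ℝ k) 
    (fun i => (Pi.single (f i) (1 : ℝ) : Fin m → ℝ)) σ

theorem mono_append {k l : ℕ} (f : Fin k → Fin m) (g : Fin l → Fin m) :
    mono (Fin.append f g) = mono f * mono g := by
  rw [mono, mono, mono, ExteriorAlgebra.ιMulti_mul_ιMulti]
  congr 1
  ext1 i
  refine Fin.addCases (fun j => ?_) (fun j => ?_) i <;> simp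

theorem mono_insertNth {k : ℕ} (p : Fin (k + 1)) (i : Fin m) (g : Fin k → Fin m) :
    mono (p.insertNth i g : Fin (k + 1) → Fin m) =
      (-1 : ℝ) ^ (p : ℕ) • (ExteriorAlgebra.ι ℝ (Pi.single i (1 : ℝ)) * mono g) := by
  have h : (fun j => Pi.single ((p.insertNth i g : Fin (k + 1) → Fin m) j) (1 : ℝ)) =
      (p.insertNth (Pi.single i (1 : ℝ)) (fun j => Pi.single (g j) (1 : ℝ)) :
        Fin (k + 1) → Fin m → ℝ) := by
    ext1 j
    refine Fin.succAboveCases p ?_ (fun j => ?_) j <;> simp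
  rw [mono, h, AlternatingMap.map_insertNth, ExteriorAlgebra.ιMulti_succ_apply]
  simp only [Matrix.cons_val_zero]
  rw [← Int.cast_smul_eq_zsmul ℝ]
  push_cast
  rfl

/-- The element of the algebra with given coefficients. -/
def assemble (U : Opens (Mod m)) (k : ℕ) :
    ((Fin k → Fin m) → Smooth U) →ₗ[ℝ] FormAlg U where
  -- All index maps are summed, so for alternating coefficients each monomial occurs `k!` times.
  toFun h := (k.factorial : ℝ)⁻¹ • ∑ f, h f ⊗ₜ[ℝ] mono f
  map_add' h h' := by simp only [Pi.add_apply, add_tmul, Finset.sum_add_distrib, smul_add]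
  map_smul' r h := by
    simp only [Pi.smul_apply, RingHom.id_apply, ← smul_tmul', ← Finset.smul_sum, smul_comm r]

theorem assemble_apply (U : Opens (Mod m)) {k : ℕ} (h : (Fin k → Fin m) → Smooth U) :
    assemble U k h = (k.factorial : ℝ)⁻¹ • ∑ f, h f ⊗ₜ[ℝ] mono f := rfl

/-- Reindexing by `σ` produces the sign of `σ` in the monomial, which cancels the sign in front, so
all `k!` summands are equal. Hence coefficients need not be antisymmetrized beforehand. -/
theorem assemble_alternatization (U : Opens (Mod m)) {k : ℕ} (h : (Fin k → Fin m) → Smooth U) :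
    assemble U k (fun f => ∑ σ : Equiv.Perm (Fin k), ((Equiv.Perm.sign σ : ℤ) : ℝ) • h (f ∘ σ)) =
      (k.factorial : ℝ) • assemble U k h := by
  simp only [assemble_apply, sum_tmul]
  rw [Finset.sum_comm, smul_comm]
  congr 1
  have : ∀ σ ∈ (Finset.univ : Finset (Equiv.Perm (Fin k))),
      ∑ f : Fin k → Fin m, (((Equiv.Perm.sign σ : ℤ) : ℝ) • h (f ∘ σ)) ⊗ₜ[ℝ] mono f =
        ∑ f, h f ⊗ₜ[ℝ] mono f := by
    intro σ _
    refine Fintype.sum_equiv (Equiv.arrowCongr σ.symm (Equiv.refl _)) _ _ fun f => ?_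
    have h1 : (Equiv.arrowCongr σ.symm (Equiv.refl (Fin m))) f = f ∘ σ := by ext; rfl
    rw [h1, mono_comp_perm, smul_tmul, Units.smul_def, Int.cast_smul_eq_zsmul]
  rw [Finset.sum_congr rfl this, Finset.sum_const, Finset.card_univ, Fintype.card_perm,
    Fintype.card_fin, ← Nat.cast_smul_eq_nsmul ℝ]

theorem assemble_mul (U : Opens (Mod m)) {k l : ℕ} (h : (Fin k → Fin m) → Smooth U)
    (h' : (Fin l → Fin m) → Smooth U) :
    assemble U k h * assemble U l h' = ((k + l).factorial * (k.factorial * l.factorial : ℝ)⁻¹) •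
      assemble U (k + l) fun f => h (fun i => f (Fin.castAdd l i)) *
        h' (fun i => f (Fin.natAdd k i)) := by
  simp only [assemble_apply, smul_mul_smul_comm, Finset.sum_mul_sum, smul_smul]
  congr 1
  · have := Nat.factorial_ne_zero (k + l)
    field_simp
  · rw [← Fintype.sum_prod_type']
    refine Fintype.sum_equiv (Fin.appendEquiv k l) _ _ fun x => ?_
    rw [Algebra.TensorProduct.tmul_mul_tmul, ← mono_append]
    simp [Fin.appendEquiv]

/-- An index map is split into its `p`-th entry and the rest. Moving that differential to the front
costs `(-1)^p`, and `1 / (k + 1)` is the ratio of the two normalizations. -/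
theorem assemble_insertNth (U : Opens (Mod m)) {k : ℕ} (p : Fin (k + 1))
    (h : Fin m → (Fin k → Fin m) → Smooth U) :
    assemble U (k + 1) (fun f => h (f p) (p.removeNth f)) =
      ((-1 : ℝ) ^ (p : ℕ) * (k + 1 : ℝ)⁻¹) •
        ∑ i, (formCalculus U).e i * assemble U k (h i) := by
  have h1 : ∑ f : Fin (k + 1) → Fin m, h (f p) (p.removeNth f) ⊗ₜ[ℝ] mono f =
      (-1 : ℝ) ^ (p : ℕ) • ∑ i, (formCalculus U).e i * ∑ g, h i g ⊗ₜ[ℝ] mono g := by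
    simp only [Finset.mul_sum]
    rw [← Fintype.sum_prod_type', Finset.smul_sum]
    symm
    refine Fintype.sum_equiv (Fin.insertNthEquiv (fun _ => Fin m) p) _ _ fun x => ?_
    have h2 : Fin.insertNthEquiv (fun _ => Fin m) p x = p.insertNth x.1 x.2 := by
      ext1 j; simp
    rw [h2, mono_insertNth, tmul_smul, Fin.insertNth_apply_same, Fin.removeNth_insertNth]
    change _ • ((1 ⊗ₜ _) * _) = _
    rw [Algebra.TensorProduct.tmul_mul_tmul, one_mul]
  simp only [assemble_apply, h1, mul_smul_comm, ← Finset.smul_sum, smul_smul]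
  congr 1
  rw [Nat.factorial_succ]
  push_cast
  field_simp

theorem D_assemble (U : Opens (Mod m)) {k : ℕ} (h : (Fin k → Fin m) → Smooth U) (i : Fin m) :
    (formCalculus U).D i (assemble U k h) =
      assemble U k fun f => Smooth.D (EuclideanSpace.single i 1) (h f) := by
  rw [assemble_apply, assemble_apply, map_smul, map_sum]
  rfl

/-! ### From differential forms to elements of the algebra. -/

open Classical in
/-- The restriction to an open set of a function which is smooth there. -/
def toSmooth (U : Opens (Mod m)) (g : Mod m → ℝ) : Smooth U :=
  -- The default value `0` gives every family of forms an image in the algebra; smoothness is then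
  -- needed only to compute with it.
  if h : ContDiffOn ℝ (⊤ : ℕ∞) g U then Smooth.res g h else 0

theorem toSmooth_apply {U : Opens (Mod m)} {g : Mod m → ℝ} (h : ContDiffOn ℝ (⊤ : ℕ∞) g U) (y : U) :
    (toSmooth U g).1 y = g y := by
  rw [toSmooth, dif_pos h]; rfl

theorem D_toSmooth {U : Opens (Mod m)} {g : Mod m → ℝ} (h : ContDiffOn ℝ (⊤ : ℕ∞) g U) (v : Mod m) :
    Smooth.D v (toSmooth U g) = toSmooth U fun y => fderiv ℝ g y v := by
  rw [toSmooth, dif_pos h, toSmooth, dif_pos (contDiffOn_fderiv_apply h v), Smooth.D_res]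

section Forms

variable {F : Type*} [NormedAddCommGroup F] [NormedSpace ℝ F]

theorem contDiffOn_form_apply {U : Set (Mod m)} {k : ℕ} {α : Mod m → Mod m [⋀^Fin k]→L[ℝ] F}
    (hα : ContDiffOn ℝ (⊤ : ℕ∞) α U) (v : Fin k → Mod m) :
    ContDiffOn ℝ (⊤ : ℕ∞) (fun y => α y v) U :=
  (ContinuousAlternatingMap.apply ℝ (Mod m) F v).contDiff.comp_contDiffOn hα

theorem contDiffOn_fun_const_smul {U : Set (Mod m)} {α : Mod m → F}
    (hα : ContDiffOn ℝ (⊤ : ℕ∞) α U) (r : ℝ) : ContDiffOn ℝ (⊤ : ℕ∞) (fun y => r • α y) U :=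
  contDiffOn_const.smul hα

end Forms

/-- The coefficients of a differential form. -/
def coeff (U : Opens (Mod m)) {k : ℕ} (α : Mod m → Mod m [⋀^Fin k]→L[ℝ] ℝ) (f : Fin k → Fin m) :
    Smooth U :=
  toSmooth U fun y => α y fun i => EuclideanSpace.single (f i) 1

theorem coeff_apply {U : Opens (Mod m)} {k : ℕ} {α : Mod m → Mod m [⋀^Fin k]→L[ℝ] ℝ}
    (hα : ContDiffOn ℝ (⊤ : ℕ∞) α U) (f : Fin k → Fin m) (y : U) :
    (coeff U α f).1 y = α y fun i => EuclideanSpace.single (f i) 1 :=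
  toSmooth_apply (contDiffOn_form_apply hα _) y

/-- The element of the algebra of forms on `U` given by a differential form which is smooth
on `U`. -/
def toAlg (U : Opens (Mod m)) {k : ℕ} (α : Mod m → Mod m [⋀^Fin k]→L[ℝ] ℝ) : FormAlg U :=
  assemble U k (coeff U α)

theorem toAlg_congr {U : Opens (Mod m)} {k : ℕ} {α β : Mod m → Mod m [⋀^Fin k]→L[ℝ] ℝ}
    (h : Set.EqOn α β U) : toAlg U α = toAlg U β := by
  have : coeff U α = coeff U β := by
    ext1 f
    have he : Set.EqOn (fun y => α y fun i => EuclideanSpace.single (f i) 1)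
      (fun y => β y fun i => EuclideanSpace.single (f i) 1) U := fun y hy => by
        simp only [h hy]
    by_cases hc : ContDiffOn ℝ (⊤ : ℕ∞) (fun y => α y fun i => EuclideanSpace.single (f i) 1) U
    · refine Subtype.ext (funext fun y => ?_)
      rw [coeff, coeff, toSmooth_apply hc, toSmooth_apply (hc.congr he.symm)]
      exact he y.2
    · rw [coeff, coeff, toSmooth, toSmooth, dif_neg hc, dif_neg fun hd => hc (hd.congr he)]
  rw [toAlg, toAlg, this]

theorem toAlg_add {U : Opens (Mod m)} {k : ℕ} {α β : Mod m → Mod m [⋀^Fin k]→L[ℝ] ℝ}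
    (hα : ContDiffOn ℝ (⊤ : ℕ∞) α U) (hβ : ContDiffOn ℝ (⊤ : ℕ∞) β U) :
    toAlg U (fun y => α y + β y) = toAlg U α + toAlg U β := by
  rw [toAlg, toAlg, toAlg, ← map_add]
  congr 1
  refine funext fun f => Subtype.ext (funext fun y => ?_)
  rw [coeff_apply (hα.add hβ)]
  change _ = (coeff U α f).1 y + (coeff U β f).1 y
  rw [coeff_apply hα, coeff_apply hβ]
  rfl

theorem toAlg_smul {U : Opens (Mod m)} {k : ℕ} {α : Mod m → Mod m [⋀^Fin k]→L[ℝ] ℝ}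
    (hα : ContDiffOn ℝ (⊤ : ℕ∞) α U) (r : ℝ) :
    toAlg U (fun y => r • α y) = r • toAlg U α := by
  rw [toAlg, toAlg, ← map_smul]
  congr 1
  refine funext fun f => Subtype.ext (funext fun y => ?_)
  rw [coeff_apply (contDiffOn_fun_const_smul hα r)]
  change _ = r • (coeff U α f).1 y
  rw [coeff_apply hα]
  rfl

theorem toAlg_castForm {U : Opens (Mod m)} {k l : ℕ} (h : k = l)
    (α : Mod m → Mod m [⋀^Fin k]→L[ℝ] ℝ) :
    toAlg U (fun y => castForm h (α y)) = toAlg U α := by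
  subst h; rfl

theorem toAlg_sub {U : Opens (Mod m)} {k : ℕ} {α β : Mod m → Mod m [⋀^Fin k]→L[ℝ] ℝ}
    (hα : ContDiffOn ℝ (⊤ : ℕ∞) α U) (hβ : ContDiffOn ℝ (⊤ : ℕ∞) β U) :
    toAlg U (fun y => α y - β y) = toAlg U α - toAlg U β := by
  have h := toAlg_add hα (contDiffOn_fun_const_smul hβ (-1))
  rw [toAlg_smul hβ] at h
  simpa [sub_eq_add_neg] using h

theorem toAlg_sum {U : Opens (Mod m)} {k : ℕ} {κ : Type*} [Fintype κ]
    {α : κ → Mod m → Mod m [⋀^Fin k]→L[ℝ] ℝ} (hα : ∀ s, ContDiffOn ℝ (⊤ : ℕ∞) (α s) U) :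
    toAlg U (fun y => ∑ s, α s y) = ∑ s, toAlg U (α s) := by
  simp only [toAlg, ← map_sum]
  congr 1
  refine funext fun f => Subtype.ext (funext fun y => ?_)
  rw [coeff_apply (ContDiffOn.sum fun s _ => hα s)]
  simp only [Finset.sum_apply, AddSubmonoidClass.coe_finsetSum, coeff_apply (hα _),
    ContinuousAlternatingMap.sum_apply]

theorem par_toAlg (U : Opens (Mod m)) {k : ℕ} (α : Mod m → Mod m [⋀^Fin k]→L[ℝ] ℝ) :
    (formCalculus U).Par k (toAlg U α) := by
  rw [toAlg, assemble_apply]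
  refine FormCalculus.Par.smul (FormCalculus.Par.sum fun f => ?_) _
  have h : CliffordAlgebra.involute (mono f) = (-1 : ℝ) ^ k • mono f := by
    rw [mono, ExteriorAlgebra.ιMulti_apply]
    have := CliffordAlgebra.involute_prod_map_ι (Q := (0 : QuadraticForm ℝ (Fin m → ℝ)))
      (List.ofFn fun i => Pi.single (f i) (1 : ℝ))
    rw [List.map_ofFn, List.length_ofFn] at this
    exact this
  change Algebra.TensorProduct.map _ _ _ = _
  rw [Algebra.TensorProduct.map_tmul, h, tmul_smul]
  rfl

end FN
end

noncomputable section
namespace FN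
open TensorProduct
open TopologicalSpace (Opens)
variable {m : ℕ}

/-! ### Wedge products in the algebra. -/

section Wedge

variable {F G H : Type*} [NormedAddCommGroup F] [NormedSpace ℝ F] [NormedAddCommGroup G]
  [NormedSpace ℝ G] [NormedAddCommGroup H] [NormedSpace ℝ H]

/-- The wedge product as a bilinear map. -/
def wedgeBilin (k l : ℕ) (B : F →L[ℝ] G →L[ℝ] H) :
    (Mod m [⋀^Fin k]→L[ℝ] F) →ₗ[ℝ] (Mod m [⋀^Fin l]→L[ℝ] G) →ₗ[ℝ] (Mod m [⋀^Fin (k + l)]→L[ℝ] H) :=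
  LinearMap.mk₂ ℝ (wedge B)
    (fun a a' b => by
      ext1 v
      simp only [wedge_apply, ContinuousAlternatingMap.add_apply, map_add, _root_.add_apply,
        smul_add, Finset.sum_add_distrib])
    (fun r a b => by
      ext1 v
      simp only [wedge_apply, ContinuousAlternatingMap.smul_apply, map_smul, _root_.smul_apply,
        Finset.smul_sum, smul_comm _ r])
    (fun a b b' => by
      ext1 v
      simp only [wedge_apply, ContinuousAlternatingMap.add_apply, map_add,
        smul_add, Finset.sum_add_distrib])
    (fun r a b => by
      ext1 v
      simp only [wedge_apply, ContinuousAlternatingMap.smul_apply, map_smul,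
        Finset.smul_sum, smul_comm _ r])

theorem contDiffOn_wedge [FiniteDimensional ℝ F] [FiniteDimensional ℝ G] {U : Set (Mod m)}
    {k l : ℕ} (B : F →L[ℝ] G →L[ℝ] H) {a : Mod m → Mod m [⋀^Fin k]→L[ℝ] F}
    {b : Mod m → Mod m [⋀^Fin l]→L[ℝ] G} (ha : ContDiffOn ℝ (⊤ : ℕ∞) a U)
    (hb : ContDiffOn ℝ (⊤ : ℕ∞) b U) : ContDiffOn ℝ (⊤ : ℕ∞) (fun y => wedge B (a y) (b y)) U := by
  have := finiteDimensional_form (E := Mod m) (F := F) (k := k)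
  have := finiteDimensional_form (E := Mod m) (F := G) (k := l)
  let f : (Mod m [⋀^Fin k]→L[ℝ] F) →L[ℝ] (Mod m [⋀^Fin l]→L[ℝ] G) →L[ℝ]
      (Mod m [⋀^Fin (k + l)]→L[ℝ] H) :=
    -- Bilinear maps on finite-dimensional spaces are continuous, hence smooth.
    LinearMap.toContinuousLinearMap
      (LinearMap.toContinuousLinearMap.toLinearMap ∘ₗ wedgeBilin k l B)
  exact (f.contDiff.comp_contDiffOn ha).clm_apply hb

theorem contDiffOn_compForm {U : Set (Mod m)} {k : ℕ} (p : F →L[ℝ] G)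
    {a : Mod m → Mod m [⋀^Fin k]→L[ℝ] F} (ha : ContDiffOn ℝ (⊤ : ℕ∞) a U) :
    ContDiffOn ℝ (⊤ : ℕ∞) (fun y => p.compContinuousAlternatingMap (a y)) U :=
  (ContinuousLinearMap.compContinuousAlternatingMapCLM ℝ (Mod m) F G (Fin k) p).contDiff.comp_contDiffOn
    ha

theorem coe_compForm {k : ℕ} (p : F →L[ℝ] G) (a : Mod m [⋀^Fin k]→L[ℝ] F) (v : Fin k → Mod m) :
    p.compContinuousAlternatingMap a v = p (a v) := rfl

/-- The wedge product corresponds to the multiplication. -/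
theorem toAlg_wedge [FiniteDimensional ℝ F] [FiniteDimensional ℝ G] {U : Opens (Mod m)} {k l : ℕ}
    {κ : Type*} [Fintype κ]
    (B : F →L[ℝ] G →L[ℝ] H) (q : H →L[ℝ] ℝ) (p : κ → F →L[ℝ] ℝ) (p' : κ → G →L[ℝ] ℝ)
    (hB : ∀ x z, q (B x z) = ∑ s, p s x * p' s z)
    {a : Mod m → Mod m [⋀^Fin k]→L[ℝ] F}
    {b : Mod m → Mod m [⋀^Fin l]→L[ℝ] G} (ha : ContDiffOn ℝ (⊤ : ℕ∞) a U)
    (hb : ContDiffOn ℝ (⊤ : ℕ∞) b U) :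
    toAlg U (fun y => q.compContinuousAlternatingMap (wedge B (a y) (b y))) =
      ∑ s, toAlg U (fun y => (p s).compContinuousAlternatingMap (a y)) *
        toAlg U (fun y => (p' s).compContinuousAlternatingMap (b y)) := by
  simp only [toAlg, assemble_mul]
  -- The factor `(k + l)!` from the product is absorbed into a sum over permutations, which is the
  -- sum in the definition of the wedge product; `1 / (k! l!)` is its normalization.
  rw [← Finset.smul_sum, ← map_sum, mul_comm, mul_smul, ← assemble_alternatization, ← map_smul]
  congr 1
  refine funext fun f => Subtype.ext (funext fun y => ?_)
  rw [coeff_apply (contDiffOn_compForm q (contDiffOn_wedge B ha hb)), coe_compForm, wedge_apply,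
    map_smul, map_sum]
  simp only [Pi.smul_apply, SetLike.val_smul, AddSubmonoidClass.coe_finsetSum, Finset.sum_apply,
    MulMemClass.coe_mul, Pi.mul_apply, coeff_apply (contDiffOn_compForm (p _) ha),
    coeff_apply (contDiffOn_compForm (p' _) hb), coe_compForm, Function.comp_apply]
  congr 1
  refine Finset.sum_congr rfl fun σ _ => ?_
  rw [Units.smul_def, map_zsmul, hB, ← Int.cast_smul_eq_zsmul ℝ]

end Wedge

/-! ### Insertions and the exterior derivative in the algebra; injectivity. -/

theorem curryLeft_contDiffOn {F : Type*} [NormedAddCommGroup F] [NormedSpace ℝ F]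
    {U : Set (Mod m)} {k : ℕ} {α : Mod m → Mod m [⋀^Fin (k + 1)]→L[ℝ] F}
    (hα : ContDiffOn ℝ (⊤ : ℕ∞) α U) (v : Mod m) :
    ContDiffOn ℝ (⊤ : ℕ∞) (fun y => (α y).curryLeft v) U :=
  (ContinuousAlternatingMap.curryLeftLI.contDiff.comp_contDiffOn hα).clm_apply contDiffOn_const

/-- Insertion of the `i`-th coordinate vector. -/
def insBasis {k : ℕ} (i : Fin m) (α : Mod m → Mod m [⋀^Fin (k + 1)]→L[ℝ] ℝ) (y : Mod m) :
    Mod m [⋀^Fin k]→L[ℝ] ℝ :=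
  (α y).curryLeft (EuclideanSpace.single i 1)

theorem coeff_cons {U : Opens (Mod m)} {k : ℕ} {α : Mod m → Mod m [⋀^Fin (k + 1)]→L[ℝ] ℝ}
    (hα : ContDiffOn ℝ (⊤ : ℕ∞) α U) (f : Fin (k + 1) → Fin m) :
    coeff U α f = coeff U (insBasis (f 0) α) ((0 : Fin (k + 1)).removeNth f) := by
  refine Subtype.ext (funext fun y => ?_)
  rw [coeff_apply hα, coeff_apply (α := insBasis (f 0) α) (curryLeft_contDiffOn hα _), insBasis,
    ContinuousAlternatingMap.curryLeft_apply_apply]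
  congr 1
  ext1 i
  refine Fin.cases ?_ (fun j => ?_) i <;> simp [Fin.removeNth]

/-- Euler's identity `∑ dx^i ∧ i_{∂_i} α = deg(α) α`, from splitting off the first index. It drives
the induction on the degree in `ins_toAlg`. -/
theorem toAlg_succ {U : Opens (Mod m)} {k : ℕ} {α : Mod m → Mod m [⋀^Fin (k + 1)]→L[ℝ] ℝ}
    (hα : ContDiffOn ℝ (⊤ : ℕ∞) α U) :
    (k + 1 : ℝ) • toAlg U α = ∑ i, (formCalculus U).e i * toAlg U (insBasis i α) := by
  have h := assemble_insertNth U (0 : Fin (k + 1)) fun i => coeff U (insBasis i α)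
  simp only [toAlg]
  rw [funext fun f => coeff_cons hα f, h, smul_smul]
  have : (k + 1 : ℝ) ≠ 0 := by positivity
  simp [this]

theorem toAlg_zero_form {U : Opens (Mod m)} (α : Mod m → Mod m [⋀^Fin 0]→L[ℝ] ℝ) :
    toAlg U α = coeff U α ![] ⊗ₜ[ℝ] 1 := by
  rw [toAlg, assemble_apply]
  simp [mono, Subsingleton.elim _ (![] : Fin 0 → Fin m)]

theorem ins_toAlg_zero {U : Opens (Mod m)} (α : Mod m → Mod m [⋀^Fin 0]→L[ℝ] ℝ) (i : Fin m) :
    (formCalculus U).ins i (toAlg U α) = 0 := by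
  rw [toAlg_zero_form]
  change LinearMap.lTensor _ _ _ = 0
  simp

theorem insBasis_insBasis {k : ℕ} (i j : Fin m) (α : Mod m → Mod m [⋀^Fin (k + 2)]→L[ℝ] ℝ) :
    insBasis i (insBasis j α) = fun y => (-1 : ℝ) • insBasis j (insBasis i α) y := by
  ext y v
  simp only [insBasis, ContinuousAlternatingMap.curryLeft_apply_apply,
    ContinuousAlternatingMap.smul_apply]
  have h := (α y).toAlternatingMap.map_swap
    (Matrix.vecCons (EuclideanSpace.single i (1 : ℝ)) (Matrix.vecCons (EuclideanSpace.single j 1) v))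
    (i := 0) (j := 1) (by simp)
  rw [neg_one_smul]
  refine Eq.trans (congrArg (α y) ?_) h
  ext1 s
  refine Fin.cases ?_ (fun s => ?_) s
  · simp
  · refine Fin.cases ?_ (fun s => ?_) s
    · simp
    · have h0 : s.succ.succ ≠ 0 := Fin.succ_ne_zero _
      have h1 : s.succ.succ ≠ 1 := by
        rw [← Fin.succ_zero_eq_one]; exact fun h => Fin.succ_ne_zero _ (Fin.succ_injective _ h)
      simp [Equiv.swap_apply_of_ne_of_ne h0 h1]

theorem insBasis_contDiffOn {U : Set (Mod m)} {k : ℕ} {α : Mod m → Mod m [⋀^Fin (k + 1)]→L[ℝ] ℝ}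
    (hα : ContDiffOn ℝ (⊤ : ℕ∞) α U) (i : Fin m) : ContDiffOn ℝ (⊤ : ℕ∞) (insBasis i α) U :=
  curryLeft_contDiffOn hα _

theorem succ_smul_ins_toAlg {U : Opens (Mod m)} {k : ℕ}
    {α : Mod m → Mod m [⋀^Fin (k + 1)]→L[ℝ] ℝ} (hα : ContDiffOn ℝ (⊤ : ℕ∞) α U) (i : Fin m) :
    (k + 1 : ℝ) • (formCalculus U).ins i (toAlg U α) = toAlg U (insBasis i α) -
      ∑ j, (formCalculus U).e j * (formCalculus U).ins i (toAlg U (insBasis j α)) := by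
  rw [← map_smul, toAlg_succ hα, map_sum]
  simp only [(formCalculus U).ins_mul, (formCalculus U).ins_e, (formCalculus U).γ_e,
    Finset.sum_add_distrib, neg_mul, Finset.sum_neg_distrib, sub_eq_add_neg]
  simp

/-- Insertion of coordinate vectors corresponds to the insertion operators of the algebra. -/
theorem ins_toAlg {U : Opens (Mod m)} {k : ℕ} {α : Mod m → Mod m [⋀^Fin (k + 1)]→L[ℝ] ℝ}
    (hα : ContDiffOn ℝ (⊤ : ℕ∞) α U) (i : Fin m) :
    (formCalculus U).ins i (toAlg U α) = toAlg U (insBasis i α) := by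
  induction k with
  | zero =>
    have h := succ_smul_ins_toAlg hα i
    simp only [ins_toAlg_zero, mul_zero, Finset.sum_const_zero, sub_zero] at h
    simpa using h
  | succ k ih =>
    have hk : ((k + 1 : ℕ) + 1 : ℝ) ≠ 0 := by positivity
    refine smul_right_injective (FormAlg U) hk ?_
    change ((k + 1 : ℕ) + 1 : ℝ) • (formCalculus U).ins i (toAlg U α) =
      ((k + 1 : ℕ) + 1 : ℝ) • toAlg U (insBasis i α)
    -- The induction hypothesis handles insertion into the contracted forms. Exchanging the two
    -- insertions turns the remaining sum into Euler's identity for `insBasis i α`, which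
    -- contributes the missing `k + 1` copies.
    have h2 (j : Fin m) : (formCalculus U).ins i (toAlg U (insBasis j α)) =
        -toAlg U (insBasis j (insBasis i α)) := by
      rw [ih (insBasis_contDiffOn hα j), insBasis_insBasis,
        toAlg_smul (insBasis_contDiffOn (insBasis_contDiffOn hα i) j), neg_one_smul]
    rw [succ_smul_ins_toAlg hα]
    simp only [h2, mul_neg, Finset.sum_neg_distrib]
    rw [← toAlg_succ (insBasis_contDiffOn hα i)]
    push_cast
    module

theorem extDeriv_contDiffOn {F : Type*} [NormedAddCommGroup F] [NormedSpace ℝ F]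
    {U : Opens (Mod m)} {k : ℕ} {α : Mod m → Mod m [⋀^Fin k]→L[ℝ] F}
    (hα : ContDiffOn ℝ (⊤ : ℕ∞) α U) : ContDiffOn ℝ (⊤ : ℕ∞) (extDeriv α) U := by
  have h1 := hα.fderiv_of_isOpen (m := (⊤ : ℕ∞)) U.isOpen (by simp)
  exact (ContinuousAlternatingMap.alternatizeUncurryFinCLM ℝ (Mod m) F).contDiff.comp_contDiffOn
    h1

theorem contDiffOn_differentiableAt {F : Type*} [NormedAddCommGroup F] [NormedSpace ℝ F]
    {U : Opens (Mod m)} {α : Mod m → F} (hα : ContDiffOn ℝ (⊤ : ℕ∞) α U) {y : Mod m} (hy : y ∈ U) :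
    DifferentiableAt ℝ α y :=
  (hα.contDiffAt (U.isOpen.mem_nhds hy)).differentiableAt (by simp)

/-- The exterior derivative corresponds to the differential of the algebra. -/
theorem toAlg_extDeriv {U : Opens (Mod m)} {k : ℕ} {α : Mod m → Mod m [⋀^Fin k]→L[ℝ] ℝ}
    (hα : ContDiffOn ℝ (⊤ : ℕ∞) α U) :
    toAlg U (extDeriv α) = (formCalculus U).d (toAlg U α) := by
  have h : coeff U (extDeriv α) = ∑ p : Fin (k + 1), fun f => (-1 : ℝ) ^ (p : ℕ) •
      Smooth.D (EuclideanSpace.single (f p) 1) (coeff U α (p.removeNth f)) := by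
    refine funext fun f => Subtype.ext (funext fun y => ?_)
    rw [coeff_apply (extDeriv_contDiffOn hα),
      extDeriv_apply (contDiffOn_differentiableAt hα y.2)]
    simp only [Finset.sum_apply, AddSubmonoidClass.coe_finsetSum, SetLike.val_smul, Pi.smul_apply]
    refine Finset.sum_congr rfl fun p _ => ?_
    rw [coeff, D_toSmooth (contDiffOn_form_apply hα _), toSmooth_apply
      (contDiffOn_fderiv_apply (contDiffOn_form_apply hα _) _), ← Int.cast_smul_eq_zsmul ℝ]
    push_cast
    rfl
  have h2 (p : Fin (k + 1)) := assemble_insertNth U p fun i g => (-1 : ℝ) ^ (p : ℕ) •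
      Smooth.D (EuclideanSpace.single i 1) (coeff U α g)
  rw [toAlg, h, map_sum, Finset.sum_congr rfl fun p _ => h2 p, FormCalculus.d_apply]
  have h3 (p : ℕ) (i : Fin m) : assemble U k (fun g => (-1 : ℝ) ^ p •
      Smooth.D (EuclideanSpace.single i 1) (coeff U α g)) =
        (-1 : ℝ) ^ p • (formCalculus U).D i (toAlg U α) := by
    rw [toAlg, D_assemble, ← map_smul]
    rfl
  simp only [h3, mul_smul_comm, ← Finset.smul_sum, smul_smul]
  -- The sign in the formula for `d` cancels the sign of moving the `p`-th differential to the
  -- front, so the `k + 1` positions contribute equally.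
  have h4 (p : ℕ) : (-1 : ℝ) ^ p * (k + 1 : ℝ)⁻¹ * (-1) ^ p = (k + 1 : ℝ)⁻¹ := by
    rcases neg_one_pow_eq_or ℝ p with hp | hp <;> rw [hp] <;> ring
  simp only [h4, Finset.sum_const, Finset.card_univ, Fintype.card_fin]
  rw [← Nat.cast_smul_eq_nsmul ℝ, smul_smul]
  push_cast
  rw [mul_inv_cancel₀ (by positivity), one_smul]

theorem curryLeft_eq_sum {F : Type*} [NormedAddCommGroup F] [NormedSpace ℝ F] {k : ℕ}
    (α : Mod m [⋀^Fin (k + 1)]→L[ℝ] F) (v : Mod m) :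
    α.curryLeft v = ∑ i, v i • α.curryLeft (EuclideanSpace.single i 1) := by
  conv_lhs => rw [← (EuclideanSpace.basisFun (Fin m) ℝ).sum_repr v]
  rw [map_sum]
  exact Finset.sum_congr rfl fun i _ => by simp

/-- A form which is smooth on `U` is determined on `U` by its image in the algebra. -/
theorem eqOn_zero_of_toAlg_eq_zero {U : Opens (Mod m)} {k : ℕ}
    {α : Mod m → Mod m [⋀^Fin k]→L[ℝ] ℝ} (hα : ContDiffOn ℝ (⊤ : ℕ∞) α U) (h : toAlg U α = 0)
    {y : Mod m} (hy : y ∈ U) : α y = 0 := by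
  induction k with
  | zero =>
    rw [toAlg_zero_form] at h
    -- The augmentation `Λ(ℝᵐ) → ℝ` recovers the coefficient function of a `0`-form.
    have h1 := congrArg (Algebra.TensorProduct.rid ℝ ℝ (Smooth U) ∘ Algebra.TensorProduct.map
      (AlgHom.id ℝ (Smooth U)) ExteriorAlgebra.algebraMapInv) h
    simp only [Function.comp_apply, Algebra.TensorProduct.map_tmul, map_one, map_zero] at h1
    simp only [AlgHom.coe_id, id_eq, Algebra.TensorProduct.rid_tmul, one_smul] at h1
    have h2 := congrFun (congrArg Subtype.val h1) ⟨y, hy⟩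
    rw [coeff_apply hα] at h2
    ext v
    rw [Subsingleton.elim v (fun i => EuclideanSpace.single (![] i) 1)]
    exact h2
  | succ k ih =>
    -- All insertions of `α` also have image zero, and a form of positive degree is determined by
    -- its insertions of basis vectors.
    have h1 (i : Fin m) : (α y).curryLeft (EuclideanSpace.single i 1) = 0 :=
      ih (insBasis_contDiffOn hα i) (by rw [← ins_toAlg hα, h, map_zero])
    ext v
    have h2 := ContinuousAlternatingMap.curryLeft_apply_apply (α y) (v 0) (Matrix.vecTail v)
    rw [show Matrix.vecCons (v 0) (Matrix.vecTail v) = v from Matrix.cons_head_tail v] at h2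
    rw [← h2, curryLeft_eq_sum]
    simp [h1]

theorem eqOn_of_toAlg_eq {U : Opens (Mod m)} {k : ℕ}
    {α β : Mod m → Mod m [⋀^Fin k]→L[ℝ] ℝ} (hα : ContDiffOn ℝ (⊤ : ℕ∞) α U)
    (hβ : ContDiffOn ℝ (⊤ : ℕ∞) β U) (h : toAlg U α = toAlg U β)
    {y : Mod m} (hy : y ∈ U) : α y = β y :=
  sub_eq_zero.1 (eqOn_zero_of_toAlg_eq_zero (α := fun y => α y - β y) (hα.sub hβ)
    (by rw [toAlg_sub hα hβ, h, sub_self]) hy)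

end FN
end

noncomputable section
namespace FN
open TensorProduct
open TopologicalSpace (Opens)
variable {m : ℕ}

/-! ### Vector-valued forms -/

/-- The `i`-th component of a vector-valued form. -/
def component {k : ℕ} (i : Fin m) (K : Mod m [⋀^Fin k]→L[ℝ] Mod m) : Mod m [⋀^Fin k]→L[ℝ] ℝ :=
  (EuclideanSpace.proj i : Mod m →L[ℝ] ℝ).compContinuousAlternatingMap K

theorem component_apply {k : ℕ} (i : Fin m) (K : Mod m [⋀^Fin k]→L[ℝ] Mod m) (v : Fin k → Mod m) :
    component i K v = K v i := rfl

theorem ext_component {k : ℕ} {K L : Mod m [⋀^Fin k]→L[ℝ] Mod m}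
    (h : ∀ i, component i K = component i L) : K = L := by
  ext v i
  exact DFunLike.congr_fun (h i) v

theorem component_contDiffOn {U : Set (Mod m)} {k : ℕ} {K : Mod m → Mod m [⋀^Fin k]→L[ℝ] Mod m}
    (hK : ContDiffOn ℝ (⊤ : ℕ∞) K U) (i : Fin m) :
    ContDiffOn ℝ (⊤ : ℕ∞) (fun y => component i (K y)) U :=
  contDiffOn_compForm _ hK

/-- The components of a vector-valued form as elements of the algebra. -/
def toVec (U : Opens (Mod m)) {k : ℕ} (K : Mod m → Mod m [⋀^Fin k]→L[ℝ] Mod m) (i : Fin m) :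
    FormAlg U :=
  toAlg U fun y => component i (K y)

theorem par_toVec (U : Opens (Mod m)) {k : ℕ} (K : Mod m → Mod m [⋀^Fin k]→L[ℝ] Mod m) (i : Fin m) :
    (formCalculus U).Par k (toVec U K i) := par_toAlg U _

theorem eqOn_of_toVec_eq {U : Opens (Mod m)} {k : ℕ} {K L : Mod m → Mod m [⋀^Fin k]→L[ℝ] Mod m}
    (hK : ContDiffOn ℝ (⊤ : ℕ∞) K U) (hL : ContDiffOn ℝ (⊤ : ℕ∞) L U)
    (h : toVec U K = toVec U L) {y : Mod m} (hy : y ∈ U) : K y = L y :=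
  ext_component fun i => eqOn_of_toAlg_eq (component_contDiffOn hK i) (component_contDiffOn hL i)
    (congrFun h i) hy

theorem toVec_congr {U : Opens (Mod m)} {k : ℕ} {K L : Mod m → Mod m [⋀^Fin k]→L[ℝ] Mod m}
    (h : Set.EqOn K L U) : toVec U K = toVec U L :=
  funext fun i => toAlg_congr fun y hy => by simp only [h hy]

theorem toVec_add {U : Opens (Mod m)} {k : ℕ} {K L : Mod m → Mod m [⋀^Fin k]→L[ℝ] Mod m}
    (hK : ContDiffOn ℝ (⊤ : ℕ∞) K U) (hL : ContDiffOn ℝ (⊤ : ℕ∞) L U) (i : Fin m) :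
    toVec U (fun y => K y + L y) i = toVec U K i + toVec U L i := by
  rw [toVec, toVec, toVec, ← toAlg_add (component_contDiffOn hK i) (component_contDiffOn hL i)]
  rfl

theorem toVec_smul {U : Opens (Mod m)} {k : ℕ} {K : Mod m → Mod m [⋀^Fin k]→L[ℝ] Mod m}
    (hK : ContDiffOn ℝ (⊤ : ℕ∞) K U) (r : ℝ) (i : Fin m) :
    toVec U (fun y => r • K y) i = r • toVec U K i := by
  rw [toVec, toVec, ← toAlg_smul (component_contDiffOn hK i)]
  congr 1

theorem toVec_sub {U : Opens (Mod m)} {k : ℕ} {K L : Mod m → Mod m [⋀^Fin k]→L[ℝ] Mod m}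
    (hK : ContDiffOn ℝ (⊤ : ℕ∞) K U) (hL : ContDiffOn ℝ (⊤ : ℕ∞) L U) (i : Fin m) :
    toVec U (fun y => K y - L y) i = toVec U K i - toVec U L i := by
  rw [toVec, toVec, toVec, ← toAlg_sub (component_contDiffOn hK i) (component_contDiffOn hL i)]
  rfl

theorem toVec_castForm {U : Opens (Mod m)} {k l : ℕ} (h : k = l)
    (K : Mod m → Mod m [⋀^Fin k]→L[ℝ] Mod m) :
    toVec U (fun y => castForm h (K y)) = toVec U K := by
  subst h; rfl

section

variable {F : Type*} [NormedAddCommGroup F] [NormedSpace ℝ F]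

theorem firstSlot_apply {k : ℕ} (α : Mod m [⋀^Fin (k + 1)]→L[ℝ] F) (v : Fin k → Mod m) (z : Mod m) :
    firstSlot α v z = α.curryLeft z v := rfl

theorem contDiff_of_endValued {k : ℕ}
    (g : (Mod m [⋀^Fin (k + 1)]→L[ℝ] F) →L[ℝ] Mod m [⋀^Fin k]→L[ℝ] (Mod m →L[ℝ] F)) :
    ContDiff ℝ (⊤ : ℕ∞) g :=
  ContinuousLinearMap.contDiff (𝕜 := ℝ) (E := Mod m [⋀^Fin (k + 1)]→L[ℝ] F)
    (F := Mod m [⋀^Fin k]→L[ℝ] (Mod m →L[ℝ] F)) g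

theorem firstSlot_contDiffOn [FiniteDimensional ℝ F] {U : Set (Mod m)} {k : ℕ}
    {α : Mod m → Mod m [⋀^Fin (k + 1)]→L[ℝ] F} (hα : ContDiffOn ℝ (⊤ : ℕ∞) α U) :
    ContDiffOn ℝ (⊤ : ℕ∞) (fun y => firstSlot (α y)) U := by
  have := finiteDimensional_form (E := Mod m) (F := F) (k := k + 1)
  let f : (Mod m [⋀^Fin (k + 1)]→L[ℝ] F) →ₗ[ℝ] Mod m [⋀^Fin k]→L[ℝ] (Mod m →L[ℝ] F) :=
    { toFun := firstSlot, map_add' := fun _ _ => rfl, map_smul' := fun _ _ => rfl }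
  let g : (Mod m [⋀^Fin (k + 1)]→L[ℝ] F) →L[ℝ] Mod m [⋀^Fin k]→L[ℝ] (Mod m →L[ℝ] F) :=
    LinearMap.toContinuousLinearMap f
  exact (contDiff_of_endValued g).comp_contDiffOn hα

theorem insertForm_contDiffOn [FiniteDimensional ℝ F] {U : Set (Mod m)} {k p : ℕ}
    {K : Mod m → Mod m [⋀^Fin k]→L[ℝ] Mod m} {α : Mod m → Mod m [⋀^Fin (p + 1)]→L[ℝ] F}
    (hK : ContDiffOn ℝ (⊤ : ℕ∞) K U) (hα : ContDiffOn ℝ (⊤ : ℕ∞) α U) :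
    ContDiffOn ℝ (⊤ : ℕ∞) (fun y => insertForm (K y) (α y)) U :=
  contDiffOn_wedge _ hK (firstSlot_contDiffOn hα)

/-- Insertion of a vector-valued form corresponds to the insertion in the algebra. -/
theorem toAlg_insertForm [FiniteDimensional ℝ F] {U : Opens (Mod m)} {k p : ℕ} (q : F →L[ℝ] ℝ)
    {K : Mod m → Mod m [⋀^Fin k]→L[ℝ] Mod m} {α : Mod m → Mod m [⋀^Fin (p + 1)]→L[ℝ] F}
    (hK : ContDiffOn ℝ (⊤ : ℕ∞) K U) (hα : ContDiffOn ℝ (⊤ : ℕ∞) α U) :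
    toAlg U (fun y => q.compContinuousAlternatingMap (insertForm (K y) (α y))) =
      (formCalculus U).insV (toVec U K)
        (toAlg U fun y => q.compContinuousAlternatingMap (α y)) := by
  rw [FormCalculus.insV_apply]
  simp only [ins_toAlg (contDiffOn_compForm q hα)]
  have hB (x : Mod m) (A : Mod m →L[ℝ] F) :
      q ((ContinuousLinearMap.id ℝ (Mod m →L[ℝ] F)).flip x A) =
        ∑ i, (EuclideanSpace.proj i : Mod m →L[ℝ] ℝ) x *
          (q.comp (ContinuousLinearMap.apply ℝ F (EuclideanSpace.single i (1 : ℝ)))) A := by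
    change q (A x) = _
    conv_lhs => rw [← (EuclideanSpace.basisFun (Fin m) ℝ).sum_repr x]
    simp
  have h := toAlg_wedge (U := U) (ContinuousLinearMap.id ℝ (Mod m →L[ℝ] F)).flip q
    (fun i => EuclideanSpace.proj i)
    (fun i => q.comp (ContinuousLinearMap.apply ℝ F (EuclideanSpace.single i (1 : ℝ)))) hB hK
    (firstSlot_contDiffOn hα)
  exact h

theorem extDeriv_compForm {U : Opens (Mod m)} {k : ℕ} (q : F →L[ℝ] ℝ)
    {α : Mod m → Mod m [⋀^Fin k]→L[ℝ] F} (hα : ContDiffOn ℝ (⊤ : ℕ∞) α U) {y : Mod m} (hy : y ∈ U) :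
    extDeriv (fun y => q.compContinuousAlternatingMap (α y)) y =
      q.compContinuousAlternatingMap (extDeriv α y) := by
  have hd := contDiffOn_differentiableAt hα hy
  ext v
  rw [extDeriv_apply (contDiffOn_differentiableAt (contDiffOn_compForm q hα) hy), coe_compForm,
    extDeriv_apply hd, map_sum]
  refine Finset.sum_congr rfl fun p _ => ?_
  rw [map_zsmul]
  congr 1
  have h1 : DifferentiableAt ℝ (fun y => α y (p.removeNth v)) y :=
    contDiffOn_differentiableAt (contDiffOn_form_apply hα _) hy
  have h2 := (q.hasFDerivAt.comp y h1.hasFDerivAt).fderiv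
  exact DFunLike.congr_fun h2 (v p)

theorem toAlg_compForm_extDeriv {U : Opens (Mod m)} {k : ℕ} (q : F →L[ℝ] ℝ)
    {α : Mod m → Mod m [⋀^Fin k]→L[ℝ] F} (hα : ContDiffOn ℝ (⊤ : ℕ∞) α U) :
    toAlg U (fun y => q.compContinuousAlternatingMap (extDeriv α y)) =
      (formCalculus U).d (toAlg U fun y => q.compContinuousAlternatingMap (α y)) := by
  rw [← toAlg_extDeriv (contDiffOn_compForm q hα)]
  exact toAlg_congr fun y hy => (extDeriv_compForm q hα hy).symm

end

/-! ### Lie derivative and bracket of vector-valued forms in the algebra. -/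

theorem flatDInsert_contDiffOn {U : Opens (Mod m)} {k l : ℕ}
    {K : Mod m → Mod m [⋀^Fin k]→L[ℝ] Mod m} {α : Mod m → Mod m [⋀^Fin l]→L[ℝ] Mod m}
    (hK : ContDiffOn ℝ (⊤ : ℕ∞) K U) (hα : ContDiffOn ℝ (⊤ : ℕ∞) α U) :
    ContDiffOn ℝ (⊤ : ℕ∞) (flatDInsert K α) U := by
  cases l with
  | zero => exact contDiffOn_const
  | succ l => exact extDeriv_contDiffOn (insertForm_contDiffOn hK hα)

theorem flatLie_contDiffOn {U : Opens (Mod m)} {k l : ℕ}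
    {K : Mod m → Mod m [⋀^Fin k]→L[ℝ] Mod m} {α : Mod m → Mod m [⋀^Fin l]→L[ℝ] Mod m}
    (hK : ContDiffOn ℝ (⊤ : ℕ∞) K U) (hα : ContDiffOn ℝ (⊤ : ℕ∞) α U) :
    ContDiffOn ℝ (⊤ : ℕ∞) (flatLie K α) U :=
  (insertForm_contDiffOn hK (extDeriv_contDiffOn hα)).add
    (contDiffOn_fun_const_smul (flatDInsert_contDiffOn hK hα) _)

theorem toVec_flatDInsert {U : Opens (Mod m)} {k l : ℕ}
    {K : Mod m → Mod m [⋀^Fin k]→L[ℝ] Mod m} {α : Mod m → Mod m [⋀^Fin l]→L[ℝ] Mod m}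
    (hK : ContDiffOn ℝ (⊤ : ℕ∞) K U) (hα : ContDiffOn ℝ (⊤ : ℕ∞) α U) (i : Fin m) :
    toVec U (flatDInsert K α) i =
      (formCalculus U).d ((formCalculus U).insV (toVec U K) (toVec U α i)) := by
  cases l with
  | zero =>
    -- The case distinction in `flatDInsert` matches the algebra, where insertion into a function
    -- gives zero.
    have h1 : (formCalculus U).insV (toVec U K) (toVec U α i) = 0 := by
      rw [FormCalculus.insV_apply]
      simp only [toVec, ins_toAlg_zero, mul_zero, Finset.sum_const_zero]
    have h2 := toVec_smul (K := flatDInsert K α)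
      (contDiffOn_const (c := (0 : Mod m [⋀^Fin k]→L[ℝ] Mod m)) (s := (U : Set (Mod m)))) 0 i
    rw [h1, map_zero]
    rw [zero_smul] at h2
    rw [← h2]
    congr 1
    funext y
    exact (zero_smul ℝ _).symm
  | succ l =>
    refine (toAlg_compForm_extDeriv _ (insertForm_contDiffOn hK hα)).trans ?_
    rw [toAlg_insertForm _ hK hα]
    rfl

theorem toVec_flatLie {U : Opens (Mod m)} {k l : ℕ}
    {K : Mod m → Mod m [⋀^Fin k]→L[ℝ] Mod m} {α : Mod m → Mod m [⋀^Fin l]→L[ℝ] Mod m}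
    (hK : ContDiffOn ℝ (⊤ : ℕ∞) K U) (hα : ContDiffOn ℝ (⊤ : ℕ∞) α U) (i : Fin m) :
    toVec U (flatLie K α) i = (formCalculus U).lie k (toVec U K) (toVec U α i) := by
  have h := toVec_add (insertForm_contDiffOn hK (extDeriv_contDiffOn hα))
    (contDiffOn_fun_const_smul (flatDInsert_contDiffOn hK hα) ((-1) ^ k)) i
  rw [toVec_smul (flatDInsert_contDiffOn hK hα), toVec_flatDInsert hK hα] at h
  rw [FormCalculus.lie_apply]
  refine h.trans ?_
  congr 1
  refine (toAlg_insertForm _ hK (extDeriv_contDiffOn hα)).trans ?_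
  rw [toAlg_compForm_extDeriv _ hα]
  rfl

/-- The Frölicher–Nijenhuis bracket in a vector space. -/
def flatBracket {k l : ℕ} (K : Mod m → Mod m [⋀^Fin k]→L[ℝ] Mod m)
    (L : Mod m → Mod m [⋀^Fin l]→L[ℝ] Mod m) (y : Mod m) : Mod m [⋀^Fin (k + l)]→L[ℝ] Mod m :=
  flatLie K L y - (-1 : ℝ) ^ (k * l) • castForm (Nat.add_comm l k) (flatLie L K y)

theorem castForm_contDiffOn {F : Type*} [NormedAddCommGroup F] [NormedSpace ℝ F]
    {U : Set (Mod m)} {k l : ℕ} (h : k = l) {α : Mod m → Mod m [⋀^Fin k]→L[ℝ] F}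
    (hα : ContDiffOn ℝ (⊤ : ℕ∞) α U) : ContDiffOn ℝ (⊤ : ℕ∞) (fun y => castForm h (α y)) U := by
  subst h; exact hα

theorem flatBracket_contDiffOn {U : Opens (Mod m)} {k l : ℕ}
    {K : Mod m → Mod m [⋀^Fin k]→L[ℝ] Mod m} {L : Mod m → Mod m [⋀^Fin l]→L[ℝ] Mod m}
    (hK : ContDiffOn ℝ (⊤ : ℕ∞) K U) (hL : ContDiffOn ℝ (⊤ : ℕ∞) L U) :
    ContDiffOn ℝ (⊤ : ℕ∞) (flatBracket K L) U :=
  (flatLie_contDiffOn hK hL).sub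
    (contDiffOn_fun_const_smul (castForm_contDiffOn _ (flatLie_contDiffOn hL hK)) _)

theorem toVec_flatBracket {U : Opens (Mod m)} {k l : ℕ}
    {K : Mod m → Mod m [⋀^Fin k]→L[ℝ] Mod m} {L : Mod m → Mod m [⋀^Fin l]→L[ℝ] Mod m}
    (hK : ContDiffOn ℝ (⊤ : ℕ∞) K U) (hL : ContDiffOn ℝ (⊤ : ℕ∞) L U) :
    toVec U (flatBracket K L) = (formCalculus U).bracket k l (toVec U K) (toVec U L) := by
  ext1 i
  have hc := castForm_contDiffOn (Nat.add_comm l k) (flatLie_contDiffOn hL hK)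
  have h := toVec_sub (flatLie_contDiffOn hK hL) (contDiffOn_fun_const_smul hc ((-1) ^ (k * l))) i
  rw [toVec_smul hc, toVec_castForm, toVec_flatLie hK hL, toVec_flatLie hL hK] at h
  exact h

/-! ### Trace, identity form and concomitant in components. -/

theorem trace_eq_sum (A : Mod m →ₗ[ℝ] Mod m) :
    LinearMap.trace ℝ (Mod m) A = ∑ i, A (EuclideanSpace.single i 1) i := by
  rw [LinearMap.trace_eq_sum_inner A (EuclideanSpace.basisFun (Fin m) ℝ)]
  simp [EuclideanSpace.inner_single_left]

theorem contract_eq_sum {k : ℕ} (K : Mod m [⋀^Fin (k + 1)]→L[ℝ] Mod m) :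
    contract K = ∑ i, (component i K).curryLeft (EuclideanSpace.single i 1) := by
  ext v
  rw [contract_apply, trace_eq_sum, ContinuousAlternatingMap.sum_apply]
  rfl

theorem contract_contDiffOn {U : Set (Mod m)} {k : ℕ}
    {K : Mod m → Mod m [⋀^Fin (k + 1)]→L[ℝ] Mod m} (hK : ContDiffOn ℝ (⊤ : ℕ∞) K U) :
    ContDiffOn ℝ (⊤ : ℕ∞) (fun y => contract (K y)) U :=
  contDiff_contract.comp_contDiffOn hK

theorem toAlg_contract {U : Opens (Mod m)} {k : ℕ}
    {K : Mod m → Mod m [⋀^Fin (k + 1)]→L[ℝ] Mod m} (hK : ContDiffOn ℝ (⊤ : ℕ∞) K U) :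
    toAlg U (fun y => contract (K y)) = ∑ i, (formCalculus U).ins i (toVec U K i) := by
  simp only [contract_eq_sum]
  refine (toAlg_sum (α := fun i => insBasis i fun y => component i (K y)) fun i =>
    insBasis_contDiffOn (component_contDiffOn hK i) i).trans ?_
  exact Finset.sum_congr rfl fun i _ => (ins_toAlg (component_contDiffOn hK i) i).symm

theorem toAlg_component_idForm (U : Opens (Mod m)) (i : Fin m) :
    toAlg U (fun _ => component i (idForm (Mod m))) = (formCalculus U).e i := by
  have hc : ContDiffOn ℝ (⊤ : ℕ∞) (fun _ : Mod m => component i (idForm (Mod m))) U :=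
    contDiffOn_const
  -- By Euler's identity the `1`-form is `∑ e j` times its `j`-th coefficient, and that coefficient
  -- is the Kronecker delta.
  have h := toAlg_succ hc
  have h2 (j : Fin m) : toAlg U (insBasis j fun _ => component i (idForm (Mod m))) =
      if j = i then 1 else 0 := by
    rw [toAlg_zero_form]
    have : coeff U (insBasis j fun _ => component i (idForm (Mod m))) ![] =
        if j = i then 1 else 0 := by
      refine Subtype.ext (funext fun y => ?_)
      rw [coeff_apply (insBasis_contDiffOn hc j), insBasis,
        ContinuousAlternatingMap.curryLeft_apply_apply, component_apply]
      by_cases hj : j = i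
      · subst hj
        simp [idForm]
      · simp [idForm, hj, Ne.symm hj]
    rw [this]
    split_ifs
    · rfl
    · simp
  simp only [h2, mul_ite, mul_one, mul_zero] at h
  simpa using h

theorem toVec_wedgeId {U : Opens (Mod m)} {k : ℕ} {φ : Mod m → Mod m [⋀^Fin k]→L[ℝ] ℝ}
    (hφ : ContDiffOn ℝ (⊤ : ℕ∞) φ U) :
    toVec U (fun y => wedgeId (φ y)) = fun i => toAlg U φ * (formCalculus U).e i := by
  ext1 i
  have h := toAlg_wedge (U := U) (ContinuousLinearMap.lsmul ℝ ℝ)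
    (EuclideanSpace.proj i : Mod m →L[ℝ] ℝ) (fun _ : Unit => ContinuousLinearMap.id ℝ ℝ)
    (fun _ => EuclideanSpace.proj i) (fun x z => by simp) hφ
    (contDiffOn_const (c := idForm (Mod m)))
  refine h.trans ?_
  rw [Fintype.sum_unique, ← toAlg_component_idForm]
  rfl

theorem concomitant_contDiffOn {U : Set (Mod m)} {k l : ℕ}
    {K : Mod m → Mod m [⋀^Fin (k + 1)]→L[ℝ] Mod m} {L : Mod m → Mod m [⋀^Fin (l + 1)]→L[ℝ] Mod m}
    (hK : ContDiffOn ℝ (⊤ : ℕ∞) K U) (hL : ContDiffOn ℝ (⊤ : ℕ∞) L U) :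
    ContDiffOn ℝ (⊤ : ℕ∞) (fun y => concomitant (K y) (L y)) U :=
  contDiffOn_wedge _ (firstSlot_contDiffOn hK) (firstSlot_contDiffOn hL)

theorem toAlg_concomitant {U : Opens (Mod m)} {k l : ℕ}
    {K : Mod m → Mod m [⋀^Fin (k + 1)]→L[ℝ] Mod m} {L : Mod m → Mod m [⋀^Fin (l + 1)]→L[ℝ] Mod m}
    (hK : ContDiffOn ℝ (⊤ : ℕ∞) K U) (hL : ContDiffOn ℝ (⊤ : ℕ∞) L U) :
    toAlg U (fun y => concomitant (K y) (L y)) = ∑ i, ∑ j,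
      (formCalculus U).ins i (toVec U K j) * (formCalculus U).ins j (toVec U L i) := by
  let p (s : Fin m × Fin m) : (Mod m →L[ℝ] Mod m) →L[ℝ] ℝ :=
    (EuclideanSpace.proj s.2 : Mod m →L[ℝ] ℝ).comp
      (ContinuousLinearMap.apply ℝ (Mod m) (EuclideanSpace.single s.1 (1 : ℝ)))
  have h := toAlg_wedge (U := U) (traceComp (Mod m)) (ContinuousLinearMap.id ℝ ℝ) p
    -- The pairing `tr(A ∘ B)` is a sum over pairs of matrix entries, with the indices exchanged in
    -- the second factor.
    (fun s => p (s.2, s.1)) (fun A B => by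
      change LinearMap.trace ℝ (Mod m) ((A.comp B : Mod m →L[ℝ] Mod m) : Mod m →ₗ[ℝ] Mod m) = _
      rw [trace_eq_sum, Fintype.sum_prod_type, Finset.sum_comm]
      refine Finset.sum_congr rfl fun j _ => ?_
      change A (B _) j = _
      conv_lhs => rw [← (EuclideanSpace.basisFun (Fin m) ℝ).sum_repr (B _)]
      simp [p, mul_comm])
    (firstSlot_contDiffOn hK) (firstSlot_contDiffOn hL)
  rw [Fintype.sum_prod_type] at h
  refine h.trans (Finset.sum_congr rfl fun i _ => Finset.sum_congr rfl fun j _ => ?_)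
  rw [toVec, toVec, ins_toAlg (component_contDiffOn hK j), ins_toAlg (component_contDiffOn hL i)]
  rfl

end FN
end

noncomputable section
namespace FN
open TopologicalSpace (Opens)
variable {m : ℕ}

/-! ### Identities for forms on open subsets of `ℝᵐ` -/

theorem flatBracket_jacobi {U : Opens (Mod m)} {k l n : ℕ}
    {K : Mod m → Mod m [⋀^Fin k]→L[ℝ] Mod m} {L : Mod m → Mod m [⋀^Fin l]→L[ℝ] Mod m}
    {N : Mod m → Mod m [⋀^Fin n]→L[ℝ] Mod m}
    (hK : ContDiffOn ℝ (⊤ : ℕ∞) K U) (hL : ContDiffOn ℝ (⊤ : ℕ∞) L U)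
    (hN : ContDiffOn ℝ (⊤ : ℕ∞) N U) {y : Mod m} (hy : y ∈ U) :
    flatBracket K (flatBracket L N) y =
      castForm (Nat.add_assoc k l n) (flatBracket (flatBracket K L) N y) +
        (-1 : ℝ) ^ (k * l) • castForm (Nat.add_left_comm l k n)
          (flatBracket L (flatBracket K N) y) := by
  have h1 := castForm_contDiffOn (Nat.add_assoc k l n)
    (flatBracket_contDiffOn (flatBracket_contDiffOn hK hL) hN)
  have h2 := castForm_contDiffOn (Nat.add_left_comm l k n)
    (flatBracket_contDiffOn hL (flatBracket_contDiffOn hK hN))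
  have h3 := contDiffOn_fun_const_smul h2 ((-1) ^ (k * l))
  refine eqOn_of_toVec_eq (L := fun y => castForm (Nat.add_assoc k l n)
      (flatBracket (flatBracket K L) N y) + (-1 : ℝ) ^ (k * l) •
        castForm (Nat.add_left_comm l k n) (flatBracket L (flatBracket K N) y))
    (flatBracket_contDiffOn hK (flatBracket_contDiffOn hL hN)) (h1.add h3) (funext fun i => ?_) hy
  rw [toVec_add h1 h3, toVec_smul h2, toVec_castForm, toVec_castForm,
    toVec_flatBracket hK (flatBracket_contDiffOn hL hN), toVec_flatBracket hL hN,
    toVec_flatBracket (flatBracket_contDiffOn hK hL) hN, toVec_flatBracket hK hL,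
    toVec_flatBracket hL (flatBracket_contDiffOn hK hN), toVec_flatBracket hK hN]
  exact FormCalculus.bracket_jacobi (par_toVec U K) (par_toVec U L) (par_toVec U N) i

theorem wedgeId_contDiffOn {U : Set (Mod m)} {k : ℕ} {φ : Mod m → Mod m [⋀^Fin k]→L[ℝ] ℝ}
    (hφ : ContDiffOn ℝ (⊤ : ℕ∞) φ U) : ContDiffOn ℝ (⊤ : ℕ∞) (fun y => wedgeId (φ y)) U :=
  contDiff_wedgeId.comp_contDiffOn hφ

theorem toAlg_zero (U : Opens (Mod m)) (k : ℕ) :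
    toAlg U (fun _ => (0 : Mod m [⋀^Fin k]→L[ℝ] ℝ)) = 0 := by
  have h := toAlg_smul (contDiffOn_const (c := (0 : Mod m [⋀^Fin k]→L[ℝ] ℝ))
    (s := (U : Set (Mod m)))) 0
  simpa using h

theorem toVec_zero (U : Opens (Mod m)) (k : ℕ) :
    toVec U (fun _ => (0 : Mod m [⋀^Fin k]→L[ℝ] Mod m)) = 0 := by
  ext1 i
  have h := toVec_smul (contDiffOn_const (c := (0 : Mod m [⋀^Fin k]→L[ℝ] Mod m))
    (s := (U : Set (Mod m)))) 0 i
  rw [zero_smul] at h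
  rw [Pi.zero_apply, ← h]
  congr 1
  funext y
  exact (zero_smul ℝ (0 : Mod m [⋀^Fin k]→L[ℝ] Mod m)).symm

theorem toAlg_insertForm_real {U : Opens (Mod m)} {k p : ℕ}
    {K : Mod m → Mod m [⋀^Fin k]→L[ℝ] Mod m} {α : Mod m → Mod m [⋀^Fin (p + 1)]→L[ℝ] ℝ}
    (hK : ContDiffOn ℝ (⊤ : ℕ∞) K U) (hα : ContDiffOn ℝ (⊤ : ℕ∞) α U) :
    toAlg U (fun y => insertForm (K y) (α y)) =
      (formCalculus U).insV (toVec U K) (toAlg U α) :=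
  toAlg_insertForm (ContinuousLinearMap.id ℝ ℝ) hK hα

theorem d_toAlg_eq_zero {U : Opens (Mod m)} {k : ℕ} {φ : Mod m → Mod m [⋀^Fin k]→L[ℝ] ℝ}
    (hφ : ContDiffOn ℝ (⊤ : ℕ∞) φ U) (hd : ∀ y ∈ U, extDeriv φ y = 0) :
    (formCalculus U).d (toAlg U φ) = 0 := by
  rw [← toAlg_extDeriv hφ, toAlg_congr (β := fun _ => 0) fun y hy => hd y hy, toAlg_zero]

/-- For a function `φ` the form `i_L φ` is zero, so the general formula `± d(i_L φ) ∧ I`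
degenerates. -/
theorem flatBracket_wedgeId_zero {U : Opens (Mod m)} {l : ℕ}
    {φ : Mod m → Mod m [⋀^Fin 0]→L[ℝ] ℝ} {L : Mod m → Mod m [⋀^Fin l]→L[ℝ] Mod m}
    (hφ : ContDiffOn ℝ (⊤ : ℕ∞) φ U) (hL : ContDiffOn ℝ (⊤ : ℕ∞) L U)
    (hd : ∀ y ∈ U, extDeriv φ y = 0) {y : Mod m} (hy : y ∈ U) :
    flatBracket (fun y => wedgeId (φ y)) L y = 0 := by
  refine eqOn_of_toVec_eq (L := fun _ => 0) (flatBracket_contDiffOn (wedgeId_contDiffOn hφ) hL)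
    contDiffOn_const (funext fun i => ?_) hy
  rw [toVec_zero, toVec_flatBracket (wedgeId_contDiffOn hφ) hL, toVec_wedgeId hφ]
  have h := FormCalculus.bracket_mul_e (par_toAlg U φ) (par_toVec U L) (d_toAlg_eq_zero hφ hd) i
  rw [FormCalculus.insV_apply] at h
  simp only [ins_toAlg_zero, mul_zero, Finset.sum_const_zero, map_zero, zero_mul, smul_zero] at h
  exact h

/-- The bracket of `φ ∧ I` with `L` for a closed form `φ` is of the form `dχ ∧ I`. -/
theorem flatBracket_wedgeId_succ {U : Opens (Mod m)} {q l : ℕ}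
    {φ : Mod m → Mod m [⋀^Fin (q + 1)]→L[ℝ] ℝ} {L : Mod m → Mod m [⋀^Fin l]→L[ℝ] Mod m}
    (hφ : ContDiffOn ℝ (⊤ : ℕ∞) φ U) (hL : ContDiffOn ℝ (⊤ : ℕ∞) L U)
    (hd : ∀ y ∈ U, extDeriv φ y = 0) {y : Mod m} (hy : y ∈ U) :
    flatBracket (fun y => wedgeId (φ y)) L y = (-1 : ℝ) ^ ((q + 1) * l + 1) •
      castForm (by omega) (wedgeId (extDeriv (fun y => insertForm (L y) (φ y)) y)) := by
  have h1 := wedgeId_contDiffOn (extDeriv_contDiffOn (insertForm_contDiffOn hL hφ))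
  have h2 := castForm_contDiffOn (show l + q + 1 + 1 = q + 1 + 1 + l by omega) h1
  refine eqOn_of_toVec_eq (L := fun y => (-1 : ℝ) ^ ((q + 1) * l + 1) •
      castForm (by omega) (wedgeId (extDeriv (fun y => insertForm (L y) (φ y)) y)))
    (flatBracket_contDiffOn (wedgeId_contDiffOn hφ) hL)
    (contDiffOn_fun_const_smul h2 _) (funext fun i => ?_) hy
  rw [toVec_smul h2, toVec_castForm, toVec_wedgeId (extDeriv_contDiffOn (insertForm_contDiffOn hL hφ)),
    toVec_flatBracket (wedgeId_contDiffOn hφ) hL, toVec_wedgeId hφ,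
    toAlg_extDeriv (insertForm_contDiffOn hL hφ), toAlg_insertForm_real hL hφ]
  exact FormCalculus.bracket_mul_e (par_toAlg U φ) (par_toVec U L) (d_toAlg_eq_zero hφ hd) i

/-- The trace of a vector-valued form vanishes; there is no condition in degree `0`. -/
def IsTraceless : {k : ℕ} → (Mod m [⋀^Fin k]→L[ℝ] Mod m) → Prop
  | 0, _ => True
  | _ + 1, K => contract K = 0

theorem isTraceless_iff {U : Opens (Mod m)} {k : ℕ} {K : Mod m → Mod m [⋀^Fin k]→L[ℝ] Mod m}
    (hK : ContDiffOn ℝ (⊤ : ℕ∞) K U) :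
    (∀ y ∈ U, IsTraceless (K y)) ↔ ∑ i, (formCalculus U).ins i (toVec U K i) = 0 := by
  cases k with
  | zero =>
    simp only [toVec, ins_toAlg_zero, Finset.sum_const_zero, iff_true]
    exact fun _ _ => trivial
  | succ k =>
    rw [← toAlg_contract hK]
    constructor
    · intro h
      rw [toAlg_congr (β := fun _ => 0) fun y hy => h y hy, toAlg_zero]
    · exact fun h y hy => eqOn_zero_of_toAlg_eq_zero (contract_contDiffOn hK) h hy

/-- This is `FormCalculus.sum_ins_bracket` for actual forms. The form `B` is the bracket read in a
degree visibly of the shape `n + 1`, so that `contract` applies; the sign is `(-1)^k` since `K` has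
degree `k + 1`. -/
theorem contract_flatBracket {U : Opens (Mod m)} {k l : ℕ}
    {K : Mod m → Mod m [⋀^Fin (k + 1)]→L[ℝ] Mod m} {L : Mod m → Mod m [⋀^Fin (l + 1)]→L[ℝ] Mod m}
    (hK : ContDiffOn ℝ (⊤ : ℕ∞) K U) (hL : ContDiffOn ℝ (⊤ : ℕ∞) L U)
    (hcK : ∀ y ∈ U, IsTraceless (K y)) (hcL : ∀ y ∈ U, IsTraceless (L y))
    {B : Mod m → Mod m [⋀^Fin (k + 1 + l + 1)]→L[ℝ] Mod m} (hB : B = flatBracket K L)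
    {y : Mod m} (hy : y ∈ U) :
    contract (B y) =
      (-1 : ℝ) ^ k • castForm (by omega) (extDeriv (fun y => concomitant (K y) (L y)) y) := by
  have h1 := extDeriv_contDiffOn (concomitant_contDiffOn hK hL)
  have h2 := castForm_contDiffOn (show k + l + 1 = k + 1 + l by omega) h1
  have hBs : ContDiffOn ℝ (⊤ : ℕ∞) B U := hB ▸ flatBracket_contDiffOn hK hL
  have hBv : toVec U B = (formCalculus U).bracket (k + 1) (l + 1) (toVec U K) (toVec U L) :=
    hB ▸ toVec_flatBracket hK hL
  have h := FormCalculus.sum_ins_bracket (par_toVec U K) (par_toVec U L)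
    ((isTraceless_iff hK).1 hcK) ((isTraceless_iff hL).1 hcL)
  rw [← hBv, ← toAlg_contract hBs, ← toAlg_concomitant hK hL,
    ← toAlg_extDeriv (concomitant_contDiffOn hK hL)] at h
  refine eqOn_of_toAlg_eq (α := fun y => contract (B y)) (β := fun y => (-1 : ℝ) ^ k •
      castForm (by omega) (extDeriv (fun y => concomitant (K y) (L y)) y))
    (contract_contDiffOn hBs) (contDiffOn_fun_const_smul h2 _) ?_ hy
  rw [toAlg_smul h2, toAlg_castForm, h, pow_succ]
  module

/-- A factor of degree `0` admits no insertions, so the concomitant, and with it the trace of the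
bracket, vanishes. -/
theorem isTraceless_flatBracket_zero {U : Opens (Mod m)} {k l : ℕ}
    {K : Mod m → Mod m [⋀^Fin k]→L[ℝ] Mod m} {L : Mod m → Mod m [⋀^Fin l]→L[ℝ] Mod m}
    (hK : ContDiffOn ℝ (⊤ : ℕ∞) K U) (hL : ContDiffOn ℝ (⊤ : ℕ∞) L U)
    (hcK : ∀ y ∈ U, IsTraceless (K y)) (hcL : ∀ y ∈ U, IsTraceless (L y)) (h0 : k = 0 ∨ l = 0)
    {y : Mod m} (hy : y ∈ U) : IsTraceless (flatBracket K L y) := by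
  refine (isTraceless_iff (flatBracket_contDiffOn hK hL)).2 ?_ y hy
  rw [toVec_flatBracket hK hL, FormCalculus.sum_ins_bracket (par_toVec U K) (par_toVec U L)
    ((isTraceless_iff hK).1 hcK) ((isTraceless_iff hL).1 hcL)]
  rcases h0 with rfl | rfl <;> simp only [toVec, ins_toAlg_zero] <;> simp

theorem insV_e_toAlg {U : Opens (Mod m)} {k : ℕ} {φ : Mod m → Mod m [⋀^Fin k]→L[ℝ] ℝ}
    (hφ : ContDiffOn ℝ (⊤ : ℕ∞) φ U) :
    (formCalculus U).insV (formCalculus U).e (toAlg U φ) = (k : ℝ) • toAlg U φ := by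
  rw [FormCalculus.insV_apply]
  cases k with
  | zero => simp [ins_toAlg_zero]
  | succ k => simp only [ins_toAlg hφ, ← toAlg_succ hφ]; push_cast; rfl

/-- `c (φ ∧ I) = (-1)^k (m - k) φ`. -/
theorem contract_wedgeId {k : ℕ} (φ : Mod m [⋀^Fin k]→L[ℝ] ℝ) :
    contract (wedgeId φ) = ((-1 : ℝ) ^ k * ((m : ℝ) - k)) • φ := by
  -- A pointwise identity becomes one in the algebra by regarding `φ` as a constant form on `ℝᵐ`.
  have hφ : ContDiffOn ℝ (⊤ : ℕ∞) (fun _ : Mod m => φ) (⊤ : Opens (Mod m)) := contDiffOn_const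
  refine eqOn_of_toAlg_eq (U := ⊤) (α := fun _ => contract (wedgeId φ))
    (β := fun _ => ((-1 : ℝ) ^ k * ((m : ℝ) - k)) • φ) contDiffOn_const contDiffOn_const ?_
    (y := 0) trivial
  rw [toAlg_smul hφ, toAlg_contract (wedgeId_contDiffOn hφ), toVec_wedgeId hφ,
    FormCalculus.sum_ins_mul_e (par_toAlg ⊤ _), insV_e_toAlg hφ, Fintype.card_fin]
  module

theorem form_eq_zero_of_lt {F : Type*} [NormedAddCommGroup F] [NormedSpace ℝ F] {k : ℕ}
    (h : m < k) (α : Mod m [⋀^Fin k]→L[ℝ] F) : α = 0 := by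
  ext v
  refine α.toAlternatingMap.map_linearDependent v fun hv => ?_
  have := hv.fintype_card_le_finrank
  simp at this
  omega

/-- In the top degree the contraction is injective. -/
theorem eq_zero_of_contract_eq_zero {n : ℕ} (hn : m ≤ n + 1)
    {K : Mod m [⋀^Fin (n + 1)]→L[ℝ] Mod m} (h : contract K = 0) : K = 0 := by
  have hK : ContDiffOn ℝ (⊤ : ℕ∞) (fun _ : Mod m => K) (⊤ : Opens (Mod m)) := contDiffOn_const
  have hc : ContDiffOn ℝ (⊤ : ℕ∞) (fun _ : Mod m => idForm (Mod m)) (⊤ : Opens (Mod m)) :=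
    contDiffOn_const
  refine eqOn_of_toVec_eq (U := ⊤) (K := fun _ => K) (L := fun _ => 0) contDiffOn_const
    contDiffOn_const (funext fun i => ?_) (y := 0) trivial
  rw [toVec_zero]
  refine FormCalculus.eq_zero_of_sum_ins_eq_zero (fun i j => ?_)
    ((isTraceless_iff hK).1 fun _ _ => h) i
  have h1 := toAlg_wedge (U := (⊤ : Opens (Mod m))) (ContinuousLinearMap.mul ℝ ℝ)
    (ContinuousLinearMap.id ℝ ℝ) (fun _ : Unit => ContinuousLinearMap.id ℝ ℝ)
    (fun _ => ContinuousLinearMap.id ℝ ℝ) (fun x z => by simp) (component_contDiffOn hc i)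
    (component_contDiffOn hK j)
  rw [Fintype.sum_unique] at h1
  rw [← toAlg_component_idForm]
  refine Eq.trans h1.symm ?_
  rw [toAlg_congr (β := fun _ => 0), toAlg_zero]
  -- The product `dx^i ∧ K^j` has degree `n + 2 > m`.
  exact fun y _ => form_eq_zero_of_lt (by omega) _

/-! ### Naturality -/

theorem insertForm_pullback {F : Type*} [NormedAddCommGroup F] [NormedSpace ℝ F] {k p : ℕ}
    {K K' : Mod m [⋀^Fin k]→L[ℝ] Mod m} (α : Mod m [⋀^Fin (p + 1)]→L[ℝ] F) (A : Mod m →L[ℝ] Mod m)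
    (h : A.compContinuousAlternatingMap K' = K.compContinuousLinearMap A) :
    insertForm K' (α.compContinuousLinearMap A) = (insertForm K α).compContinuousLinearMap A := by
  ext1 v
  rw [ContinuousAlternatingMap.compContinuousLinearMap_apply, insertForm, insertForm, wedge_apply,
    wedge_apply]
  congr 1
  refine Finset.sum_congr rfl fun σ _ => ?_
  congr 1
  have h1 := DFunLike.congr_fun h fun i => v (σ (Fin.castAdd p i))
  simp only [coe_compForm, ContinuousAlternatingMap.compContinuousLinearMap_apply] at h1
  simp only [ContinuousLinearMap.flip_apply, ContinuousLinearMap.id_apply, firstSlot_apply,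
    ContinuousAlternatingMap.curryLeft_apply_apply,
    ContinuousAlternatingMap.compContinuousLinearMap_apply]
  congr 1
  ext1 i
  refine Fin.cases ?_ (fun i => ?_) i
  · simpa [Function.comp_def] using h1
  · simp

/-- Since `K` alternates, all `k!` permutations in the wedge product contribute the same value `A (K
v)`. -/
theorem insertForm_ofSubsingleton {F : Type*} [NormedAddCommGroup F] [NormedSpace ℝ F] {k : ℕ}
    (K : Mod m [⋀^Fin k]→L[ℝ] Mod m) (A : Mod m →L[ℝ] F) :
    insertForm K (ContinuousAlternatingMap.ofSubsingleton ℝ (Mod m) F (0 : Fin 1) A) =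
      A.compContinuousAlternatingMap K := by
  ext1 v
  rw [insertForm, wedge_apply]
  have h (σ : Equiv.Perm (Fin (k + 0))) : Equiv.Perm.sign σ •
      (ContinuousLinearMap.id ℝ (Mod m →L[ℝ] F)).flip (K fun i => v (σ (Fin.castAdd 0 i)))
        (firstSlot (ContinuousAlternatingMap.ofSubsingleton ℝ (Mod m) F (0 : Fin 1) A)
          fun i => v (σ (Fin.natAdd k i))) = A (K v) := by
    have h1 := K.toAlternatingMap.map_perm v σ
    change _ • A (K fun i => v (σ i)) = _
    rw [show K (fun i => v (σ i)) = Equiv.Perm.sign σ • K v from h1, Units.smul_def,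
      Units.smul_def, map_zsmul, smul_smul]
    simp
  simp only [h, Finset.sum_const, Finset.card_univ, Fintype.card_perm, Fintype.card_fin]
  rw [← Nat.cast_smul_eq_nsmul ℝ, smul_smul, coe_compForm]
  have := Nat.factorial_ne_zero k
  simp only [add_zero, Nat.factorial_zero, Nat.cast_one, mul_one]
  rw [inv_mul_cancel₀ (by positivity), one_smul]

section Naturality

variable {W V : Opens (Mod m)} {τ : Mod m → Mod m}

/-- The pullback of a vector-valued form; the values are not transformed. -/
def pullback {k : ℕ} (τ : Mod m → Mod m) (α : Mod m → Mod m [⋀^Fin k]→L[ℝ] Mod m) (z : Mod m) :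
    Mod m [⋀^Fin k]→L[ℝ] Mod m :=
  (α (τ z)).compContinuousLinearMap (fderiv ℝ τ z)

theorem extDeriv_pullback_eq (hτ : ContDiffOn ℝ (⊤ : ℕ∞) τ W) (hm : Set.MapsTo τ W V) {k : ℕ}
    {α : Mod m → Mod m [⋀^Fin k]→L[ℝ] Mod m} (hα : ContDiffOn ℝ (⊤ : ℕ∞) α V) {z : Mod m}
    (hz : z ∈ W) : extDeriv (pullback τ α) z = pullback τ (extDeriv α) z := by
  have h : ContDiffAt ℝ 2 τ z :=
    (hτ.contDiffAt (W.isOpen.mem_nhds hz)).of_le (by norm_cast)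
  exact extDeriv_pullback (contDiffOn_differentiableAt hα (hm hz)) h (by simp)

variable {k l : ℕ} {K K' : Mod m → Mod m [⋀^Fin k]→L[ℝ] Mod m}
  {L L' : Mod m → Mod m [⋀^Fin l]→L[ℝ] Mod m}

/-- Pullback commutes with `d` and, when `K'` and `K` are `τ`-related, with insertion; both hold
near `z`, as the derivative requires. -/
theorem flatLie_pullback (hτ : ContDiffOn ℝ (⊤ : ℕ∞) τ W) (hm : Set.MapsTo τ W V)
    (hK : ContDiffOn ℝ (⊤ : ℕ∞) K V) (hL : ContDiffOn ℝ (⊤ : ℕ∞) L V)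
    (hKK : ∀ z ∈ W, (fderiv ℝ τ z).compContinuousAlternatingMap (K' z) = pullback τ K z)
    {z : Mod m} (hz : z ∈ W) : flatLie K' (pullback τ L) z = pullback τ (flatLie K L) z := by
  have h1 : insertForm (K' z) (extDeriv (pullback τ L) z) =
      (insertForm (K (τ z)) (extDeriv L (τ z))).compContinuousLinearMap (fderiv ℝ τ z) := by
    rw [extDeriv_pullback_eq hτ hm hL hz]
    exact insertForm_pullback _ _ (hKK z hz)
  have h2 : flatDInsert K' (pullback τ L) z =
      (flatDInsert K L (τ z)).compContinuousLinearMap (fderiv ℝ τ z) := by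
    cases l with
    | zero => rfl
    | succ l =>
      have h3 : (fun y => insertForm (K' y) (pullback τ L y)) =ᶠ[nhds z]
          pullback τ (fun y => insertForm (K y) (L y)) := by
        filter_upwards [W.isOpen.mem_nhds hz] with y hy
        exact insertForm_pullback _ _ (hKK y hy)
      change extDeriv _ z = (extDeriv _ (τ z)).compContinuousLinearMap _
      rw [h3.extDeriv_eq, extDeriv_pullback_eq hτ hm (insertForm_contDiffOn hK hL) hz]
      rfl
  rw [flatLie, h1, h2]
  rfl

theorem pullback_contDiffOn (hτ : ContDiffOn ℝ (⊤ : ℕ∞) τ W) 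
    (hK' : ContDiffOn ℝ (⊤ : ℕ∞) K' W)
    (hKK : ∀ z ∈ W, (fderiv ℝ τ z).compContinuousAlternatingMap (K' z) = pullback τ K z) :
    ContDiffOn ℝ (⊤ : ℕ∞) (pullback τ K) W := by
  have h1 := hτ.fderiv_of_isOpen (m := (⊤ : ℕ∞)) W.isOpen (by simp)
  have h2 := (ContinuousLinearMap.contDiff (𝕜 := ℝ) (E := Mod m →L[ℝ] Mod m)
    (F := (Mod m [⋀^Fin k]→L[ℝ] Mod m) →L[ℝ] (Mod m [⋀^Fin k]→L[ℝ] Mod m))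
    (ContinuousLinearMap.compContinuousAlternatingMapCLM ℝ (Mod m) (Mod m) (Mod m)
      (Fin k))).comp_contDiffOn h1
  exact (h2.clm_apply hK').congr fun z hz => (hKK z hz).symm

/-- The map `τ` as a `0`-form. -/
def asForm (τ : Mod m → Mod m) (z : Mod m) : Mod m [⋀^Fin 0]→L[ℝ] Mod m :=
  ContinuousAlternatingMap.constOfIsEmpty ℝ (Mod m) (Fin 0) (τ z)

theorem asForm_contDiffOn (hτ : ContDiffOn ℝ (⊤ : ℕ∞) τ W) :
    ContDiffOn ℝ (⊤ : ℕ∞) (asForm τ) W :=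
  (ContinuousAlternatingMap.constOfIsEmptyLIE ℝ (Mod m) (Mod m) (Fin 0)).contDiff.comp_contDiffOn hτ

/-- On functions only the term `i_K dτ` survives. This expresses `dτ ∘ K` as a Lie derivative, so
that the commutator formula applies to it. -/
theorem flatLie_asForm (K : Mod m → Mod m [⋀^Fin k]→L[ℝ] Mod m) (z : Mod m) :
    flatLie K (asForm τ) z = (fderiv ℝ τ z).compContinuousAlternatingMap (K z) := by
  have h : extDeriv (asForm τ) z = _ := extDeriv_constOfIsEmpty τ z
  rw [flatLie, h, insertForm_ofSubsingleton]
  exact (congrArg (_ + ·) (smul_zero ((-1 : ℝ) ^ k))).trans (add_zero _)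

/-- The bracket of vector-valued forms is natural. -/
theorem flatBracket_pullback (hτ : ContDiffOn ℝ (⊤ : ℕ∞) τ W) (hm : Set.MapsTo τ W V)
    (hK : ContDiffOn ℝ (⊤ : ℕ∞) K V) (hL : ContDiffOn ℝ (⊤ : ℕ∞) L V)
    (hK' : ContDiffOn ℝ (⊤ : ℕ∞) K' W) (hL' : ContDiffOn ℝ (⊤ : ℕ∞) L' W)
    (hKK : ∀ z ∈ W, (fderiv ℝ τ z).compContinuousAlternatingMap (K' z) = pullback τ K z)
    (hLL : ∀ z ∈ W, (fderiv ℝ τ z).compContinuousAlternatingMap (L' z) = pullback τ L z)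
    {z : Mod m} (hz : z ∈ W) :
    (fderiv ℝ τ z).compContinuousAlternatingMap (flatBracket K' L' z) =
      pullback τ (flatBracket K L) z := by
  have hp (z : Mod m) (hz : z ∈ W) : pullback τ (flatBracket K L) z =
      flatLie K' (pullback τ L) z - (-1 : ℝ) ^ (k * l) •
        castForm (Nat.add_comm l k) (flatLie L' (pullback τ K) z) := by
    rw [flatLie_pullback hτ hm hK hL hKK hz, flatLie_pullback hτ hm hL hK hLL hz]
    have hc {p q : ℕ} (h : p = q) (α : Mod m [⋀^Fin p]→L[ℝ] Mod m) (A : Mod m →L[ℝ] Mod m) :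
      castForm h (α.compContinuousLinearMap A) = (castForm h α).compContinuousLinearMap A := by
        subst h; rfl
    rw [pullback, pullback, pullback, hc]
    rfl
  have hpK := pullback_contDiffOn hτ hK' hKK
  have hpL := pullback_contDiffOn hτ hL' hLL
  have hB := flatBracket_contDiffOn hK' hL'
  have h0 := asForm_contDiffOn hτ
  have hc := castForm_contDiffOn (Nat.add_comm l k) (flatLie_contDiffOn hL' hpK)
  -- The claim now reads `Θ([K', L']) τ = Θ(K') (τ^* L) - (-1)^{k l} Θ(L') (τ^* K)`.
  rw [hp z hz, ← flatLie_asForm]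
  refine eqOn_of_toVec_eq (K := flatLie (flatBracket K' L') (asForm τ))
    (L := fun z => flatLie K' (pullback τ L) z - (-1 : ℝ) ^ (k * l) •
        castForm (Nat.add_comm l k) (flatLie L' (pullback τ K) z)) (flatLie_contDiffOn hB h0)
    ((flatLie_contDiffOn hK' hpL).sub (contDiffOn_fun_const_smul hc _)) (funext fun i => ?_) hz
  -- By relatedness `τ^* K = dτ ∘ K' = Θ(K') τ`, and likewise for `L`, so the claim is the
  -- commutator formula on the components of `τ`.
  have hKe : toVec W (pullback τ K) i =
      (formCalculus W).lie k (toVec W K') (toVec W (asForm τ) i) := by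
    rw [← toVec_flatLie hK' h0]
    exact congrFun (toVec_congr fun z hz => by rw [flatLie_asForm, hKK z hz]) i
  have hLe : toVec W (pullback τ L) i =
      (formCalculus W).lie l (toVec W L') (toVec W (asForm τ) i) := by
    rw [← toVec_flatLie hL' h0]
    exact congrFun (toVec_congr fun z hz => by rw [flatLie_asForm, hLL z hz]) i
  rw [toVec_flatLie hB h0, toVec_flatBracket hK' hL',
    FormCalculus.lie_bracket (par_toVec W K') (par_toVec W L'),
    toVec_sub (flatLie_contDiffOn hK' hpL) (contDiffOn_fun_const_smul hc _), toVec_smul hc,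
    toVec_castForm, toVec_flatLie hK' hpL, toVec_flatLie hL' hpK, hKe, hLe]

end Naturality

end FN
end

noncomputable section
namespace FN

/-! ### The bracket on a manifold -/

section CastForm

variable {E F : Type*} [NormedAddCommGroup E] [NormedSpace ℝ E] [NormedAddCommGroup F]
  [NormedSpace ℝ F]

theorem castForm_add {k l : ℕ} (h : k = l) (α β : E [⋀^Fin k]→L[ℝ] F) :
    castForm h (α + β) = castForm h α + castForm h β := by subst h; rfl

theorem castForm_sub {k l : ℕ} (h : k = l) (α β : E [⋀^Fin k]→L[ℝ] F) :
    castForm h (α - β) = castForm h α - castForm h β := by subst h; rfl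

theorem castForm_smul {k l : ℕ} (h : k = l) (r : ℝ) (α : E [⋀^Fin k]→L[ℝ] F) :
    castForm h (r • α) = r • castForm h α := by subst h; rfl

theorem castForm_castForm {k l n : ℕ} (h : k = l) (h' : l = n) (α : E [⋀^Fin k]→L[ℝ] F) :
    castForm h' (castForm h α) = castForm (h.trans h') α := by subst h; subst h'; rfl

theorem castForm_rfl {k : ℕ} (h : k = k) (α : E [⋀^Fin k]→L[ℝ] F) : castForm h α = α := rfl

end CastForm

/-! ### Antisymmetry, locality and bilinearity of the bracket in coordinates. -/

section FlatBracket

open TopologicalSpace (Opens)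

variable {m : ℕ} {U : Opens (Mod m)} {k l : ℕ}

theorem flatBracket_symm (K : Mod m → Mod m [⋀^Fin k]→L[ℝ] Mod m)
    (L : Mod m → Mod m [⋀^Fin l]→L[ℝ] Mod m) (y : Mod m) :
    flatBracket K L y =
      -((-1 : ℝ) ^ (k * l) • castForm (Nat.add_comm l k) (flatBracket L K y)) := by
  rw [flatBracket, flatBracket, castForm_sub, castForm_smul, castForm_castForm, castForm_rfl,
    mul_comm l k]
  rcases neg_one_pow_eq_or ℝ (k * l) with h | h <;> rw [h] <;> module

theorem flatBracket_congr {K K' : Mod m → Mod m [⋀^Fin k]→L[ℝ] Mod m}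
    {L L' : Mod m → Mod m [⋀^Fin l]→L[ℝ] Mod m}
    (hK : ContDiffOn ℝ (⊤ : ℕ∞) K U) (hL : ContDiffOn ℝ (⊤ : ℕ∞) L U)
    (hKK : Set.EqOn K' K U) (hLL : Set.EqOn L' L U) {y : Mod m} (hy : y ∈ U) :
    flatBracket K' L' y = flatBracket K L y := by
  refine eqOn_of_toVec_eq (flatBracket_contDiffOn (hK.congr hKK) (hL.congr hLL))
    (flatBracket_contDiffOn hK hL) ?_ hy
  rw [toVec_flatBracket hK hL, toVec_flatBracket (hK.congr hKK) (hL.congr hLL), toVec_congr hKK,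
    toVec_congr hLL]

theorem flatBracket_add_left {K K' : Mod m → Mod m [⋀^Fin k]→L[ℝ] Mod m}
    {L : Mod m → Mod m [⋀^Fin l]→L[ℝ] Mod m} (hK : ContDiffOn ℝ (⊤ : ℕ∞) K U)
    (hK' : ContDiffOn ℝ (⊤ : ℕ∞) K' U) (hL : ContDiffOn ℝ (⊤ : ℕ∞) L U) {y : Mod m} (hy : y ∈ U) :
    flatBracket (fun y => K y + K' y) L y = flatBracket K L y + flatBracket K' L y := by
  have h1 := flatBracket_contDiffOn hK hL
  have h2 := flatBracket_contDiffOn hK' hL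
  refine eqOn_of_toVec_eq (L := fun y => flatBracket K L y + flatBracket K' L y)
    (flatBracket_contDiffOn (hK.add hK') hL) (h1.add h2) (funext fun i => ?_) hy
  rw [toVec_add h1 h2, toVec_flatBracket hK hL, toVec_flatBracket hK' hL,
    toVec_flatBracket (hK.add hK') hL]
  simp only [FormCalculus.bracket, FormCalculus.lie_apply, FormCalculus.insV_apply,
    toVec_add hK hK', add_mul, Finset.sum_add_distrib, map_add, smul_add]
  abel

theorem flatBracket_smul_left {K : Mod m → Mod m [⋀^Fin k]→L[ℝ] Mod m}
    {L : Mod m → Mod m [⋀^Fin l]→L[ℝ] Mod m} (r : ℝ) (hK : ContDiffOn ℝ (⊤ : ℕ∞) K U)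
    (hL : ContDiffOn ℝ (⊤ : ℕ∞) L U) {y : Mod m} (hy : y ∈ U) :
    flatBracket (fun y => r • K y) L y = r • flatBracket K L y := by
  have h1 := flatBracket_contDiffOn hK hL
  have hr := contDiffOn_fun_const_smul hK r
  refine eqOn_of_toVec_eq (L := fun y => r • flatBracket K L y)
    (flatBracket_contDiffOn hr hL) (contDiffOn_fun_const_smul h1 r) (funext fun i => ?_) hy
  rw [toVec_smul h1, toVec_flatBracket hK hL, toVec_flatBracket hr hL]
  simp only [FormCalculus.bracket, FormCalculus.lie_apply, FormCalculus.insV_apply,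
    toVec_smul hK, smul_mul_assoc, ← Finset.smul_sum, map_smul]
  module

end FlatBracket

/-! ### Charts and independence of the bracket from the chart. -/

section Manifold

open scoped Manifold

universe u

open TopologicalSpace (Opens)

variable {m : ℕ} {M : Type u} [TopologicalSpace M] [ChartedSpace (Mod m) M]

/-- The image of the preferred chart at `x`. -/
def chartTarget (m : ℕ) {M : Type u} [TopologicalSpace M] [ChartedSpace (Mod m) M] (x : M) :
    Opens (Mod m) :=
  ⟨(extChartAt (𝓡 m) x).target, isOpen_extChartAt_target x⟩

theorem mem_chartTarget_self (x : M) : extChartAt (𝓡 m) x x ∈ chartTarget m x :=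
  mem_extChartAt_target x

variable [IsManifold (𝓡 m) (⊤ : ℕ∞) M]

theorem fnBracket_apply {k l : ℕ} (K : RawVForm m M k) (L : RawVForm m M l) (x : M) :
    fnBracket K L x =
      flatBracket (RawVForm.rep K x) (RawVForm.rep L x) (extChartAt (𝓡 m) x x) := rfl

/-- The overlap of the preferred charts at `x` and at `p`, in the coordinates of the former. -/
def chartOverlap (x p : M) : Opens (Mod m) :=
  ⟨(extChartAt (𝓡 m) x).target ∩ (extChartAt (𝓡 m) x).symm ⁻¹' (extChartAt (𝓡 m) p).source,
    (continuousOn_extChartAt_symm x).isOpen_inter_preimage (isOpen_extChartAt_target x)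
      (isOpen_extChartAt_source p)⟩

theorem coordChange_contDiffOn (x p : M) : ContDiffOn ℝ (⊤ : ℕ∞)
    (extChartAt (𝓡 m) p ∘ (extChartAt (𝓡 m) x).symm) (chartOverlap (m := m) x p) := by
  rintro z ⟨hz, hz'⟩
  have := contDiffWithinAt_ext_coord_change (I := 𝓡 m) (n := (⊤ : ℕ∞)) p x (y := z) (by
    rw [PartialEquiv.trans_source'', PartialEquiv.symm_symm, PartialEquiv.symm_target]
    exact ⟨(extChartAt (𝓡 m) x).symm z, ⟨(extChartAt (𝓡 m) x).map_target hz, hz'⟩,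
      (extChartAt (𝓡 m) x).right_inv hz⟩)
  rw [ModelWithCorners.range_eq_univ, contDiffWithinAt_univ] at this
  exact this.contDiffWithinAt

theorem fderiv_coordChange {x p : M} {z : Mod m} (hz : z ∈ chartOverlap (m := m) x p) :
    fderiv ℝ (extChartAt (𝓡 m) p ∘ (extChartAt (𝓡 m) x).symm) z =
      tangentCoordChange (𝓡 m) x p ((extChartAt (𝓡 m) x).symm z) := by
  have := hasFDerivWithinAt_tangentCoordChange (I := 𝓡 m) (x := x) (y := p)
    (z := (extChartAt (𝓡 m) x).symm z) ⟨(extChartAt (𝓡 m) x).map_target hz.1, hz.2⟩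
  rw [ModelWithCorners.range_eq_univ, hasFDerivWithinAt_univ] at this
  have h3 := this.fderiv
  rwa [(extChartAt (𝓡 m) x).right_inv hz.1] at h3

/-- The expressions of `K` in two charts are related by the coordinate change, which is the
hypothesis of `flatBracket_pullback`. -/
theorem RawVForm.rep_coordChange {k : ℕ} (K : RawVForm m M k) {x p : M} {z : Mod m}
    (hz : z ∈ chartOverlap (m := m) x p) :
    (fderiv ℝ (extChartAt (𝓡 m) p ∘ (extChartAt (𝓡 m) x).symm)
        z).compContinuousAlternatingMap (RawVForm.rep K x z) =
      pullback (extChartAt (𝓡 m) p ∘ (extChartAt (𝓡 m) x).symm) (RawVForm.rep K p) z := by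
  rw [pullback, fderiv_coordChange hz]
  have h4 : (extChartAt (𝓡 m) p).symm ((extChartAt (𝓡 m) p ∘ (extChartAt (𝓡 m) x).symm) z) =
    (extChartAt (𝓡 m) x).symm z := (extChartAt (𝓡 m) p).left_inv hz.2
  have hx : (extChartAt (𝓡 m) x).symm z ∈ (extChartAt (𝓡 m) x).source :=
    (extChartAt (𝓡 m) x).map_target hz.1
  have hs := mem_extChartAt_source (I := 𝓡 m) ((extChartAt (𝓡 m) x).symm z)
  ext1 v
  simp only [RawVForm.rep, h4, coe_compForm,
    ContinuousAlternatingMap.compContinuousLinearMap_apply]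
  rw [tangentCoordChange_comp ⟨⟨hs, hx⟩, hz.2⟩]
  congr 2
  ext1 i
  simp only [Function.comp_apply]
  rw [tangentCoordChange_comp ⟨⟨hx, hz.2⟩, hs⟩]

/-- `fnBracket` uses a different chart at each point. By naturality under the coordinate change from
the chart at `x` to the chart at the point `p` with coordinates `y`, one fixed chart gives the same
result. -/
theorem rep_fnBracket {k l : ℕ} {K : RawVForm m M k} {L : RawVForm m M l}
    (hK : K ∈ vformSubmodule m M k) (hL : L ∈ vformSubmodule m M l) (x : M) {y : Mod m}
    (hy : y ∈ chartTarget m x) :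
    RawVForm.rep (fnBracket K L) x y = flatBracket (RawVForm.rep K x) (RawVForm.rep L x) y := by
  set p := (extChartAt (𝓡 m) x).symm y with hp
  have hps : p ∈ (extChartAt (𝓡 m) x).source := (extChartAt (𝓡 m) x).map_target hy
  have hyW : y ∈ chartOverlap (m := m) x p := ⟨hy, mem_extChartAt_source p⟩
  have hsub : (chartOverlap (m := m) x p : Set (Mod m)) ⊆ chartTarget m x := fun z hz => hz.1
  have h := flatBracket_pullback (V := chartTarget m p) (coordChange_contDiffOn x p)
    (fun z hz => (extChartAt (𝓡 m) p).map_source hz.2) (mem_vform.1 hK p) (mem_vform.1 hL p)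
    ((mem_vform.1 hK x).mono hsub) ((mem_vform.1 hL x).mono hsub)
    (fun z hz => RawVForm.rep_coordChange K hz) (fun z hz => RawVForm.rep_coordChange L hz) hyW
  rw [pullback, fderiv_coordChange hyW] at h
  rw [RawVForm.rep, ← hp, fnBracket_apply]
  rw [← hp] at h
  have h5 : (extChartAt (𝓡 m) p ∘ (extChartAt (𝓡 m) x).symm) y = extChartAt (𝓡 m) p p := rfl
  rw [h5] at h
  rw [← h]
  ext1 v
  exact DFunLike.congr_fun (tangentCoordChange_inv hps) _

theorem VForm.contDiffOn {k : ℕ} {K : RawVForm m M k} (hK : K ∈ vformSubmodule m M k) (x : M) :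
    ContDiffOn ℝ (⊤ : ℕ∞) (RawVForm.rep K x) (chartTarget m x) := mem_vform.1 hK x

theorem Form.contDiffOn {k : ℕ} {K : RawForm m M k} (hK : K ∈ formSubmodule m M k) (x : M) :
    ContDiffOn ℝ (⊤ : ℕ∞) (RawForm.rep K x) (chartTarget m x) := mem_form.1 hK x

theorem fnBracket_mem {k l : ℕ} {K : RawVForm m M k} {L : RawVForm m M l}
    (hK : K ∈ vformSubmodule m M k) (hL : L ∈ vformSubmodule m M l) :
    fnBracket K L ∈ vformSubmodule m M (k + l) :=
  mem_vform.2 fun x => (flatBracket_contDiffOn (VForm.contDiffOn hK x) (VForm.contDiffOn hL x)).congr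
    fun _ hy => rep_fnBracket hK hL x hy

theorem fnBracket_symm {k l : ℕ} (K : RawVForm m M k) (L : RawVForm m M l) (x : M) :
    fnBracket K L x = -((-1 : ℝ) ^ (k * l) • castForm (Nat.add_comm l k) (fnBracket L K x)) :=
  flatBracket_symm _ _ _

theorem RawVForm.rep_add {k : ℕ} (K L : RawVForm m M k) (x : M) :
    RawVForm.rep (K + L) x = fun y => RawVForm.rep K x y + RawVForm.rep L x y := by
  ext; simp [RawVForm.rep]

theorem RawVForm.rep_smul {k : ℕ} (r : ℝ) (K : RawVForm m M k) (x : M) :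
    RawVForm.rep (r • K) x = fun y => r • RawVForm.rep K x y := by
  ext; simp [RawVForm.rep]

theorem fnBracket_add_left {k l : ℕ} {K K' : RawVForm m M k} {L : RawVForm m M l}
    (hK : K ∈ vformSubmodule m M k) (hK' : K' ∈ vformSubmodule m M k)
    (hL : L ∈ vformSubmodule m M l) :
    fnBracket (K + K') L = fnBracket K L + fnBracket K' L := by
  ext1 x
  rw [fnBracket_apply, RawVForm.rep_add, flatBracket_add_left (VForm.contDiffOn hK x)
    (VForm.contDiffOn hK' x) (VForm.contDiffOn hL x) (mem_chartTarget_self x)]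
  rfl

theorem fnBracket_smul_left {k l : ℕ} (r : ℝ) {K : RawVForm m M k} {L : RawVForm m M l}
    (hK : K ∈ vformSubmodule m M k) (hL : L ∈ vformSubmodule m M l) :
    fnBracket (r • K) L = r • fnBracket K L := by
  ext1 x
  rw [fnBracket_apply, RawVForm.rep_smul, flatBracket_smul_left r (VForm.contDiffOn hK x)
    (VForm.contDiffOn hL x) (mem_chartTarget_self x)]
  rfl

/-- The Frölicher–Nijenhuis bracket as a bilinear map. -/
def VForm.bracket (k l : ℕ) : VForm m M k →ₗ[ℝ] VForm m M l →ₗ[ℝ] VForm m M (k + l) :=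
  LinearMap.mk₂ ℝ (fun K L => ⟨fnBracket K.1 L.1, fnBracket_mem K.2 L.2⟩)
    (fun K K' L => Subtype.ext (fnBracket_add_left K.2 K'.2 L.2))
    (fun r K L => Subtype.ext (fnBracket_smul_left r K.2 L.2))
    -- Linearity in the second argument follows from the first by graded anticommutativity.
    (fun K L L' => Subtype.ext (funext fun x => by
      change fnBracket K.1 (L.1 + L'.1) x = fnBracket K.1 L.1 x + fnBracket K.1 L'.1 x
      rw [fnBracket_symm, fnBracket_add_left L.2 L'.2 K.2, fnBracket_symm K.1 L.1,
        fnBracket_symm K.1 L'.1, Pi.add_apply, castForm_add, smul_add, neg_add]))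
    (fun r K L => Subtype.ext (funext fun x => by
      change fnBracket K.1 (r • L.1) x = r • fnBracket K.1 L.1 x
      rw [fnBracket_symm, fnBracket_smul_left r L.2 K.2, fnBracket_symm K.1 L.1, Pi.smul_apply,
        castForm_smul, smul_neg, smul_comm r]))

/-- By `rep_fnBracket` all inner brackets may be computed in the one chart at `x`, where the
identity is `flatBracket_jacobi`. -/
theorem fnBracket_jacobi {k l n : ℕ} {K : RawVForm m M k} {L : RawVForm m M l}
    {N : RawVForm m M n} (hK : K ∈ vformSubmodule m M k) (hL : L ∈ vformSubmodule m M l)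
    (hN : N ∈ vformSubmodule m M n) (x : M) :
    fnBracket K (fnBracket L N) x =
      castForm (Nat.add_assoc k l n) (fnBracket (fnBracket K L) N x) +
        (-1 : ℝ) ^ (k * l) • castForm (Nat.add_left_comm l k n)
          (fnBracket L (fnBracket K N) x) := by
  have cK := VForm.contDiffOn hK x
  have cL := VForm.contDiffOn hL x
  have cN := VForm.contDiffOn hN x
  have hx := mem_chartTarget_self (m := m) x
  rw [fnBracket_apply, fnBracket_apply, fnBracket_apply,
    flatBracket_congr cK (flatBracket_contDiffOn cL cN) (fun _ _ => rfl)
      (fun y hy => rep_fnBracket hL hN x hy) hx,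
    flatBracket_congr (flatBracket_contDiffOn cK cL) cN
      (fun y hy => rep_fnBracket hK hL x hy) (fun _ _ => rfl) hx,
    flatBracket_congr cL (flatBracket_contDiffOn cK cN) (fun _ _ => rfl)
      (fun y hy => rep_fnBracket hK hN x hy) hx]
  exact flatBracket_jacobi cK cL cN hx

end Manifold

end FN
end

noncomputable section
namespace FN

/-! ### The complex of tangent bundle valued forms -/

section Manifold

open scoped Manifold

universe u

open TopologicalSpace (Opens)

variable {m : ℕ} {M : Type u} [TopologicalSpace M] [ChartedSpace (Mod m) M]
  [IsManifold (𝓡 m) (⊤ : ℕ∞) M]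

theorem VForm.ext {k : ℕ} {K L : VForm m M k} (h : ∀ x, K.1 x = L.1 x) : K = L :=
  Subtype.ext (funext h)

theorem Form.ext {k : ℕ} {K L : Form m M k} (h : ∀ x, K.1 x = L.1 x) : K = L :=
  Subtype.ext (funext h)

theorem VForm.eq_zero_of_lt {k : ℕ} (h : m < k) (K : VForm m M k) : K = 0 :=
  VForm.ext fun _ => form_eq_zero_of_lt h _

theorem Form.eq_zero_of_lt {k : ℕ} (h : m < k) (K : Form m M k) : K = 0 :=
  Form.ext fun _ => form_eq_zero_of_lt h _

theorem VForm.c_wedgeI {k : ℕ} (φ : Form m M k) :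
    VForm.c k (Form.wedgeI k φ) = ((-1 : ℝ) ^ k * ((m : ℝ) - k)) • φ :=
  Form.ext fun _ => contract_wedgeId _

theorem Form.d_d {k : ℕ} (φ : Form m M k) : Form.d (k + 1) (Form.d k φ) = 0 := by
  refine Form.ext fun x => ?_
  have h : RawForm.rep (RawForm.d φ.1) x =ᶠ[nhds (extChartAt (𝓡 m) x x)]
      extDeriv (RawForm.rep φ.1 x) := by
    filter_upwards [(chartTarget m x).isOpen.mem_nhds (mem_chartTarget_self x)] with y hy
    exact RawForm.rep_d φ.2 x hy
  change extDeriv (RawForm.rep (RawForm.d φ.1) x) _ = 0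
  rw [h.extDeriv_eq]
  exact extDeriv_extDeriv_apply ((Form.contDiffOn φ.2 x).contDiffAt
    ((chartTarget m x).isOpen.mem_nhds (mem_chartTarget_self x)))
    (by simp only [minSmoothness_of_isRCLikeNormedField]; norm_cast)

theorem VForm.δ_succ {k : ℕ} (K : VForm m M (k + 1)) :
    VForm.δ (k + 1) K = (-1 : ℝ) ^ k • Form.wedgeI (k + 1) (Form.d k (VForm.c k K)) := rfl

/-- The trace of `d c(K) ∧ I` is a multiple of the closed form `d c(K)`. -/
theorem VForm.δ_δ {k : ℕ} (K : VForm m M k) : VForm.δ (k + 1) (VForm.δ k K) = 0 := by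
  cases k with
  | zero => exact map_zero _
  | succ k =>
    rw [VForm.δ_succ (VForm.δ (k + 1) K), VForm.δ_succ K, map_smul, VForm.c_wedgeI, map_smul,
      map_smul, map_smul, Form.d_d, smul_zero, map_zero, smul_zero, smul_zero]

/-- The trace of `δ K` is `± (m - (k + 1)) d c(K)`, and the factor is nonzero below the top degree.
-/
theorem d_c_eq_zero {k : ℕ} (hk : k + 1 < m) {K : VForm m M (k + 1)} (h : VForm.δ (k + 1) K = 0) :
    Form.d k (VForm.c k K) = 0 := by
  have h1 := congrArg (VForm.c (k + 1)) h
  rw [VForm.δ_succ, map_smul, VForm.c_wedgeI, map_zero, smul_smul, smul_eq_zero] at h1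
  refine h1.resolve_left ?_
  have : (m : ℝ) - ((k : ℝ) + 1) ≠ 0 := by
    rw [sub_ne_zero]; exact_mod_cast hk.ne'
  simp [this]

theorem wedgeI_d_mem_boundaries {k : ℕ} (ψ : Form m M k) :
    Form.wedgeI (k + 1) (Form.d k ψ) ∈ VForm.boundaries m M (k + 1 + 1) := by
  rcases lt_or_ge k m with hk | hk
  -- Since `δ (ψ ∧ I) = (m - k) dψ ∧ I`, the witness is `ψ ∧ I` divided by `m - k`. For `k ≥ m` the
  -- form `dψ` is zero by degree.
  · have hm : (m : ℝ) - k ≠ 0 := by rw [sub_ne_zero]; exact_mod_cast hk.ne'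
    refine ⟨((m : ℝ) - k)⁻¹ • Form.wedgeI k ψ, ?_⟩
    rw [VForm.δ_succ, map_smul, VForm.c_wedgeI, smul_smul, map_smul, map_smul, smul_smul]
    have : (-1 : ℝ) ^ k * (((m : ℝ) - k)⁻¹ * ((-1) ^ k * ((m : ℝ) - k))) = 1 := by
      rcases neg_one_pow_eq_or ℝ k with h | h <;> rw [h] <;> field_simp
    rw [this, one_smul]
  · rw [Form.eq_zero_of_lt (by omega) (Form.d k ψ), map_zero]
    exact zero_mem _

theorem mem_boundaries_of_castForm {p q : ℕ} (h : p = q) (r : ℝ) {N : VForm m M p}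
    {N' : VForm m M q} (hN : N ∈ VForm.boundaries m M p)
    (e : ∀ x, N'.1 x = r • castForm h (N.1 x)) : N' ∈ VForm.boundaries m M q := by
  subst h
  have : N' = r • N := VForm.ext e
  rw [this]
  exact Submodule.smul_mem _ _ hN

/-! ### Cocycles, boundaries and their decomposition. -/

variable (m M) in
/-- The forms `φ ∧ I` with `φ` closed. -/
def closedPart : (k : ℕ) → Submodule ℝ (VForm m M k)
  | 0 => ⊥
  | k + 1 => (LinearMap.ker (Form.d k)).map (Form.wedgeI k)

theorem boundaries_le_closedPart (k : ℕ) : VForm.boundaries m M k ≤ closedPart m M k := by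
  cases k with
  | zero => exact le_rfl
  | succ k =>
    rintro _ ⟨K, rfl⟩
    cases k with
    | zero => exact zero_mem _
    | succ k => exact Submodule.smul_mem _ _ ⟨_, Form.d_d _, rfl⟩

theorem closedPart_le_cocycles (k : ℕ) : closedPart m M k ≤ VForm.cocycles m M k := by
  cases k with
  | zero => exact bot_le
  | succ k =>
    rintro _ ⟨φ, hφ, rfl⟩
    have hφ' : Form.d k φ = 0 := hφ
    rw [LinearMap.mem_ker, VForm.δ_succ, VForm.c_wedgeI, map_smul, hφ', smul_zero, map_zero,
      smul_zero]

theorem traceless_le_cocycles (k : ℕ) : Traceless m M k ≤ VForm.cocycles m M k := by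
  cases k with
  | zero => exact fun _ _ => rfl
  | succ k =>
    intro K hK
    have hK' : VForm.c k K = 0 := hK
    rw [LinearMap.mem_ker, VForm.δ_succ, hK', map_zero, map_zero, smul_zero]

theorem boundaries_le_cocycles (k : ℕ) : VForm.boundaries m M k ≤ VForm.cocycles m M k :=
  (boundaries_le_closedPart k).trans (closedPart_le_cocycles k)

theorem mem_cocycles_of_le {k : ℕ} (h : m ≤ k) (K : VForm m M k) : K ∈ VForm.cocycles m M k :=
  LinearMap.mem_ker.2 (VForm.eq_zero_of_lt (by omega) _)

theorem mem_traceless_iff {k : ℕ} {K : VForm m M k} :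
    K ∈ Traceless m M k ↔ ∀ x, IsTraceless (K.1 x) := by
  cases k with
  | zero => exact ⟨fun _ _ => trivial, fun _ => trivial⟩
  | succ k =>
    change VForm.c k K = 0 ↔ _
    exact ⟨fun h x => congrFun (congrArg Subtype.val h) x, fun h => Form.ext h⟩

theorem isTraceless_rep {k : ℕ} {K : RawVForm m M k} (h : ∀ x, IsTraceless (K x)) (x : M) :
    ∀ y ∈ chartTarget m x, IsTraceless (RawVForm.rep K x y) := by
  intro y hy
  cases k with
  | zero => trivial
  | succ k =>
    refine (contract_transport _ _ _
        (tangentCoordChange_inv' ((extChartAt (𝓡 m) x).map_target hy))).trans ?_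
    rw [show contract _ = 0 from h _]
    rfl

/-- The multiple of `c(K) ∧ I` is normalized by the factor in `c(φ ∧ I)` so that it has the same
trace as `K`. -/
theorem eq_wedgeI_add {k : ℕ} (hk : k < m) (K : VForm m M (k + 1)) :
    VForm.c k (K - Form.wedgeI k (((-1 : ℝ) ^ k * ((m : ℝ) - k))⁻¹ • VForm.c k K)) = 0 := by
  have hm : (m : ℝ) - k ≠ 0 := by rw [sub_ne_zero]; exact_mod_cast hk.ne'
  rw [map_sub, VForm.c_wedgeI, smul_smul, mul_inv_cancel₀ (by simp [hm]), one_smul, sub_self]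

theorem exists_decomposition {k : ℕ} (hk : k < m) {K : VForm m M k}
    (hK : K ∈ VForm.cocycles m M k) :
    ∃ P ∈ closedPart m M k, ∃ K' ∈ Traceless m M k, K = P + K' := by
  cases k with
  | zero => exact ⟨0, zero_mem _, K, trivial, (zero_add K).symm⟩
  | succ k =>
    refine ⟨Form.wedgeI k (((-1 : ℝ) ^ k * ((m : ℝ) - k))⁻¹ • VForm.c k K), ⟨_, ?_, rfl⟩, _,
      eq_wedgeI_add (by omega) K, (add_sub_cancel _ _).symm⟩
    refine LinearMap.mem_ker.2 ?_
    rw [map_smul, d_c_eq_zero hk hK, smul_zero]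

/-- For `φ` of degree below `m` the trace of `φ ∧ I` is a nonzero multiple of `φ`; in higher degrees
`φ ∧ I` itself vanishes. This is the uniqueness in the decomposition of cocycles. -/
theorem eq_zero_of_traceless_of_closedPart {k : ℕ} {K : VForm m M k} (hK : K ∈ Traceless m M k)
    (hK' : K ∈ closedPart m M k) : K = 0 := by
  cases k with
  | zero => exact hK'
  | succ k =>
    obtain ⟨φ, -, rfl⟩ := hK'
    rcases lt_or_ge k m with hk | hk
    · have h1 : VForm.c k (Form.wedgeI k φ) = 0 := hK
      have hm : (m : ℝ) - k ≠ 0 := by rw [sub_ne_zero]; exact_mod_cast hk.ne'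
      rw [VForm.c_wedgeI, smul_eq_zero] at h1
      rw [h1.resolve_left (by simp [hm]), map_zero]
    · exact VForm.eq_zero_of_lt (by omega) _

theorem traceless_eq_bot {k : ℕ} (hm : 0 < m) (hk : m ≤ k) : Traceless m M k = ⊥ := by
  refine (Submodule.eq_bot_iff _).2 fun K hK => ?_
  cases k with
  | zero => omega
  | succ k => exact VForm.ext fun x => eq_zero_of_contract_eq_zero hk (mem_traceless_iff.1 hK x)

/-! ### Brackets with `φ ∧ I` and traces of brackets on the manifold. -/

theorem RawVForm.rep_wedgeI {k : ℕ} (φ : Form m M k) (x : M) {y : Mod m} (hy : y ∈ chartTarget m x) :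
    RawVForm.rep (Form.wedgeI k φ).1 x y = wedgeId (RawForm.rep φ.1 x y) :=
  wedgeId_transport _ _ _ (tangentCoordChange_inv ((extChartAt (𝓡 m) x).map_target hy))

theorem RawForm.rep_insertForm {k q : ℕ} (K : RawVForm m M k) (φ : RawForm m M (q + 1)) (x : M)
    {y : Mod m} (hy : y ∈ chartTarget m x) :
    RawForm.rep (fun x => insertForm (K x) (φ x) : RawForm m M (k + q)) x y =
      insertForm (RawVForm.rep K x y) (RawForm.rep φ x y) := by
  symm
  refine insertForm_pullback _ _ ?_
  ext1 v
  exact DFunLike.congr_fun (tangentCoordChange_inv' ((extChartAt (𝓡 m) x).map_target hy)) _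

/-- Insertion of a tangent bundle valued form. -/
def Form.insert {k q : ℕ} (K : VForm m M k) (φ : Form m M (q + 1)) : Form m M (k + q) :=
  ⟨fun x => insertForm (K.1 x) (φ.1 x), mem_form.2 fun x =>
    (insertForm_contDiffOn (mem_vform.1 K.2 x) (mem_form.1 φ.2 x)).congr fun _ hy =>
      RawForm.rep_insertForm K.1 φ.1 x hy⟩

theorem extDeriv_rep_eq_zero {k : ℕ} {φ : Form m M k} (hφ : Form.d k φ = 0) (x : M) :
    ∀ y ∈ chartTarget m x, extDeriv (RawForm.rep φ.1 x) y = 0 := by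
  intro y hy
  rw [← RawForm.rep_d φ.2 x hy, show RawForm.d φ.1 = 0 from congrArg Subtype.val hφ]
  rfl

/-- The bracket of `φ ∧ I` with any form is a boundary if `φ` is closed. -/
theorem bracket_mem_boundaries {k l : ℕ} {P : VForm m M k} (hP : P ∈ closedPart m M k)
    (L : VForm m M l) : VForm.bracket k l P L ∈ VForm.boundaries m M (k + l) := by
  cases k with
  | zero =>
    have : P = 0 := hP
    rw [this, map_zero]
    exact zero_mem _
  | succ k =>
    obtain ⟨φ, hφ, rfl⟩ := hP
    have hd : Form.d k φ = 0 := hφ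
    have hs := fun x => Form.contDiffOn φ.2 x
    have hL := fun x => VForm.contDiffOn L.2 x
    have h1 (x : M) : fnBracket (Form.wedgeI k φ).1 L.1 x =
        flatBracket (fun y => wedgeId (RawForm.rep φ.1 x y)) (RawVForm.rep L.1 x)
          (extChartAt (𝓡 m) x x) :=
      flatBracket_congr (wedgeId_contDiffOn (hs x)) (hL x)
        (fun y hy => RawVForm.rep_wedgeI φ x hy) (fun _ _ => rfl) (mem_chartTarget_self x)
    cases k with
    | zero =>
      have : VForm.bracket (0 + 1) l (Form.wedgeI 0 φ) L = 0 := VForm.ext fun x =>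
        (h1 x).trans (flatBracket_wedgeId_zero (hs x) (hL x) (extDeriv_rep_eq_zero hd x)
          (mem_chartTarget_self x))
      rw [this]
      exact zero_mem _
    | succ q =>
      -- The local forms `i_L φ` are the coordinate expressions of a global form, so the bracket is
      -- globally `± d(i_L φ) ∧ I`.
      refine mem_boundaries_of_castForm (show l + q + 1 + 1 = q + 1 + 1 + l by omega)
        ((-1) ^ ((q + 1) * l + 1)) (wedgeI_d_mem_boundaries (Form.insert L φ)) fun x => ?_
      refine (h1 x).trans ((flatBracket_wedgeId_succ (hs x) (hL x) (extDeriv_rep_eq_zero hd x)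
          (mem_chartTarget_self x)).trans ?_)
      congr 3
      change extDeriv _ _ = extDeriv _ _
      refine Filter.EventuallyEq.extDeriv_eq ?_
      filter_upwards [(chartTarget m x).isOpen.mem_nhds (mem_chartTarget_self x)] with y hy
      exact (RawForm.rep_insertForm L.1 φ.1 x hy).symm

theorem bracket_mem_boundaries' {k l : ℕ} (K : VForm m M k) {P : VForm m M l}
    (hP : P ∈ closedPart m M l) : VForm.bracket k l K P ∈ VForm.boundaries m M (k + l) :=
  mem_boundaries_of_castForm (Nat.add_comm l k) (-(-1) ^ (k * l)) (bracket_mem_boundaries hP K)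
    fun x => (fnBracket_symm K.1 P.1 x).trans (neg_smul _ _).symm

/-- The transported forms have first-slot endomorphisms `A' ∘ F ∘ A`. In the trace of a product the
inner `A ∘ A'` cancels, and the outer factors cancel by cyclicity. -/
theorem concomitant_transport {k l : ℕ} (K : Mod m [⋀^Fin (k + 1)]→L[ℝ] Mod m)
    (L : Mod m [⋀^Fin (l + 1)]→L[ℝ] Mod m) (A A' : Mod m →L[ℝ] Mod m)
    (h : A.comp A' = ContinuousLinearMap.id ℝ (Mod m)) :
    concomitant (A'.compContinuousAlternatingMap (K.compContinuousLinearMap A))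
      (A'.compContinuousAlternatingMap (L.compContinuousLinearMap A)) =
      (concomitant K L).compContinuousLinearMap A := by
  have hf {n : ℕ} (N : Mod m [⋀^Fin (n + 1)]→L[ℝ] Mod m) (v : Fin n → Mod m) :
      firstSlot (A'.compContinuousAlternatingMap (N.compContinuousLinearMap A)) v =
        A'.comp ((firstSlot N fun i => A (v i)).comp A) := by
    ext1 z
    change A' (N (A ∘ Matrix.vecCons z v)) = A' (N (Matrix.vecCons (A z) fun i => A (v i)))
    congr 2
    ext1 i
    refine Fin.cases ?_ (fun i => ?_) i <;> simp
  have ht (F G : Mod m →L[ℝ] Mod m) : traceComp (Mod m) (A'.comp (F.comp A)) (A'.comp (G.comp A)) =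
      traceComp (Mod m) F G := by
    have hz (z : Mod m) : A (A' z) = z := DFunLike.congr_fun h z
    change LinearMap.trace ℝ (Mod m) ((A' : Mod m →ₗ[ℝ] Mod m) * (F : Mod m →ₗ[ℝ] Mod m) *
        ((A : Mod m →ₗ[ℝ] Mod m) * (A' : Mod m →ₗ[ℝ] Mod m)) * (G : Mod m →ₗ[ℝ] Mod m) *
        (A : Mod m →ₗ[ℝ] Mod m)) =
      LinearMap.trace ℝ (Mod m) ((F : Mod m →ₗ[ℝ] Mod m) * (G : Mod m →ₗ[ℝ] Mod m))
    have h2 : (A : Mod m →ₗ[ℝ] Mod m) * (A' : Mod m →ₗ[ℝ] Mod m) = 1 := LinearMap.ext hz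
    rw [h2, mul_one, mul_assoc, mul_assoc, LinearMap.trace_mul_comm, mul_assoc, mul_assoc, h2,
      mul_one]
  ext1 v
  rw [ContinuousAlternatingMap.compContinuousLinearMap_apply, concomitant, concomitant, wedge_apply,
    wedge_apply]
  simp only [hf, ht]
  rfl

/-- The concomitant `S` of tangent bundle valued forms. -/
def VForm.concomitant {k l : ℕ} (K : VForm m M (k + 1)) (L : VForm m M (l + 1)) :
    Form m M (k + l) :=
  ⟨fun x => FN.concomitant (K.1 x) (L.1 x), mem_form.2 fun x =>
    (concomitant_contDiffOn (mem_vform.1 K.2 x) (mem_vform.1 L.2 x)).congr fun _ hy =>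
      (concomitant_transport _ _ _ _
        (tangentCoordChange_inv' ((extChartAt (𝓡 m) x).map_target hy))).symm⟩

theorem contract_castForm {p q : ℕ} (h : p = q) (K : Mod m [⋀^Fin (p + 1)]→L[ℝ] Mod m) :
    contract (castForm (congrArg (· + 1) h) K) = castForm h (contract K) := by
  subst h; rfl

theorem contract_fnBracket {k l : ℕ} {K : VForm m M (k + 1)} {L : VForm m M (l + 1)}
    (hK : K ∈ Traceless m M (k + 1)) (hL : L ∈ Traceless m M (l + 1)) (x : M)
    {B : Mod m [⋀^Fin (k + 1 + l + 1)]→L[ℝ] Mod m} (hB : B = fnBracket K.1 L.1 x) :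
    contract B = (-1 : ℝ) ^ k •
      castForm (by omega) ((Form.d (k + l) (VForm.concomitant K L)).1 x) := by
  rw [hB]
  refine (contract_flatBracket (VForm.contDiffOn K.2 x) (VForm.contDiffOn L.2 x)
    (isTraceless_rep (mem_traceless_iff.1 hK) x) (isTraceless_rep (mem_traceless_iff.1 hL) x)
    rfl (mem_chartTarget_self x)).trans ?_
  congr 2
  change extDeriv _ _ = extDeriv _ _
  refine Filter.EventuallyEq.extDeriv_eq ?_
  filter_upwards [(chartTarget m x).isOpen.mem_nhds (mem_chartTarget_self x)] with y hy
  exact concomitant_transport _ _ _ _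
    (tangentCoordChange_inv' ((extChartAt (𝓡 m) x).map_target hy))

end Manifold

end FN
end

noncomputable section
namespace FN

/-! ### Brackets on cohomology -/

section Manifold

open scoped Manifold

universe u

variable {m : ℕ} {M : Type u} [TopologicalSpace M] [ChartedSpace (Mod m) M]
  [IsManifold (𝓡 m) (⊤ : ℕ∞) M]

theorem VForm.exists_castForm {p q : ℕ} (h : p = q) (N : VForm m M p) :
    ∃ N' : VForm m M q, ∀ x, N'.1 x = castForm h (N.1 x) := by
  subst h; exact ⟨N, fun _ => rfl⟩

theorem contract_sub_smul {k : ℕ} (r : ℝ) (K L : Mod m [⋀^Fin (k + 1)]→L[ℝ] Mod m) :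
    contract (K - r • L) = contract K - r • contract L := by
  rw [show K - r • L = K + (-r) • L by module, contract_add, contract_smul]
  module

/-- The correction term `dS(K, L) ∧ I` is an exact form, and subtracting the appropriate multiple
of it makes the bracket of traceless forms traceless. -/
theorem exists_tracelessBracket {k l : ℕ} {K : VForm m M k} {L : VForm m M l}
    (hK : K ∈ Traceless m M k) (hL : L ∈ Traceless m M l) :
    ∃ N ∈ Traceless m M (k + l), N.1 = tracelessBracket K.1 L.1 ∧
      VForm.bracket k l K L - N ∈ VForm.boundaries m M (k + l) := by
  -- If one degree is `0`, the concomitant vanishes and the bracket is already traceless, so no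
  -- correction is needed.
  have h0 (h : k = 0 ∨ l = 0) (hS : dSWedgeI K.1 L.1 = 0) :
      ∃ N ∈ Traceless m M (k + l), N.1 = tracelessBracket K.1 L.1 ∧
        VForm.bracket k l K L - N ∈ VForm.boundaries m M (k + l) := by
    refine ⟨VForm.bracket k l K L, mem_traceless_iff.2 fun x => ?_, ?_, ?_⟩
    · exact isTraceless_flatBracket_zero (VForm.contDiffOn K.2 x) (VForm.contDiffOn L.2 x)
        (isTraceless_rep (mem_traceless_iff.1 hK) x) (isTraceless_rep (mem_traceless_iff.1 hL) x)
        h (mem_chartTarget_self x)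
    · refine Eq.symm ((congrArg (fun z => fnBracket K.1 L.1 - _ • z) hS).trans ?_)
      exact (congrArg _ (smul_zero _)).trans (sub_zero _)
    · rw [sub_self]; exact zero_mem _
  cases k with
  | zero => exact h0 (.inl rfl) (by cases l <;> rfl)
  | succ k =>
    cases l with
    | zero => exact h0 (.inr rfl) rfl
    | succ l =>
      obtain ⟨W, hW⟩ := VForm.exists_castForm (show k + l + 1 + 1 = k + 1 + (l + 1) by omega)
        (Form.wedgeI (k + l + 1) (Form.d (k + l) (VForm.concomitant K L)))
      have hWb : W ∈ VForm.boundaries m M (k + 1 + (l + 1)) :=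
        mem_boundaries_of_castForm _ 1 (wedgeI_d_mem_boundaries _)
          fun x => (hW x).trans (one_smul ℝ _).symm
      -- The coefficient solves `r * (-1)^{k+l+1} (m - k - l - 1) = (-1)^k`: the trace of `dS ∧ I`
      -- on the left, that of the bracket on the right.
      set r : ℝ := (-1) ^ (l + 1) / ((m : ℝ) - (k + 1 : ℕ) - (l + 1 : ℕ) + 1) with hr
      refine ⟨VForm.bracket _ _ K L - r • W, ?_, ?_, ?_⟩
      -- Here the denominator of `r` is zero, but the total degree is `m + 1`, so all forms vanish.
      · by_cases hm : m = k + l + 1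
        · rw [VForm.eq_zero_of_lt (by omega) (VForm.bracket _ _ K L - r • W)]
          exact zero_mem _
        · refine mem_traceless_iff.2 fun x => ?_
          have hW' := (congrArg (contract (k := k + 1 + l)) (hW x)).trans
            ((contract_castForm (show k + l + 1 = k + 1 + l by omega) _).trans
              (congrArg _ (contract_wedgeId _)))
          have hB := contract_fnBracket hK hL x rfl
          change contract (k := k + 1 + l) (fnBracket K.1 L.1 x - r • W.1 x) = 0
          rw [contract_sub_smul, hW', hB, castForm_smul, smul_smul]
          refine (sub_smul _ _ _).symm.trans ?_
          have hm' : (m : ℝ) - (k + 1) - (l + 1) + 1 ≠ 0 := by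
            intro h
            apply hm
            have : (m : ℝ) = ((k + l + 1 : ℕ) : ℝ) := by push_cast; linarith
            exact_mod_cast this
          have : (-1 : ℝ) ^ k - r * ((-1) ^ (k + l + 1) * ((m : ℝ) - ((k + l + 1 : ℕ) : ℝ))) = 0 := by
            rw [hr]
            push_cast
            have e : (m : ℝ) - (k + l + 1) = (m : ℝ) - (k + 1) - (l + 1) + 1 := by ring
            rw [e]
            field_simp
            ring_nf
            rw [mul_comm l 2, pow_mul]
            simp
          rw [this, zero_smul]
      · refine funext fun x => ?_
        change fnBracket K.1 L.1 x - r • W.1 x = _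
        rw [hW]
        rfl
      · rw [sub_sub_cancel]
        exact Submodule.smul_mem _ _ hWb

/-- From total degree `m` on everything is a cocycle. Below it both factors split as `φ ∧ I` plus a
traceless form; the terms with some `φ ∧ I` are boundaries, and the traceless ones bracket to a
traceless form plus a boundary. -/
theorem bracket_mem_cocycles {k l : ℕ} {K : VForm m M k} {L : VForm m M l}
    (hK : K ∈ VForm.cocycles m M k) (hL : L ∈ VForm.cocycles m M l) :
    VForm.bracket k l K L ∈ VForm.cocycles m M (k + l) := by
  rcases le_or_gt m (k + l) with h | h
  · exact mem_cocycles_of_le h _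
  · obtain ⟨P, hP, K', hK', rfl⟩ := exists_decomposition (by omega) hK
    obtain ⟨Q, hQ, L', hL', rfl⟩ := exists_decomposition (by omega) hL
    obtain ⟨N, hN, -, hb⟩ := exists_tracelessBracket hK' hL'
    have h3 := add_mem (boundaries_le_cocycles _ hb) (traceless_le_cocycles _ hN)
    rw [sub_add_cancel] at h3
    rw [map_add (VForm.bracket k l), LinearMap.add_apply, map_add (VForm.bracket k l K')]
    exact add_mem (boundaries_le_cocycles _ (bracket_mem_boundaries hP _))
      (add_mem (boundaries_le_cocycles _ (bracket_mem_boundaries' _ hQ)) h3)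

/-- The Frölicher–Nijenhuis bracket of cocycles. -/
def cocycleBracket (k l : ℕ) : VForm.cocycles m M k →ₗ[ℝ] VForm.cocycles m M l →ₗ[ℝ]
    VForm.cocycles m M (k + l) :=
  LinearMap.mk₂ ℝ (fun K L => ⟨VForm.bracket k l K.1 L.1, bracket_mem_cocycles K.2 L.2⟩)
    (fun K K' L => Subtype.ext (by simp)) (fun r K L => Subtype.ext (by simp))
    (fun K L L' => Subtype.ext (by simp)) (fun r K L => Subtype.ext (by simp))

theorem DeltaCohomology.mk_eq_zero {k : ℕ} {K : VForm.cocycles m M k} :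
    DeltaCohomology.mk K = 0 ↔ K.1 ∈ VForm.boundaries m M k := by
  rw [Submodule.Quotient.mk_eq_zero]
  rfl

/-- The bracket on cohomology which is induced by the Frölicher–Nijenhuis bracket. -/
def cohomologyBracket (k l : ℕ) : DeltaCohomology m M k →ₗ[ℝ] DeltaCohomology m M l →ₗ[ℝ]
    DeltaCohomology m M (k + l) :=
  Submodule.liftQ _ (LinearMap.flip (Submodule.liftQ _
    (((cocycleBracket k l).compr₂ (Submodule.mkQ _)).flip) (fun L hL => by
      refine LinearMap.ext fun K => ?_
      exact DeltaCohomology.mk_eq_zero.2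
        (bracket_mem_boundaries' K.1 (boundaries_le_closedPart _ hL)))))
    (fun K hK => by
      refine LinearMap.ext fun b => ?_
      obtain ⟨L, rfl⟩ := Submodule.Quotient.mk_surjective _ b
      exact DeltaCohomology.mk_eq_zero.2
        (bracket_mem_boundaries (boundaries_le_closedPart _ hK) L.1))

theorem cohomologyBracket_mk {k l : ℕ} (K : VForm.cocycles m M k) (L : VForm.cocycles m M l) :
    cohomologyBracket k l (DeltaCohomology.mk K) (DeltaCohomology.mk L) =
      DeltaCohomology.mk (cocycleBracket k l K L) := rfl

/-- Identities such as Jacobi relate classes in degrees that are equal only propositionally; in the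
direct sum the change of degree disappears. -/
theorem DeltaCohomology.lof_mk {p q : ℕ} (h : p = q) {N : VForm.cocycles m M p}
    {N' : VForm.cocycles m M q} (e : ∀ x, N'.1.1 x = castForm h (N.1.1 x)) :
    DirectSum.lof ℝ ℕ (DeltaCohomology m M) q (DeltaCohomology.mk N') =
      DirectSum.lof ℝ ℕ (DeltaCohomology m M) p (DeltaCohomology.mk N) := by
  subst h
  rw [show N' = N from Subtype.ext (VForm.ext e)]

theorem exists_cocycle_castForm {p q : ℕ} (h : p = q) (N : VForm.cocycles m M p) :
    ∃ N' : VForm.cocycles m M q, ∀ x, N'.1.1 x = castForm h (N.1.1 x) := by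
  subst h; exact ⟨N, fun _ => rfl⟩

theorem isGradedLie_cohomologyBracket : IsGradedLie (cohomologyBracket (m := m) (M := M)) where
  anticomm k l a b := by
    obtain ⟨K, rfl⟩ := Submodule.Quotient.mk_surjective _ a
    obtain ⟨L, rfl⟩ := Submodule.Quotient.mk_surjective _ b
    rw [cohomologyBracket_mk, cohomologyBracket_mk]
    obtain ⟨N, hN⟩ := exists_cocycle_castForm (Nat.add_comm l k) (cocycleBracket l k L K)
    have : cocycleBracket k l K L = -((-1 : ℝ) ^ (k * l) • N) :=
      Subtype.ext (VForm.ext fun x => (fnBracket_symm K.1.1 L.1.1 x).trans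
        (congrArg (fun z => -((-1 : ℝ) ^ (k * l) • z)) (hN x).symm))
    rw [← DeltaCohomology.lof_mk _ hN, ← map_smul, ← map_neg, this]
    rfl
  jacobi k l n a b c := by
    obtain ⟨K, rfl⟩ := Submodule.Quotient.mk_surjective _ a
    obtain ⟨L, rfl⟩ := Submodule.Quotient.mk_surjective _ b
    obtain ⟨P, rfl⟩ := Submodule.Quotient.mk_surjective _ c
    simp only [cohomologyBracket_mk]
    obtain ⟨N, hN⟩ := exists_cocycle_castForm (Nat.add_assoc k l n)
      (cocycleBracket (k + l) n (cocycleBracket k l K L) P)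
    obtain ⟨N', hN'⟩ := exists_cocycle_castForm (Nat.add_left_comm l k n)
      (cocycleBracket l (k + n) L (cocycleBracket k n K P))
    have : cocycleBracket k (l + n) K (cocycleBracket l n L P) = N + (-1 : ℝ) ^ (k * l) • N' :=
      Subtype.ext (VForm.ext fun x => (fnBracket_jacobi K.1.2 L.1.2 P.1.2 x).trans
        (congrArg₂ (fun z w => z + (-1 : ℝ) ^ (k * l) • w) (hN x).symm (hN' x).symm))
    rw [← DeltaCohomology.lof_mk _ hN, ← DeltaCohomology.lof_mk _ hN', ← map_smul, ← map_add, this]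
    rfl

end Manifold

/-- A family of brackets which embeds into a graded Lie algebra is a graded Lie bracket. -/
theorem IsGradedLie.of_injective {V W : ℕ → Type*} [∀ k, AddCommGroup (V k)]
    [∀ k, Module ℝ (V k)] [∀ k, AddCommGroup (W k)] [∀ k, Module ℝ (W k)]
    {b : ∀ k l, V k →ₗ[ℝ] V l →ₗ[ℝ] V (k + l)} {b' : ∀ k l, W k →ₗ[ℝ] W l →ₗ[ℝ] W (k + l)}
    (hb : IsGradedLie b') (f : ∀ k, V k →ₗ[ℝ] W k) (hf : ∀ k, Function.Injective (f k))
    (h : ∀ k l x y, f (k + l) (b k l x y) = b' k l (f k x) (f l y)) : IsGradedLie b := by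
  have hi : Function.Injective (DirectSum.lmap f) := (DirectSum.lmap_injective f).2 hf
  constructor
  · intro k l x y
    apply hi
    simp only [map_neg, map_smul, DirectSum.lmap_lof, h]
    exact hb.anticomm k l _ _
  · intro k l n x y z
    apply hi
    simp only [map_add, map_smul, DirectSum.lmap_lof, h]
    exact hb.jacobi k l n _ _ _

end FN
end

noncomputable section
namespace FN

/-! ### The structure of the cohomology -/

section Manifold

open scoped Manifold

universe u

variable {m : ℕ} {M : Type u} [TopologicalSpace M] [ChartedSpace (Mod m) M]
  [IsManifold (𝓡 m) (⊤ : ℕ∞) M]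

/-- The cohomology class of a traceless form. -/
def tracelessClass (k : ℕ) : Traceless m M k →ₗ[ℝ] DeltaCohomology m M k :=
  Submodule.mkQ _ ∘ₗ Submodule.inclusion (traceless_le_cocycles k)

/-- Boundaries have the form `φ ∧ I` with `φ` closed, and the only traceless form of this kind is
zero. -/
theorem tracelessClass_injective (k : ℕ) :
    Function.Injective (tracelessClass (m := m) (M := M) k) := by
  refine (injective_iff_map_eq_zero _).2 fun K hK => Subtype.ext ?_
  exact eq_zero_of_traceless_of_closedPart K.2
    (boundaries_le_closedPart _ (DeltaCohomology.mk_eq_zero.1 hK))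

/-- The value of the bracket `[ , ]^c` on `C(M)`. -/
def tracelessBracketFun {k l : ℕ} (K : Traceless m M k) (L : Traceless m M l) :
    Traceless m M (k + l) :=
  ⟨(exists_tracelessBracket K.2 L.2).choose, (exists_tracelessBracket K.2 L.2).choose_spec.1⟩

/-- The correction term in `[ , ]^c` is a boundary, so it is invisible in cohomology. -/
theorem tracelessClass_tracelessBracketFun {k l : ℕ} (K : Traceless m M k) (L : Traceless m M l) :
    tracelessClass (k + l) (tracelessBracketFun K L) =
      cohomologyBracket k l (tracelessClass k K) (tracelessClass l L) :=
  (sub_eq_zero.1 (DeltaCohomology.mk_eq_zero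
    (K := cocycleBracket k l ⟨K.1, traceless_le_cocycles k K.2⟩ ⟨L.1, traceless_le_cocycles l L.2⟩ -
      ⟨(tracelessBracketFun K L).1, traceless_le_cocycles _ (tracelessBracketFun K L).2⟩)|>.2
    (exists_tracelessBracket K.2 L.2).choose_spec.2.2)).symm

/-- The bracket `[ , ]^c` on `C(M)`. -/
def tracelessLie (k l : ℕ) :
    Traceless m M k →ₗ[ℝ] Traceless m M l →ₗ[ℝ] Traceless m M (k + l) :=
  -- Bilinearity is checked after the injective map to cohomology, where it is known.
  LinearMap.mk₂ ℝ tracelessBracketFun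
    (fun K K' L => tracelessClass_injective _ (by
      simp only [map_add, tracelessClass_tracelessBracketFun, LinearMap.add_apply]))
    (fun r K L => tracelessClass_injective _ (by
      simp only [map_smul, tracelessClass_tracelessBracketFun, LinearMap.smul_apply]))
    (fun K L L' => tracelessClass_injective _ (by
      simp only [map_add, tracelessClass_tracelessBracketFun]))
    (fun r K L => tracelessClass_injective _ (by
      simp only [map_smul, tracelessClass_tracelessBracketFun]))

theorem tracelessLie_val {k l : ℕ} (K : Traceless m M k) (L : Traceless m M l) :
    (tracelessLie k l K L).1.1 = tracelessBracket K.1.1 L.1.1 :=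
  (exists_tracelessBracket K.2 L.2).choose_spec.2.1

theorem tracelessClass_tracelessLie {k l : ℕ} (K : Traceless m M k) (L : Traceless m M l) :
    tracelessClass (k + l) (tracelessLie k l K L) =
      cohomologyBracket k l (tracelessClass k K) (tracelessClass l L) :=
  tracelessClass_tracelessBracketFun K L

theorem isGradedLie_tracelessLie : IsGradedLie (tracelessLie (m := m) (M := M)) :=
  isGradedLie_cohomologyBracket.of_injective tracelessClass tracelessClass_injective
    fun _ _ => tracelessClass_tracelessLie

/-! ### De Rham classes and the splitting of the cohomology. -/

theorem wedgeI_injective {k : ℕ} (hk : k < m) :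
    Function.Injective (Form.wedgeI (m := m) (M := M) k) := by
  refine (injective_iff_map_eq_zero _).2 fun φ hφ => ?_
  have hm : (m : ℝ) - k ≠ 0 := by rw [sub_ne_zero]; exact_mod_cast hk.ne'
  have h1 := VForm.c_wedgeI φ
  rw [hφ, map_zero, eq_comm, smul_eq_zero] at h1
  exact h1.resolve_left (by simp [hm])

/-- Boundaries have the form `dψ ∧ I`, and `∧ I` is injective below degree `m`. For `k = 0` both
sides say `φ = 0`, as `δ` vanishes on vector fields. -/
theorem wedgeI_mem_boundaries_iff {k : ℕ} (hk : k < m) {φ : Form m M k} :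
    Form.wedgeI k φ ∈ VForm.boundaries m M (k + 1) ↔ φ ∈ Form.boundaries m M k := by
  cases k with
  | zero =>
    constructor
    · rintro ⟨N, hN⟩
      exact wedgeI_injective hk (hN.symm.trans (map_zero _).symm)
    · intro h
      rw [show φ = 0 from h, map_zero]
      exact zero_mem _
  | succ k =>
    constructor
    · rintro ⟨N, hN⟩
      rw [VForm.δ_succ, ← map_smul, ← map_smul] at hN
      exact ⟨_, wedgeI_injective hk hN⟩
    · rintro ⟨ψ, rfl⟩
      exact wedgeI_d_mem_boundaries ψ

/-- The map `φ ↦ φ ∧ I` on closed forms. -/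
def wedgeClosed (k : ℕ) :
    LinearMap.ker (Form.d (m := m) (M := M) k) →ₗ[ℝ] VForm.cocycles m M (k + 1) :=
  (Form.wedgeI k ∘ₗ Submodule.subtype _).codRestrict _ fun φ =>
    closedPart_le_cocycles _ ⟨φ.1, φ.2, rfl⟩

/-- The map `[φ] ↦ [φ ∧ I]` on de Rham cohomology. -/
def deRhamClass : (k : ℕ) → DeRhamPred m M k →ₗ[ℝ] DeltaCohomology m M k
  | 0 => 0
  | k + 1 => Submodule.liftQ _ (Submodule.mkQ _ ∘ₗ wedgeClosed k) (fun φ hφ => by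
      refine DeltaCohomology.mk_eq_zero.2 ?_
      change Form.wedgeI k φ.1 ∈ _
      have hφ' : φ.1 ∈ Form.boundaries m M k := hφ
      rcases lt_or_ge k m with hk | hk
      · exact (wedgeI_mem_boundaries_iff hk).2 hφ'
      · rw [VForm.eq_zero_of_lt (by omega) (Form.wedgeI k φ.1)]
        exact zero_mem _)

theorem deRhamClass_mk {k : ℕ} (φ : LinearMap.ker (Form.d (m := m) (M := M) k)) :
    deRhamClass (k + 1) (DeRhamPred.mk φ) = DeltaCohomology.mk (wedgeClosed k φ) := rfl

theorem exists_deRhamClass_eq {k : ℕ} (a : DeRhamPred m M k) :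
    ∃ P : VForm.cocycles m M k, P.1 ∈ closedPart m M k ∧
      deRhamClass k a = DeltaCohomology.mk P := by
  cases k with
  | zero => exact ⟨0, zero_mem _, rfl⟩
  | succ k =>
    obtain ⟨φ, rfl⟩ := Submodule.Quotient.mk_surjective _ a
    exact ⟨wedgeClosed k φ, ⟨φ.1, φ.2, rfl⟩, rfl⟩

theorem deRhamClass_injective {k : ℕ} (hk : k < m) :
    Function.Injective (deRhamClass (m := m) (M := M) k) := by
  cases k with
  | zero => exact fun _ _ _ => rfl
  | succ k =>
    refine (injective_iff_map_eq_zero _).2 fun a ha => ?_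
    obtain ⟨φ, rfl⟩ := Submodule.Quotient.mk_surjective _ a
    exact (Submodule.Quotient.mk_eq_zero _).2
      ((wedgeI_mem_boundaries_iff (by omega)).1 (DeltaCohomology.mk_eq_zero.1 ha))

theorem cohomologyBracket_deRhamClass_left {k l : ℕ} (a : DeRhamPred m M k)
    (b : DeltaCohomology m M l) : cohomologyBracket k l (deRhamClass k a) b = 0 := by
  obtain ⟨P, hP, h⟩ := exists_deRhamClass_eq a
  obtain ⟨L, rfl⟩ := Submodule.Quotient.mk_surjective _ b
  rw [h]
  exact DeltaCohomology.mk_eq_zero.2 (bracket_mem_boundaries hP L.1)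

theorem cohomologyBracket_deRhamClass_right {k l : ℕ} (a : DeltaCohomology m M k)
    (b : DeRhamPred m M l) : cohomologyBracket k l a (deRhamClass l b) = 0 := by
  obtain ⟨P, hP, h⟩ := exists_deRhamClass_eq b
  obtain ⟨K, rfl⟩ := Submodule.Quotient.mk_surjective _ a
  rw [h]
  exact DeltaCohomology.mk_eq_zero.2 (bracket_mem_boundaries' K.1 hP)

variable (m M) in
/-- The map `([φ], K') ↦ [φ ∧ I + K']`. -/
def sumClass (k : ℕ) : DeRhamPred m M k × Traceless m M k →ₗ[ℝ] DeltaCohomology m M k :=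
  (deRhamClass k).coprod (tracelessClass k)

theorem sumClass_apply {k : ℕ} (z : DeRhamPred m M k × Traceless m M k) :
    sumClass m M k z = deRhamClass k z.1 + tracelessClass k z.2 := rfl

/-- Surjectivity is the decomposition of cocycles. If `φ ∧ I + K'` is a boundary, then `K'` is both
traceless and of the form `χ ∧ I`, hence zero, and `φ` is then exact. -/
theorem sumClass_bijective {k : ℕ} (hk : k < m) : Function.Bijective (sumClass m M k) := by
  constructor
  · refine (injective_iff_map_eq_zero _).2 ?_
    rintro ⟨a, K⟩ h
    rw [sumClass_apply] at h
    obtain ⟨P, hP, hPa⟩ := exists_deRhamClass_eq a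
    have h1 : P.1 + K.1 ∈ VForm.boundaries m M k := by
      rw [hPa] at h
      exact DeltaCohomology.mk_eq_zero.1 h
    have h2 : K = 0 := Subtype.ext (eq_zero_of_traceless_of_closedPart K.2
      ((Submodule.add_mem_iff_right _ hP).1 (boundaries_le_closedPart _ h1)))
    rw [h2, map_zero, add_zero] at h
    exact Prod.ext (deRhamClass_injective hk (h.trans (map_zero _).symm)) h2
  · intro a
    obtain ⟨⟨K, hK⟩, rfl⟩ := Submodule.Quotient.mk_surjective _ a
    obtain ⟨P, hP, K', hK', rfl⟩ := exists_decomposition hk hK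
    cases k with
    | zero =>
      refine ⟨(0, ⟨K', hK'⟩), ?_⟩
      rw [sumClass_apply, map_zero, zero_add]
      exact congrArg (fun z => DeltaCohomology.mk z) (Subtype.ext
        (by rw [show P = 0 from hP]; exact (zero_add K').symm))
    | succ k =>
      obtain ⟨φ, hφ, rfl⟩ := hP
      exact ⟨(DeRhamPred.mk ⟨φ, hφ⟩, ⟨K', hK'⟩), rfl⟩

variable (m M) in
/-- The isomorphism `H^k(Ω(M; TM), δ) ≅ H^{k-1}_dR(M) ⊕ C^k(M)` for `k < m`. -/
def splitting (k : ℕ) (hk : k < m) :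
    DeltaCohomology m M k ≃ₗ[ℝ] DeRhamPred m M k × Traceless m M k :=
  (LinearEquiv.ofBijective (sumClass m M k) (sumClass_bijective hk)).symm

theorem splitting_apply_eq_iff {k : ℕ} (hk : k < m) {a : DeltaCohomology m M k}
    {z : DeRhamPred m M k × Traceless m M k} : splitting m M k hk a = z ↔ a = sumClass m M k z :=
  LinearEquiv.symm_apply_eq _

theorem sumClass_splitting {k : ℕ} (hk : k < m) (a : DeltaCohomology m M k) :
    sumClass m M k (splitting m M k hk a) = a :=
  ((splitting_apply_eq_iff hk).1 rfl).symm

/-- All brackets involving a de Rham class vanish, so only the bracket of the traceless components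
survives. There is no condition on `k + l`. -/
theorem cohomologyBracket_eq {k l : ℕ} (hk : k < m) (hl : l < m) (a : DeltaCohomology m M k)
    (b : DeltaCohomology m M l) :
    cohomologyBracket k l a b = tracelessClass (k + l)
      (tracelessLie k l (splitting m M k hk a).2 (splitting m M l hl b).2) := by
  conv_lhs => rw [← sumClass_splitting hk a, ← sumClass_splitting hl b]
  rw [tracelessClass_tracelessLie, sumClass_apply, sumClass_apply, map_add, cohomologyBracket_deRhamClass_right,
    zero_add, map_add, LinearMap.add_apply, cohomologyBracket_deRhamClass_left, zero_add]

/-- The isomorphism `H^m(Ω(M; TM), δ) ≅ Ω^{m-1}(M) / d Ω^{m-2}(M) ⊕ C^m(M)`. -/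
theorem nonempty_topDegree {n : ℕ} (hn : m = n + 1) :
    Nonempty (DeltaCohomology m M (n + 1) ≃ₗ[ℝ]
      (Form m M n ⧸ Form.boundaries m M n) × Traceless m M (n + 1)) := by
  have hT : Traceless m M (n + 1) = ⊥ := traceless_eq_bot (by omega) hn.le
  let f : Form m M n →ₗ[ℝ] DeltaCohomology m M (n + 1) := Submodule.mkQ _ ∘ₗ
    (Form.wedgeI n).codRestrict _ fun φ => mem_cocycles_of_le hn.le _
  -- In the top degree `φ ∧ I` is a cocycle for every `φ`, so the quotient is by exact forms without
  -- restriction to closed ones.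
  have hf : LinearMap.ker f = Form.boundaries m M n := Submodule.ext fun φ =>
    (DeltaCohomology.mk_eq_zero (K := ⟨Form.wedgeI n φ, mem_cocycles_of_le hn.le _⟩)).trans
      (wedgeI_mem_boundaries_iff (by omega))
  have hs : Function.Surjective f := by
    intro a
    obtain ⟨⟨K, hK⟩, rfl⟩ := Submodule.Quotient.mk_surjective _ a
    -- Removing the trace part of `K` leaves a traceless form of top degree, which is zero.
    have h1 := eq_wedgeI_add (by omega) K
    have h2 := (Submodule.eq_bot_iff _).1 hT _ h1
    exact ⟨_, congrArg (fun z => DeltaCohomology.mk z) (Subtype.ext (sub_eq_zero.1 h2).symm)⟩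
  have : Unique (Traceless m M (n + 1)) := by rw [hT]; infer_instance
  exact ⟨((Submodule.quotEquivOfEq _ _ hf.symm).trans
    (f.quotKerEquivOfSurjective hs)).symm.trans LinearEquiv.prodUnique.symm⟩

end Manifold

end FN
end

/-! ### The theorem. -/

open scoped Manifold in
theorem theorem2p5 (m : ℕ) (M : Type*) [TopologicalSpace M]
    [ChartedSpace (EuclideanSpace ℝ (Fin m)) M] [IsManifold (𝓡 m) (⊤ : ℕ∞) M] :
    -- `δ` is a differential on `Ω(M; TM)`
    (∀ (k : ℕ) (K : FN.VForm m M k), FN.VForm.δ (k + 1) (FN.VForm.δ k K) = 0) ∧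
    -- `[ , ]^c` is a well-defined bracket on `C(M)`, and `(C(M), [ , ]^c)` is a graded Lie algebra
    ∃ bC : ∀ k l, FN.Traceless m M k →ₗ[ℝ] FN.Traceless m M l →ₗ[ℝ] FN.Traceless m M (k + l),
      (∀ (k l : ℕ) (K : FN.Traceless m M k) (L : FN.Traceless m M l),
        (bC k l K L).1.1 = FN.tracelessBracket K.1.1 L.1.1) ∧
      FN.IsGradedLie bC ∧
    -- the Frölicher–Nijenhuis bracket induces a bracket on cohomology, which becomes a graded
    -- Lie algebra
    ∃ bH : ∀ k l, FN.DeltaCohomology m M k →ₗ[ℝ] FN.DeltaCohomology m M l →ₗ[ℝ]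
        FN.DeltaCohomology m M (k + l),
      (∀ (k l : ℕ) (K : FN.VForm.cocycles m M k) (L : FN.VForm.cocycles m M l),
        ∃ N : FN.VForm.cocycles m M (k + l), N.1.1 = FN.fnBracket K.1.1 L.1.1 ∧
          bH k l (FN.DeltaCohomology.mk K) (FN.DeltaCohomology.mk L) =
            FN.DeltaCohomology.mk N) ∧
      FN.IsGradedLie bH ∧
    -- `H^k(Ω(M; TM), δ) ≅ H^{k-1}_dR(M) ⊕ C^k(M)` in the degrees `k < m`
    (∃ Φ : ∀ k, k < m →
        FN.DeltaCohomology m M k ≃ₗ[ℝ] FN.DeRhamPred m M k × FN.Traceless m M k,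
      -- the isomorphism is the one given by `([φ], K') ↦ [φ ∧ I + K']`
      (∀ (k : ℕ) (hk : k < m) (K : FN.VForm.cocycles m M k) (hK : K.1 ∈ FN.Traceless m M k),
        Φ k hk (FN.DeltaCohomology.mk K) = (0, ⟨K.1, hK⟩)) ∧
      (∀ (k : ℕ) (hk : k + 1 < m) (φ : LinearMap.ker (FN.Form.d (m := m) (M := M) k))
        (K : FN.VForm.cocycles m M (k + 1)), K.1 = FN.Form.wedgeI k φ.1 →
        Φ (k + 1) hk (FN.DeltaCohomology.mk K) = (FN.DeRhamPred.mk φ, 0)) ∧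
      -- the induced bracket is that of the direct product of the abelian algebra
      -- `H^{*-1}_dR(M)` and of `(C(M), [ , ]^c)`
      (∀ (k l : ℕ) (hk : k < m) (hl : l < m) (hkl : k + l < m)
        (a : FN.DeltaCohomology m M k) (b : FN.DeltaCohomology m M l),
        Φ (k + l) hkl (bH k l a b) = (0, bC k l (Φ k hk a).2 (Φ l hl b).2))) ∧
    -- it vanishes if the degree of the product is at least `m`, where `C^{k+l}(M) = 0`
    (∀ (k l : ℕ), k < m → l < m → m ≤ k + l →
      (∀ (a : FN.DeltaCohomology m M k) (b : FN.DeltaCohomology m M l), bH k l a b = 0) ∧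
      FN.Traceless m M (k + l) = ⊥) ∧
    -- in the top degree `m = n + 1`, where all elements of `Ω^m(M; TM)` are cocycles, the de Rham
    -- cohomology is replaced by `Ω^{m-1}(M)` modulo the exact forms
    (∀ n : ℕ, m = n + 1 →
      Nonempty (FN.DeltaCohomology m M (n + 1) ≃ₗ[ℝ]
        (FN.Form m M n ⧸ FN.Form.boundaries m M n) × FN.Traceless m M (n + 1))) := by
  refine ⟨fun k K => FN.VForm.δ_δ K, FN.tracelessLie, fun k l => FN.tracelessLie_val,
    FN.isGradedLie_tracelessLie, FN.cohomologyBracket,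
    fun k l K L => ⟨FN.cocycleBracket k l K L, rfl, rfl⟩, FN.isGradedLie_cohomologyBracket,
    ⟨FN.splitting m M, ?_, ?_, ?_⟩, ?_, fun n => FN.nonempty_topDegree⟩
  · intro k hk K hK
    rw [FN.splitting_apply_eq_iff, FN.sumClass_apply, map_zero, zero_add]
    rfl
  · intro k hk φ K hK
    rw [FN.splitting_apply_eq_iff, FN.sumClass_apply, map_zero, add_zero, FN.deRhamClass_mk,
      show K = FN.wedgeClosed k φ from Subtype.ext hK]
  · intro k l hk hl hkl a b
    rw [FN.splitting_apply_eq_iff, FN.sumClass_apply, map_zero, zero_add]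
    exact FN.cohomologyBracket_eq hk hl a b
  · intro k l hk hl hkl
    -- The bracket is the class of an element of `C^{k+l}(M)`, and this space is zero from degree
    -- `m` on because `k < m` forces `m > 0`.
    have hT : FN.Traceless m M (k + l) = ⊥ := FN.traceless_eq_bot (by omega) hkl
    refine ⟨fun a b => ?_, hT⟩
    rw [FN.cohomologyBracket_eq hk hl a b]
    have : Subsingleton (FN.Traceless m M (k + l)) := by rw [hT]; infer_instance
    rw [Subsingleton.elim (FN.tracelessLie k l _ _) 0, map_zero]
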